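/- Let $(\Omega,\mathcal F,\mathbb P)$ be a probability space with a filtration $\mathfrak F=(\mathcal F_t)_{t\ge 0}$ satisfying the usual conditions (right-continuous, $\mathcal F_0$ contains all $\mathbb P$-null sets). Let $Y=(Y(t))_{t\ge 0}$ be a non-negative, right-continuous, $\mathfrak F$-adapted process with $\mathbb E(\sup_{t\ge 0}Y(t))<\infty$. For a process $X$ put $X(\infty):=\limsup_{t\to\infty}X(t)$. Stopping times take values in $[0,\infty]$. Let $n\ge 1$ and let $\delta_1,\delta_2,\dots$ be $[0,\infty]$-valued random variables with $\delta_1,\dots,\delta_{n-1}$ a.s. finite; only $\delta_1,\dots,\delta_{n-1}$ are relevant. For a filtration $\mathfrak A=(\mathcal A_t)_{t\ge0}$ and a measurable $\rho:\Omega\to[0,\infty]$, let $\mathfrak A^{\rho}$ be the smallest right-continuous filtration containing $\mathfrak A$ for which $\rho$ is a stopping time, i.e. the right-continuous filtration generated by $\big(\sigma(\mathcal A_t,\{\rho\le s\}: s\le t)\big)_{t\ge0}$, and put $\mathfrak A^{\rho_1,\dots,\rho_i}:=(\mathfrak A^{\rho_1,\dots,\rho_{i-1}})^{\rho_i}$.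 For a filtration $\mathfrak A$, waiting times $d=(d_1,d_2,\dots)$, $k\ge 0$ and an $\mathfrak A$-stopping time $\sigma$, let $\mathcal S^k_\sigma(d,\mathfrak A)$ be the set of all $(\tau_1,\dots,\tau_k)$ such that $\tau_1\ge\sigma$ is an $\mathfrak A$-stopping time and, for $i=2,\dots,k$, $\tau_i$ is an $\mathfrak A^{\tau_1+d_1,\dots,\tau_{i-1}+d_{i-1}}$-stopping time with $\tau_{i-1}+d_{i-1}\le\tau_i$; let $\mathcal S^k_\sigma(d,\mathfrak A)_{\mathrm{disc}}$ be the subset of those for which $\tau_1$ has countable range. Define $$Z_k^{d,\mathfrak A}(\sigma):=\operatorname*{ess\,sup}_{\tau\in\mathcal S^k_\sigma(d,\mathfrak A)}\mathbb E\Big(\sum_{i=1}^kY(\tau_i)\,\Big|\,\mathcal A_\sigma\Big),\qquad Z_k^{d,\mathfrak A}(\sigma)_{\mathrm{disc}}:=\operatorname*{ess\,sup}_{\tau\in\mathcal S^k_\sigma(d,\mathfrak A)_{\mathrm{disc}}}\mathbb E\Big(\sum_{i=1}^kY(\tau_i)\,\Big|\,\mathcal A_\sigma\Big),$$ so that $Z_0\equiv0$.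 Let $\delta=(\delta_1,\delta_2,\dots)$, $L\delta=(\delta_2,\delta_3,\dots)$ and $$\overline Z^{\delta}_{n-1}(t):=\mathbb E\big(Z_{n-1}^{L\delta,\mathfrak F^{t+\delta_1}}(t+\delta_1)\,\big|\,\mathcal F_t\big),\qquad t\ge 0.$$ **Theorem.** For every $t\ge0$ the essential supremum $Z_{n-1}^{L\delta,\mathfrak F^{t+\delta_1}}(t+\delta_1)$ exists and is integrable, and the process $\overline Z^{\delta}_{n-1}$ has a right-continuous modification. For every right-continuous modification $\overline Z^{\delta,r}_{n-1}$ of it, the process $Y_n:=Y+\overline Z^{\delta,r}_{n-1}$ is $\mathfrak F$-adapted and right-continuous, $Y_n(\tau)$ is integrable for every $\mathfrak F$-stopping time $\tau$, and for every $\mathfrak F$-stopping time $\sigma$ the following essential suprema exist and are a.s. equal: $$Z_n^{\delta,\mathfrak F}(\sigma)_{\mathrm{disc}}=\operatorname*{ess\,sup}_{\tau\ge\sigma,\ \tau\ \mathfrak F\text{-stopping time}}\mathbb E\big(Y_n(\tau)\,\big|\,\mathcal F_\sigma\big).$$ If moreover $\delta_1,\dots,\delta_{n-1}$ are $\mathfrak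 F$-stopping times, then for every $\mathfrak F$-stopping time $\sigma$ also $$Z_n^{\delta,\mathfrak F}(\sigma)=\operatorname*{ess\,sup}_{\tau\ge\sigma,\ \tau\ \mathfrak F\text{-stopping time}}\mathbb E\big(Y_n(\tau)\,\big|\,\mathcal F_\sigma\big),$$ where again both essential suprema exist. -/

import Mathlib

open MeasureTheory Filter Topology
open scoped NNReal ENNReal MeasureTheory.Filtration

namespace MultipleStopping

noncomputable section

/-- The process `X`, indexed by the times in `[0, ∞)` and evaluated at a random time
`τ : Ω → [0, ∞]`, with the convention `X(∞) = limsup_{t → ∞} X(t)`. -/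
def atTime {Ω : Type*} (X : ℝ≥0 → Ω → ℝ) (τ : Ω → WithTop ℝ≥0) (ω : Ω) : ℝ :=
  match τ ω with
  | none => limsup (fun t : ℝ≥0 => X t ω) atTop
  | some t => X t ω

/-- All paths of `X` are right-continuous. -/
def RightContinuousPaths {Ω : Type*} (X : ℝ≥0 → Ω → ℝ) : Prop :=
  ∀ ω t, ContinuousWithinAt (fun s => X s ω) (Set.Ici t) t

/-- The filtration `𝒢^ρ`, with `𝒢^ρ_t = σ({ρ ≤ s} : s ≤ t)`: the smallest filtration for which the
random time `ρ` is a stopping time. (The clause `MeasurableSet A` holds by itself for measurable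
`ρ`, the only case that occurs.) -/
def timeFiltration {Ω : Type*} {m : MeasurableSpace Ω} (ρ : Ω → WithTop ℝ≥0) :
    Filtration ℝ≥0 m where
  seq t := MeasurableSpace.generateFrom
    {A | MeasurableSet A ∧ ∃ s : ℝ≥0, s ≤ t ∧ A = {ω | ρ ω ≤ s}}
  mono' _ _ htu := MeasurableSpace.generateFrom_mono
    (fun _ hA => ⟨hA.1, hA.2.choose, hA.2.choose_spec.1.trans htu, hA.2.choose_spec.2⟩)
  le' _ := MeasurableSpace.generateFrom_le (fun _ hA => hA.1)

/-- The filtration `𝔄^ρ`: the right-continuous filtration generated by `(σ(𝒜_t, 𝒢^ρ_t))_{t ≥ 0}`. -/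
def adjoin {Ω : Type*} {m : MeasurableSpace Ω} (𝔄 : Filtration ℝ≥0 m) (ρ : Ω → WithTop ℝ≥0) :
    Filtration ℝ≥0 m :=
  (𝔄 ⊔ timeFiltration ρ)₊

theorem isStoppingTime_adjoin {Ω : Type*} {m : MeasurableSpace Ω} (𝔄 : Filtration ℝ≥0 m)
    {ρ : Ω → WithTop ℝ≥0} (hρ : ∀ t : ℝ≥0, MeasurableSet {ω | ρ ω ≤ t}) :
    IsStoppingTime (adjoin 𝔄 ρ) ρ := by
  intro t
  have h1 : MeasurableSet[timeFiltration (m := m) ρ t] {ω | ρ ω ≤ t} :=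
    MeasurableSpace.measurableSet_generateFrom ⟨hρ t, t, le_rfl, rfl⟩
  have h2 : timeFiltration (m := m) ρ ≤ adjoin 𝔄 ρ := le_sup_right.trans (Filtration.le_rightCont _)
  exact h2 t _ h1

/-- `𝔄^ρ` is the smallest right-continuous filtration that contains `𝔄` and for which `ρ` is a
stopping time. -/
theorem adjoin_le {Ω : Type*} {m : MeasurableSpace Ω} {𝔄 𝔅 : Filtration ℝ≥0 m}
    {ρ : Ω → WithTop ℝ≥0} (hB : 𝔅.IsRightContinuous) (hle : 𝔄 ≤ 𝔅) (hρ : IsStoppingTime 𝔅 ρ) :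
    adjoin 𝔄 ρ ≤ 𝔅 := by
  have h1 : timeFiltration (m := m) ρ ≤ 𝔅 := by
    intro t
    refine MeasurableSpace.generateFrom_le ?_
    rintro A ⟨-, s, hs, rfl⟩
    exact 𝔅.mono hs _ (hρ s)
  have h2 : 𝔄 ⊔ timeFiltration ρ ≤ 𝔅 := sup_le hle h1
  intro t
  refine le_trans ?_ (hB.RC t)
  rw [adjoin, Filtration.rightCont_eq, Filtration.rightCont_eq]
  exact iInf₂_mono fun j _ => h2 j

/-- The iterated filtration `𝔄^{ρ_0, …, ρ_{i-1}}`. -/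
def adjoinSeq {Ω : Type*} {m : MeasurableSpace Ω} (𝔄 : Filtration ℝ≥0 m)
    (ρ : ℕ → Ω → WithTop ℝ≥0) : ℕ → Filtration ℝ≥0 m
  | 0 => 𝔄
  | i + 1 => adjoin (adjoinSeq 𝔄 ρ i) (ρ i)

/-- The set `𝒮_σ^n(δ, 𝔉)` of exercise strategies with `n` exercises, not before `σ`. Strategies
`(τ_1, …, τ_n)` and waiting times `(δ_1, …, δ_{n-1})` are written as sequences indexed from `0`
(so `τ i` is the exercise time `τ_{i+1}` and `δ i` is `δ_{i+1}`), of which only the first `n`,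
resp. `n - 1`, entries matter. -/
def strategies {Ω : Type*} {m : MeasurableSpace Ω} (𝔉 : Filtration ℝ≥0 m)
    (δ : ℕ → Ω → WithTop ℝ≥0) (n : ℕ) (σ : Ω → WithTop ℝ≥0) : Set (ℕ → Ω → WithTop ℝ≥0) :=
  {τ | (0 < n → σ ≤ τ 0) ∧
    (∀ i, i < n → IsStoppingTime (adjoinSeq 𝔉 (fun j ω => τ j ω + δ j ω) i) (τ i)) ∧
    (∀ i, i + 1 < n → ∀ ω, τ i ω + δ i ω ≤ τ (i + 1) ω)}

/-- The set `𝒮_σ^n(δ, 𝔉)_disc`: the first exercise time has countable range. -/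
def strategiesDisc {Ω : Type*} {m : MeasurableSpace Ω} (𝔉 : Filtration ℝ≥0 m)
    (δ : ℕ → Ω → WithTop ℝ≥0) (n : ℕ) (σ : Ω → WithTop ℝ≥0) : Set (ℕ → Ω → WithTop ℝ≥0) :=
  {τ | τ ∈ strategies 𝔉 δ n σ ∧ (Set.range (τ 0)).Countable}

/-- `X` is (a version of) the essential supremum of the family `S` of random variables. -/
structure IsEssSup {Ω : Type*} {m : MeasurableSpace Ω} (μ : Measure Ω) (S : Set (Ω → ℝ))
    (X : Ω → ℝ) : Prop where
  measurable : Measurable X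
  upper : ∀ f ∈ S, f ≤ᵐ[μ] X
  least : ∀ g : Ω → ℝ, Measurable g → (∀ f ∈ S, f ≤ᵐ[μ] g) → X ≤ᵐ[μ] g

open Classical in
/-- A version of the essential supremum of the family `S` (and `0` if there is none). -/
def essSupFamily {Ω : Type*} {m : MeasurableSpace Ω} (μ : Measure Ω) (S : Set (Ω → ℝ)) : Ω → ℝ :=
  if h : ∃ X, IsEssSup μ S X then h.choose else 0

/-- The random variables `E(Y(τ_1) + … + Y(τ_n) | ℱ_σ)`, where `(τ_1, …, τ_n)` runs through `S`. -/
def rewards {Ω : Type*} {m : MeasurableSpace Ω} (μ : Measure Ω) (Y : ℝ≥0 → Ω → ℝ)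
    {𝔉 : Filtration ℝ≥0 m} {σ : Ω → WithTop ℝ≥0} (hσ : IsStoppingTime 𝔉 σ) (n : ℕ)
    (S : Set (ℕ → Ω → WithTop ℝ≥0)) : Set (Ω → ℝ) :=
  {f | ∃ τ ∈ S, f = μ[fun ω => ∑ i ∈ Finset.range n, atTime Y (τ i) ω | hσ.measurableSpace]}

/-- The value `Z_n^{δ,𝔉}(σ)` of the multiple stopping problem (almost surely `0` if `n = 0`). -/
def value {Ω : Type*} {m : MeasurableSpace Ω} (μ : Measure Ω) (Y : ℝ≥0 → Ω → ℝ)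
    {𝔉 : Filtration ℝ≥0 m} (δ : ℕ → Ω → WithTop ℝ≥0) (n : ℕ) {σ : Ω → WithTop ℝ≥0}
    (hσ : IsStoppingTime 𝔉 σ) : Ω → ℝ :=
  essSupFamily μ (rewards μ Y hσ n (strategies 𝔉 δ n σ))

/-- The value `Z_n^{δ,𝔉}(σ)_disc`. -/
def valueDisc {Ω : Type*} {m : MeasurableSpace Ω} (μ : Measure Ω) (Y : ℝ≥0 → Ω → ℝ)
    {𝔉 : Filtration ℝ≥0 m} (δ : ℕ → Ω → WithTop ℝ≥0) (n : ℕ) {σ : Ω → WithTop ℝ≥0}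
    (hσ : IsStoppingTime 𝔉 σ) : Ω → ℝ :=
  essSupFamily μ (rewards μ Y hσ n (strategiesDisc 𝔉 δ n σ))

/-- The shifted waiting times `Lδ = (δ_2, δ_3, …)`. -/
def shift {Ω : Type*} (δ : ℕ → Ω → WithTop ℝ≥0) : ℕ → Ω → WithTop ℝ≥0 := fun i => δ (i + 1)

/-- The random time `t + d`. -/
def delay {Ω : Type*} (t : ℝ≥0) (d : Ω → WithTop ℝ≥0) : Ω → WithTop ℝ≥0 := fun ω => t + d ω

theorem measurableSet_delay_le {Ω : Type*} {m : MeasurableSpace Ω} {d : Ω → WithTop ℝ≥0}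
    (hd : Measurable d) (t u : ℝ≥0) : MeasurableSet {ω | delay t d ω ≤ u} := by
  have key : ∀ x : WithTop ℝ≥0,
      (t : WithTop ℝ≥0) + x ≤ u ↔ t ≤ u ∧ x ≤ ((u - t : ℝ≥0) : WithTop ℝ≥0) := by
    intro x
    cases x with
    | top =>
      rw [WithTop.add_top, top_le_iff, top_le_iff]
      exact ⟨fun h => absurd h (WithTop.coe_ne_top), fun h => absurd h.2 (WithTop.coe_ne_top)⟩
    | coe a =>
      rw [← WithTop.coe_add, WithTop.coe_le_coe, WithTop.coe_le_coe]
      exact ⟨fun h => ⟨le_self_add.trans h, le_tsub_of_add_le_left h⟩,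
        fun h => (le_tsub_iff_left h.1).1 h.2⟩
  by_cases h : t ≤ u
  · have : {ω | delay t d ω ≤ u} = d ⁻¹' Set.Iic ((u - t : ℝ≥0) : WithTop ℝ≥0) := by
      ext ω
      exact (key (d ω)).trans (and_iff_right h)
    rw [this]
    exact hd measurableSet_Iic
  · have : {ω | delay t d ω ≤ u} = ∅ :=
      Set.eq_empty_of_forall_notMem fun ω hω => h ((key (d ω)).1 hω).1
    rw [this]
    exact MeasurableSet.empty

theorem isStoppingTime_delay {Ω : Type*} {m : MeasurableSpace Ω} (𝔉 : Filtration ℝ≥0 m)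
    {d : Ω → WithTop ℝ≥0} (hd : Measurable d) (t : ℝ≥0) :
    IsStoppingTime (adjoin 𝔉 (delay t d)) (delay t d) :=
  isStoppingTime_adjoin 𝔉 (measurableSet_delay_le hd t)

/-- `Z_k^{Lδ, 𝔉^{t+δ_1}}(t + δ_1)`: the value, at time `t + δ_1`, of the problem with `k` remaining
exercises after a first exercise at time `t`. -/
def remainingValue {Ω : Type*} {m : MeasurableSpace Ω} (μ : Measure Ω) (Y : ℝ≥0 → Ω → ℝ)
    (𝔉 : Filtration ℝ≥0 m) (δ : ℕ → Ω → WithTop ℝ≥0) (hδ : Measurable (δ 0)) (k : ℕ) (t : ℝ≥0) :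
    Ω → ℝ :=
  value μ Y (shift δ) k (isStoppingTime_delay 𝔉 hδ t)

/-- The process `t ↦ E(Z_k^{Lδ, 𝔉^{t+δ_1}}(t + δ_1) | ℱ_t)`. -/
def continuation {Ω : Type*} {m : MeasurableSpace Ω} (μ : Measure Ω) (Y : ℝ≥0 → Ω → ℝ)
    (𝔉 : Filtration ℝ≥0 m) (δ : ℕ → Ω → WithTop ℝ≥0) (hδ : Measurable (δ 0)) (k : ℕ) (t : ℝ≥0) :
    Ω → ℝ :=
  μ[remainingValue μ Y 𝔉 δ hδ k t | 𝔉 t]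

/-- `X'` is a right-continuous modification of `X`. -/
def IsRightContinuousModification {Ω : Type*} {m : MeasurableSpace Ω} (μ : Measure Ω)
    (X X' : ℝ≥0 → Ω → ℝ) : Prop :=
  RightContinuousPaths X' ∧ ∀ t, X' t =ᵐ[μ] X t

/-- The random variables `E(X(τ) | ℱ_σ)`, where `τ` runs through the stopping times `τ ≥ σ`. -/
def stoppingRewards {Ω : Type*} {m : MeasurableSpace Ω} (μ : Measure Ω) (X : ℝ≥0 → Ω → ℝ)
    {𝔉 : Filtration ℝ≥0 m} {σ : Ω → WithTop ℝ≥0} (hσ : IsStoppingTime 𝔉 σ) : Set (Ω → ℝ) :=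
  {f | ∃ τ, IsStoppingTime 𝔉 τ ∧ σ ≤ τ ∧ f = μ[atTime X τ | hσ.measurableSpace]}

end

end MultipleStopping

open MultipleStopping

/-! The principle is dynamic programming. Put k = n - 1 and let Z̄ be the process `continuation`. A
first exercise at a fixed time t earns Y(t), and Z̄(t) is the ℱ_t-conditional expectation of the
best the other k exercises can still earn.

For a first exercise time τ_1 with countable range this becomes exact on each fibre. The event {τ_1
= t} lies in ℱ_t, and on it the enlargements by τ_1 + δ_1 and by t + δ_1 have the same traces. Hence
the later exercises form an admissible strategy after t + δ_1 (`tail_mem_laterStrategies`) and earn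
at most Z̄(t). Conversely, countably many nearly optimal continuations, one for each value of the
first time, can be glued (`cons_mem_strategiesDisc`, `exists_setIntegral_totalReward_le`). In the
ordinary problem every stopping time is a limit from the right of dyadic ones, so right-continuity
of Y_n and Fatou's lemma reduce it to countable range.

The right-continuous version comes from Doob's regularisation
(`exists_isRightContinuousModification`). A later start leaves fewer strategies, so Z̄ is a
supermartingale (`strategies_delay_anti`). Delaying a nearly optimal strategy by a small h costs
little, so its mean is right-continuous (`tendsto_integral_continuation`).

Time ∞ has to match too: Z̄ tends to k Y(∞), so Y_n(∞) = (k + 1) Y(∞), the reward of n exercises at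
∞ (`ae_atTime_top_add`).

If the waiting times are stopping times, the enlargements add no information, and a whole strategy
can be delayed slightly to make its first time dyadic (`valueDisc_ae_eq_value`). -/

namespace MultipleStopping

/-! ### Dyadic times -/

/-- The dyadic time `k / 2 ^ m`. -/
noncomputable def dyadic (m k : ℕ) : ℝ≥0 := k / 2 ^ m

/-- The set of all dyadic times. -/
def dyadics : Set ℝ≥0 := Set.range fun p : ℕ × ℕ => dyadic p.1 p.2

/-- The least time on the `m`-th dyadic grid that is strictly larger than `t`. -/
noncomputable def ceilDyadic (m : ℕ) (t : ℝ≥0) : ℝ≥0 := dyadic m (⌊2 ^ m * t⌋₊ + 1)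

theorem dyadic_mem_dyadics (m k : ℕ) : dyadic m k ∈ dyadics := ⟨(m, k), rfl⟩

theorem countable_dyadics : dyadics.Countable := Set.countable_range _

theorem lt_ceilDyadic (m : ℕ) (t : ℝ≥0) : t < ceilDyadic m t := by
  rw [ceilDyadic, dyadic, lt_div_iff₀ (by positivity), mul_comm]
  exact_mod_cast Nat.lt_floor_add_one _

theorem ceilDyadic_le (m : ℕ) (t : ℝ≥0) : ceilDyadic m t ≤ t + (1 / 2) ^ m := by
  rw [ceilDyadic, dyadic, div_le_iff₀ (by positivity), add_mul, ← mul_pow]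
  have h := Nat.floor_le (zero_le (a := 2 ^ m * t))
  push_cast
  have h2 : (1 / 2 * 2 : ℝ≥0) = 1 := by norm_num
  rw [h2, one_pow, mul_comm t]
  gcongr

/-- Since `ceilDyadic` lies strictly above t, it stays at or below u exactly when t is strictly
below the last grid point not exceeding u. That condition is decided by time u, which is why
`approx` preserves stopping times. -/
theorem ceilDyadic_le_iff (m : ℕ) (t u : ℝ≥0) :
    ceilDyadic m t ≤ u ↔ t < dyadic m ⌊2 ^ m * u⌋₊ := by
  rw [ceilDyadic, dyadic, dyadic, div_le_iff₀ (by positivity), mul_comm u,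
    ← Nat.le_floor_iff zero_le, Nat.add_one_le_iff, lt_div_iff₀ (by positivity), mul_comm t,
    Nat.floor_lt zero_le]

theorem dyadic_floor_le (m : ℕ) (u : ℝ≥0) : dyadic m ⌊2 ^ m * u⌋₊ ≤ u := by
  rw [dyadic, div_le_iff₀ (by positivity), mul_comm u]
  exact Nat.floor_le zero_le

theorem tendsto_half_pow : Tendsto (fun m : ℕ => ((1 / 2 : ℝ≥0)) ^ m) atTop (𝓝 0) :=
  NNReal.tendsto_pow_atTop_nhds_zero_of_lt_one (by norm_num [← NNReal.coe_lt_coe])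

theorem tendsto_ceilDyadic (t : ℝ≥0) : Tendsto (fun m => ceilDyadic m t) atTop (𝓝[>] t) := by
  refine tendsto_nhdsWithin_iff.2 ⟨?_, Eventually.of_forall fun m => lt_ceilDyadic m t⟩
  refine tendsto_of_tendsto_of_tendsto_of_le_of_le tendsto_const_nhds ?_
    (fun m => (lt_ceilDyadic m t).le) (fun m => ceilDyadic_le m t)
  simpa using tendsto_half_pow.const_add t

theorem tendsto_ceilDyadic_inf (t : ℝ≥0) :
    Tendsto (fun m => ceilDyadic m t) atTop (𝓝[>] t ⊓ 𝓟 dyadics) :=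
  tendsto_inf.2 ⟨tendsto_ceilDyadic t,
    tendsto_principal.2 (Eventually.of_forall fun _ => dyadic_mem_dyadics _ _)⟩

instance neBot_nhdsGT_inf_dyadics (t : ℝ≥0) : (𝓝[>] t ⊓ 𝓟 dyadics).NeBot :=
  (tendsto_ceilDyadic_inf t).neBot

theorem exists_dyadic_between {s t : ℝ≥0} (h : s < t) : ∃ q ∈ dyadics, s < q ∧ q < t := by
  have h1 : ∀ᶠ m in atTop, ceilDyadic m s < t :=
    ((tendsto_ceilDyadic s).mono_right nhdsWithin_le_nhds).eventually (gt_mem_nhds h)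
  obtain ⟨m, hm⟩ := h1.exists
  exact ⟨_, dyadic_mem_dyadics _ _, lt_ceilDyadic m s, hm⟩

theorem dyadic_succ (m k : ℕ) : dyadic (m + 1) (2 * k) = dyadic m k := by
  rw [dyadic, dyadic, pow_succ]
  push_cast
  rw [mul_comm (2 : ℝ≥0) k, mul_div_mul_right _ _ (by norm_num)]

theorem dyadic_add (m j k : ℕ) : dyadic (m + j) (2 ^ j * k) = dyadic m k := by
  induction j with
  | zero => simp
  | succ j ih =>
    rw [← ih, ← dyadic_succ (m + j), pow_succ, ← add_assoc, ← mul_assoc, mul_comm 2 (2 ^ j)]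

theorem dyadic_mono (m : ℕ) : Monotone (dyadic m) := fun _ _ h => by
  unfold dyadic
  gcongr

theorem dyadic_zero_left (k : ℕ) : dyadic 0 k = k := by simp [dyadic]

theorem lt_of_dyadic_lt {m j k : ℕ} (h : dyadic m j < dyadic m k) : j < k :=
  lt_of_not_ge fun h' => (h.trans_le (dyadic_mono m h')).false

/-! ### Values at random times -/

section atTime

variable {Ω : Type*} {X : ℝ≥0 → Ω → ℝ} {τ : Ω → WithTop ℝ≥0} {ω : Ω}

theorem atTime_coe {t : ℝ≥0} (h : τ ω = t) : atTime X τ ω = X t ω := by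
  unfold atTime
  rw [h]

theorem atTime_top (h : τ ω = ⊤) : atTime X τ ω = limsup (fun t => X t ω) atTop := by
  unfold atTime
  rw [h]

theorem atTime_congr {τ' : Ω → WithTop ℝ≥0} (h : τ ω = τ' ω) : atTime X τ ω = atTime X τ' ω := by
  unfold atTime
  rw [h]

/-- At finite times this is right-continuity. Where τ = ∞ the lower bound forces the approximating
times to be ∞ as well, so nothing about the behaviour at infinity is needed. -/
theorem tendsto_atTime (hX : RightContinuousPaths X) {τm : ℕ → Ω → WithTop ℝ≥0} {ε : ℕ → ℝ≥0}
    (hε : Tendsto ε atTop (𝓝 0)) (h1 : ∀ m, τ ω ≤ τm m ω) (h2 : ∀ m, τm m ω ≤ τ ω + ε m) :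
    Tendsto (fun m => atTime X (τm m) ω) atTop (𝓝 (atTime X τ ω)) := by
  cases h : τ ω with
  | top =>
    have : ∀ m, τm m ω = τ ω := fun m => by
      rw [h, ← top_le_iff, ← h]; exact h1 m
    simp_rw [fun m => atTime_congr (X := X) (this m)]
    exact tendsto_const_nhds
  | coe t =>
    have h3 : ∀ m, ∃ s : ℝ≥0, τm m ω = s := fun m => by
      have : τm m ω ≠ ⊤ := by
        intro h'
        have := h2 m
        rw [h', h, top_le_iff, ← WithTop.coe_add] at this
        exact WithTop.coe_ne_top this
      obtain ⟨s, hs⟩ := WithTop.ne_top_iff_exists.1 this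
      exact ⟨s, hs.symm⟩
    choose s hs using h3
    simp_rw [fun m => atTime_coe (X := X) (hs m), atTime_coe (X := X) h]
    refine (hX ω t).tendsto.comp (tendsto_nhdsWithin_iff.2 ⟨?_, Eventually.of_forall fun m => ?_⟩)
    · refine tendsto_of_tendsto_of_tendsto_of_le_of_le (g := fun _ => t) (h := fun m => t + ε m)
        tendsto_const_nhds ?_ (fun m => ?_) (fun m => ?_)
      · simpa using hε.const_add t
      · have := h1 m
        rw [h, hs] at this
        exact_mod_cast this
      · have := h2 m
        rw [h, hs] at this
        exact_mod_cast this
    · have := h1 m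
      rw [h, hs] at this
      exact_mod_cast this

/-- The approximation of a random time from the right by dyadic times. -/
noncomputable def approx (m : ℕ) (τ : Ω → WithTop ℝ≥0) (ω : Ω) : WithTop ℝ≥0 :=
  (τ ω).map (ceilDyadic m)

theorem le_approx (m : ℕ) (τ : Ω → WithTop ℝ≥0) (ω : Ω) : τ ω ≤ approx m τ ω := by
  unfold approx
  cases τ ω with
  | top => simp
  | coe t => exact WithTop.coe_le_coe.2 (lt_ceilDyadic m t).le

theorem approx_le (m : ℕ) (τ : Ω → WithTop ℝ≥0) (ω : Ω) :
    approx m τ ω ≤ τ ω + ((1 / 2 : ℝ≥0) ^ m : ℝ≥0) := by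
  unfold approx
  cases τ ω with
  | top => rw [WithTop.top_add]; exact le_top
  | coe t => rw [WithTop.map_coe, ← WithTop.coe_add]; exact WithTop.coe_le_coe.2 (ceilDyadic_le m t)

theorem approx_le_coe_iff (m : ℕ) (τ : Ω → WithTop ℝ≥0) (ω : Ω) (u : ℝ≥0) :
    approx m τ ω ≤ u ↔ τ ω < dyadic m ⌊2 ^ m * u⌋₊ := by
  unfold approx
  cases τ ω with
  | top =>
    exact ⟨fun h => absurd (top_le_iff.1 h) WithTop.coe_ne_top, fun h => absurd h not_top_lt⟩
  | coe t =>
    rw [WithTop.map_coe, WithTop.coe_le_coe, WithTop.coe_lt_coe, ceilDyadic_le_iff]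

theorem countable_range_approx (m : ℕ) (τ : Ω → WithTop ℝ≥0) :
    (Set.range (approx m τ)).Countable := by
  have : (insert ⊤ ((fun t : ℝ≥0 => (t : WithTop ℝ≥0)) '' dyadics)).Countable :=
    (countable_dyadics.image _).insert _
  refine this.mono ?_
  rintro _ ⟨ω, rfl⟩
  unfold approx
  cases τ ω with
  | top => exact Set.mem_insert _ _
  | coe t => exact Set.mem_insert_of_mem _ ⟨ceilDyadic m t, dyadic_mem_dyadics _ _, rfl⟩

theorem tendsto_atTime_approx (hX : RightContinuousPaths X) :
    Tendsto (fun m => atTime X (approx m τ) ω) atTop (𝓝 (atTime X τ ω)) :=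
  tendsto_atTime hX tendsto_half_pow (fun m => le_approx m τ ω) (fun m => approx_le m τ ω)

theorem isStoppingTime_approx {m : MeasurableSpace Ω} {𝔉 : Filtration ℝ≥0 m}
    (hτ : IsStoppingTime 𝔉 τ) (j : ℕ) : IsStoppingTime 𝔉 (approx j τ) := by
  intro u
  have : {ω | approx j τ ω ≤ u} = {ω | τ ω < dyadic j ⌊2 ^ j * u⌋₊} := by
    ext ω
    exact approx_le_coe_iff j τ ω u
  rw [this]
  exact 𝔉.mono (dyadic_floor_le j u) _ (hτ.measurableSet_lt _)

theorem measurable_approx {m : MeasurableSpace Ω} (hτ : Measurable τ) (j : ℕ) :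
    Measurable (approx j τ) := by
  refine measurable_of_Iic fun i => ?_
  cases i with
  | top => simp
  | coe u =>
    have : approx j τ ⁻¹' Set.Iic (u : WithTop ℝ≥0) = τ ⁻¹' Set.Iio ↑(dyadic j ⌊2 ^ j * u⌋₊) := by
      ext ω
      exact approx_le_coe_iff j τ ω u
    rw [this]
    exact hτ measurableSet_Iio

theorem aemeasurable_of_countable_range {β γ : Type*} [MeasurableSpace γ] {m : MeasurableSpace Ω}
    {μ : Measure Ω} {p : Ω → β} (hp : (Set.range p).Countable) {f : Ω → γ}
    (h : ∀ x ∈ Set.range p, AEMeasurable f (μ.restrict (p ⁻¹' {x}))) : AEMeasurable f μ := by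
  have := hp.to_subtype
  have h1 : AEMeasurable f (μ.restrict (⋃ x : Set.range p, p ⁻¹' {(x : β)})) :=
    aemeasurable_iUnion_iff.2 fun x => h x x.2
  have h2 : ⋃ x : Set.range p, p ⁻¹' {(x : β)} = Set.univ := by
    ext ω
    simp
  rwa [h2, Measure.restrict_univ] at h1

/-- The value at ∞ is a limsup over uncountably many times, so its measurability is a separate
hypothesis. -/
theorem aemeasurable_atTime_of_countable {m : MeasurableSpace Ω} {μ : Measure Ω}
    (hX : ∀ t, AEMeasurable (X t) μ) (hX' : AEMeasurable (atTime X fun _ => ⊤) μ)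
    (hτ : Measurable τ) (hτ' : (Set.range τ).Countable) : AEMeasurable (atTime X τ) μ := by
  refine aemeasurable_of_countable_range hτ' fun x _ => ?_
  have hx : MeasurableSet (τ ⁻¹' {x}) := hτ (measurableSet_singleton x)
  cases x with
  | top =>
    refine hX'.restrict.congr ((ae_restrict_iff' hx).2 (Eventually.of_forall fun ω hω => ?_))
    exact atTime_congr (Eq.symm hω)
  | coe t =>
    refine (hX t).restrict.congr ((ae_restrict_iff' hx).2 (Eventually.of_forall fun ω hω => ?_))
    exact (atTime_coe hω).symm

theorem aemeasurable_atTime {m : MeasurableSpace Ω} {μ : Measure Ω} (hXr : RightContinuousPaths X)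
    (hX : ∀ t, AEMeasurable (X t) μ) (hX' : AEMeasurable (atTime X fun _ => ⊤) μ)
    (hτ : Measurable τ) : AEMeasurable (atTime X τ) μ :=
  aemeasurable_of_tendsto_metrizable_ae' (fun j => aemeasurable_atTime_of_countable hX hX'
    (measurable_approx hτ j) (countable_range_approx j τ))
    (Eventually.of_forall fun _ => tendsto_atTime_approx hXr)

end atTime

/-! ### Sums of random times -/

/-- A dyadic q fits strictly between x and u - y. Strict sublevel sets of a sum thus become
countable unions of sets that involve each summand only up to u. -/
theorem add_lt_coe_iff {x y : WithTop ℝ≥0} {u : ℝ≥0} :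
    x + y < u ↔ ∃ q ∈ dyadics, q ≤ u ∧ x < q ∧ y < ((u - q : ℝ≥0) : WithTop ℝ≥0) := by
  constructor
  · intro h
    cases x with
    | top => rw [WithTop.top_add] at h; exact absurd h not_top_lt
    | coe x =>
      cases y with
      | top => rw [WithTop.add_top] at h; exact absurd h not_top_lt
      | coe y =>
        rw [← WithTop.coe_add, WithTop.coe_lt_coe] at h
        obtain ⟨q, hq, h1, h2⟩ := exists_dyadic_between (lt_tsub_iff_right.2 h)
        have h3 : q + y < u := lt_tsub_iff_right.1 h2
        refine ⟨q, hq, (le_self_add.trans h3.le), WithTop.coe_lt_coe.2 h1, WithTop.coe_lt_coe.2 ?_⟩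
        exact lt_tsub_iff_left.2 h3
  · rintro ⟨q, -, hqu, h1, h2⟩
    calc x + y < q + ((u - q : ℝ≥0) : WithTop ℝ≥0) := WithTop.add_lt_add h1 h2
      _ = u := by rw [← WithTop.coe_add, add_tsub_cancel_of_le hqu]

theorem measurableSet_add_lt {Ω : Type*} {m' : MeasurableSpace Ω} {τ d : Ω → WithTop ℝ≥0} {u : ℝ≥0}
    (hτ : ∀ v : ℝ≥0, v ≤ u → MeasurableSet {ω | τ ω < v})
    (hd : ∀ v : ℝ≥0, v ≤ u → MeasurableSet {ω | d ω < v}) :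
    MeasurableSet {ω | τ ω + d ω < u} := by
  have : {ω | τ ω + d ω < u} = ⋃ q ∈ dyadics, ⋃ _ : q ≤ u,
      {ω | τ ω < q} ∩ {ω | d ω < ((u - q : ℝ≥0) : WithTop ℝ≥0)} := by
    ext ω
    simp only [Set.mem_ofPred_eq, add_lt_coe_iff, Set.mem_iUnion, Set.mem_inter_iff, exists_prop]
  rw [this]
  exact MeasurableSet.biUnion countable_dyadics fun q _ => MeasurableSet.iUnion fun hq =>
    (hτ q hq).inter (hd _ tsub_le_self)

theorem measurable_add {Ω : Type*} {m : MeasurableSpace Ω} {τ d : Ω → WithTop ℝ≥0}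
    (hτ : Measurable τ) (hd : Measurable d) : Measurable fun ω => τ ω + d ω := by
  have key : ∀ u : ℝ≥0, MeasurableSet {ω | τ ω + d ω < u} := fun u =>
    measurableSet_add_lt (fun v _ => hτ measurableSet_Iio) (fun v _ => hd measurableSet_Iio)
  refine measurable_of_Iio fun x => ?_
  cases x with
  | coe u => exact key u
  | top =>
    have : (fun ω => τ ω + d ω) ⁻¹' Set.Iio ⊤ = ⋃ k : ℕ, {ω | τ ω + d ω < (k : ℝ≥0)} := by
      ext ω
      simp only [Set.mem_preimage, Set.mem_Iio, Set.mem_iUnion, Set.mem_ofPred_eq]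
      constructor
      · intro h
        obtain ⟨x, hx⟩ := WithTop.ne_top_iff_exists.1 h.ne
        obtain ⟨k, hk⟩ := exists_nat_gt x
        exact ⟨k, by rw [← hx]; exact_mod_cast hk⟩
      · rintro ⟨k, hk⟩
        exact hk.trans_le le_top
    rw [this]
    exact MeasurableSet.iUnion fun k => key k

/-- The countable decomposition handles only strict inequalities; right-continuity of the filtration
makes them sufficient. -/
theorem isStoppingTime_add {Ω : Type*} {m : MeasurableSpace Ω} {𝔉 : Filtration ℝ≥0 m}
    (h𝔉 : 𝔉.IsRightContinuous) {τ d : Ω → WithTop ℝ≥0} (hτ : IsStoppingTime 𝔉 τ)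
    (hd : IsStoppingTime 𝔉 d) : IsStoppingTime 𝔉 fun ω => τ ω + d ω :=
  isStoppingTime_of_measurableSet_lt_of_isRightContinuous fun _ =>
    measurableSet_add_lt (fun v hv => 𝔉.mono hv _ (hτ.measurableSet_lt v))
      (fun v hv => 𝔉.mono hv _ (hd.measurableSet_lt v))

theorem add_coe_le_coe_iff {x : WithTop ℝ≥0} {h u : ℝ≥0} :
    x + h ≤ u ↔ h ≤ u ∧ x ≤ ((u - h : ℝ≥0) : WithTop ℝ≥0) := by
  cases x with
  | top =>
    rw [WithTop.top_add, top_le_iff, top_le_iff]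
    exact ⟨fun h => absurd h WithTop.coe_ne_top, fun h => absurd h.2 WithTop.coe_ne_top⟩
  | coe a =>
    rw [← WithTop.coe_add, WithTop.coe_le_coe, WithTop.coe_le_coe]
    exact ⟨fun h => ⟨le_add_self.trans h, le_tsub_of_add_le_right h⟩,
      fun h => (le_tsub_iff_right h.1).1 h.2⟩

theorem isStoppingTime_add_const {Ω : Type*} {m : MeasurableSpace Ω} {𝔉 : Filtration ℝ≥0 m}
    {τ : Ω → WithTop ℝ≥0} (hτ : IsStoppingTime 𝔉 τ) (h : ℝ≥0) :
    IsStoppingTime 𝔉 fun ω => τ ω + h := by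
  intro u
  simp only [add_coe_le_coe_iff]
  by_cases hu : h ≤ u
  · simp only [hu, true_and]
    exact 𝔉.mono tsub_le_self _ (hτ _)
  · simp [hu]

/-! ### The running supremum -/

/-- The supremum of the path of `Y` from time `T` on. -/
noncomputable def supFrom {Ω : Type*} (Y : ℝ≥0 → Ω → ℝ) (T : ℝ≥0) (ω : Ω) : ℝ≥0∞ :=
  ⨆ t, ENNReal.ofReal (Y (T + t) ω)

section supFrom

variable {Ω : Type*} {Y : ℝ≥0 → Ω → ℝ} {ω : Ω}

/-- By right-continuity every value is a limit of values at T plus dyadic times. The uncountable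
supremum is therefore a countable one, hence measurable. -/
theorem supFrom_eq_dyadic (hY : RightContinuousPaths Y) (T : ℝ≥0) :
    supFrom Y T ω = ⨆ p : ℕ × ℕ, ENNReal.ofReal (Y (T + dyadic p.1 p.2) ω) := by
  refine le_antisymm (iSup_le fun t => ?_) (iSup_le fun p => le_iSup (fun t =>
    ENNReal.ofReal (Y (T + t) ω)) _)
  have h1 : Tendsto (fun m => T + ceilDyadic m t) atTop (𝓝[≥] (T + t)) := by
    refine tendsto_nhdsWithin_iff.2 ⟨?_, Eventually.of_forall fun m => ?_⟩
    · exact ((tendsto_ceilDyadic t).mono_right nhdsWithin_le_nhds).const_add T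
    · have := (lt_ceilDyadic m t).le
      simp only [Set.mem_Ici]
      gcongr
  have h2 := (ENNReal.continuous_ofReal.tendsto _).comp ((hY ω (T + t)).tendsto.comp h1)
  exact le_of_tendsto h2 (Eventually.of_forall fun m =>
    le_iSup (fun p : ℕ × ℕ => ENNReal.ofReal (Y (T + dyadic p.1 p.2) ω)) (m, ⌊2 ^ m * t⌋₊ + 1))

theorem measurable_supFrom {m : MeasurableSpace Ω} (hY : RightContinuousPaths Y)
    (hYm : ∀ t, Measurable (Y t)) (T : ℝ≥0) : Measurable (supFrom Y T) := by
  rw [funext fun ω => supFrom_eq_dyadic (ω := ω) hY T]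
  exact Measurable.iSup fun p => (hYm _).ennreal_ofReal

theorem ofReal_le_supFrom {T t : ℝ≥0} (h : T ≤ t) : ENNReal.ofReal (Y t ω) ≤ supFrom Y T ω := by
  have := le_iSup (fun t => ENNReal.ofReal (Y (T + t) ω)) (t - T)
  rwa [add_tsub_cancel_of_le h] at this

theorem supFrom_anti : Antitone fun T => supFrom Y T ω := fun S T h => by
  refine iSup_le fun t => ?_
  exact ofReal_le_supFrom (h.trans le_self_add)

theorem supFrom_ne_top (h : supFrom Y 0 ω ≠ ∞) (T : ℝ≥0) : supFrom Y T ω ≠ ∞ :=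
  ne_top_of_le_ne_top h (supFrom_anti zero_le)

theorem le_toReal_supFrom (h : supFrom Y 0 ω ≠ ∞) {T t : ℝ≥0} (hT : T ≤ t) :
    Y t ω ≤ (supFrom Y T ω).toReal :=
  (ENNReal.ofReal_le_iff_le_toReal (supFrom_ne_top h T)).1 (ofReal_le_supFrom hT)

theorem isBoundedUnder_le_atTop (h : supFrom Y 0 ω ≠ ∞) :
    IsBoundedUnder (· ≤ ·) atTop fun t => Y t ω :=
  isBoundedUnder_of ⟨_, fun _ => le_toReal_supFrom h zero_le⟩

theorem isBoundedUnder_ge_atTop (h0 : ∀ t ω, 0 ≤ Y t ω) (l : Filter ℝ≥0) :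
    IsBoundedUnder (· ≥ ·) l fun t => Y t ω :=
  isBoundedUnder_of ⟨0, fun t => h0 t ω⟩

/-- Once the path stays below a level b above its limsup, so do the tail suprema. This makes Y(∞)
measurable almost everywhere and later supplies the upper barrier for the continuation value at
infinity. -/
theorem tendsto_supFrom (h0 : ∀ t ω, 0 ≤ Y t ω) (h : supFrom Y 0 ω ≠ ∞) :
    Tendsto (fun N : ℕ => (supFrom Y N ω).toReal) atTop (𝓝 (limsup (fun t => Y t ω) atTop)) := by
  have hle : ∀ N : ℕ, limsup (fun t => Y t ω) atTop ≤ (supFrom Y N ω).toReal := fun N =>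
    limsup_le_of_le (isBoundedUnder_ge_atTop h0 _).isCoboundedUnder_le
      ((eventually_ge_atTop (N : ℝ≥0)).mono fun t ht => le_toReal_supFrom h ht)
  refine tendsto_order.2 ⟨fun a ha => Eventually.of_forall fun N => ha.trans_le (hle N),
    fun a ha => ?_⟩
  obtain ⟨b, hb, hba⟩ := exists_between ha
  have hev := eventually_lt_of_limsup_lt hb (isBoundedUnder_le_atTop h)
  obtain ⟨T, hT⟩ := eventually_atTop.1 hev
  have hb0 : 0 ≤ b := (h0 T ω).trans (hT T le_rfl).le
  obtain ⟨N0, hN0⟩ := exists_nat_ge T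
  filter_upwards [eventually_ge_atTop N0] with N hN
  refine lt_of_le_of_lt (ENNReal.toReal_le_of_le_ofReal hb0 (iSup_le fun t => ?_)) hba
  exact ENNReal.ofReal_le_ofReal (hT _ ((hN0.trans (by exact_mod_cast hN)).trans le_self_add)).le

theorem atTime_nonneg (h0 : ∀ t ω, 0 ≤ Y t ω) (h : supFrom Y 0 ω ≠ ∞) (τ : Ω → WithTop ℝ≥0) :
    0 ≤ atTime Y τ ω := by
  cases hτ : τ ω with
  | coe t => rw [atTime_coe hτ]; exact h0 t ω
  | top =>
    rw [atTime_top hτ]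
    exact ge_of_tendsto' (tendsto_supFrom h0 h) fun N => ENNReal.toReal_nonneg

theorem atTime_le (h0 : ∀ t ω, 0 ≤ Y t ω) (h : supFrom Y 0 ω ≠ ∞) {τ : Ω → WithTop ℝ≥0} {T : ℝ≥0}
    (hT : T ≤ τ ω) : atTime Y τ ω ≤ (supFrom Y T ω).toReal := by
  cases hτ : τ ω with
  | coe t =>
    rw [atTime_coe hτ]
    rw [hτ] at hT
    exact le_toReal_supFrom h (by exact_mod_cast hT)
  | top =>
    rw [atTime_top hτ]
    exact limsup_le_of_le (isBoundedUnder_ge_atTop h0 _).isCoboundedUnder_le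
      ((eventually_ge_atTop T).mono fun t ht => le_toReal_supFrom h ht)

end supFrom

/-! ### Essential suprema of directed families -/

section EssSup

variable {Ω : Type*} {m : MeasurableSpace Ω} {μ : Measure Ω} {S : Set (Ω → ℝ)} {X : Ω → ℝ}

theorem IsEssSup.ae_eq {X' : Ω → ℝ} (h : IsEssSup μ S X) (h' : IsEssSup μ S X') : X =ᵐ[μ] X' :=
  (h.least X' h'.measurable h'.upper).antisymm (h'.least X h.measurable h.upper)

theorem IsEssSup.essSupFamily (h : IsEssSup μ S X) : IsEssSup μ S (essSupFamily μ S) := by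
  have h' : ∃ X, IsEssSup μ S X := ⟨X, h⟩
  rw [MultipleStopping.essSupFamily, dif_pos h']
  exact h'.choose_spec

theorem exists_monotone_seq_of_directed 
    (hdir : ∀ f ∈ S, ∀ g ∈ S, ∃ h ∈ S, f ≤ᵐ[μ] h ∧ g ≤ᵐ[μ] h) (f : ℕ → Ω → ℝ) (hf : ∀ j, f j ∈ S) :
    ∃ h : ℕ → Ω → ℝ, (∀ j, h j ∈ S) ∧ (∀ j, h j ≤ᵐ[μ] h (j + 1)) ∧ ∀ j, f j ≤ᵐ[μ] h j := by
  choose! D hD h1 h2 using hdir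
  let h : ℕ → Ω → ℝ := fun j => Nat.rec (f 0) (fun j g => D g (f (j + 1))) j
  have hS' : ∀ j, h j ∈ S := fun j => by
    induction j with
    | zero => exact hf 0
    | succ j ih => exact hD _ ih _ (hf _)
  refine ⟨h, hS', fun j => h1 _ (hS' j) _ (hf (j + 1)), fun j => ?_⟩
  cases j with
  | zero => exact EventuallyLE.refl _ _
  | succ j => exact h2 _ (hS' j) _ (hf (j + 1))

/-- Directedness gives an increasing sequence in S whose integrals tend to the supremum of the
integrals over S; its monotone limit is the essential supremum. The final clause is the source of
all ε-optimal strategies. -/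
theorem exists_isEssSup_of_directed (hS : S.Nonempty) (hint : ∀ f ∈ S, Integrable f μ)
    (hdir : ∀ f ∈ S, ∀ g ∈ S, ∃ h ∈ S, f ≤ᵐ[μ] h ∧ g ≤ᵐ[μ] h) {C : ℝ} (hC : ∀ f ∈ S, ∫ ω, f ω ∂μ ≤ C) :
    ∃ X, IsEssSup μ S X ∧ Integrable X μ ∧
      ∀ ε > 0, ∃ f ∈ S, ∫ ω, X ω ∂μ ≤ ∫ ω, f ω ∂μ + ε := by
  set I : Set ℝ := (fun f : Ω → ℝ => ∫ ω, f ω ∂μ) '' S with hI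
  have hIne : I.Nonempty := hS.image _
  have hIbdd : BddAbove I := ⟨C, by rintro _ ⟨f, hf, rfl⟩; exact hC f hf⟩
  have hle : ∀ f ∈ S, ∫ ω, f ω ∂μ ≤ sSup I := fun f hf => le_csSup hIbdd ⟨f, hf, rfl⟩
  have hex : ∀ j : ℕ, ∃ f ∈ S, sSup I - (1 / 2 : ℝ) ^ j < ∫ ω, f ω ∂μ := fun j => by
    obtain ⟨_, ⟨f, hf, rfl⟩, h⟩ := exists_lt_of_lt_csSup hIne
      (sub_lt_self (sSup I) (pow_pos (one_half_pos (α := ℝ)) j))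
    exact ⟨f, hf, h⟩
  choose f hf hfI using hex
  obtain ⟨h, hhS, hmono, hfh⟩ := exists_monotone_seq_of_directed hdir f hf
  have hhI : ∀ j, sSup I - (1 / 2 : ℝ) ^ j ≤ ∫ ω, h j ω ∂μ := fun j =>
    (hfI j).le.trans (integral_mono_ae (hint _ (hf j)) (hint _ (hhS j)) (hfh j))
  have hmono' : ∀ᵐ ω ∂μ, Monotone fun j => h j ω := by
    filter_upwards [ae_all_iff.2 hmono] with ω hω
    exact monotone_nat_of_le_succ hω
  -- Subtracting h 0 makes the sequence non-negative, as monotone convergence for the Lebesgue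
  -- integral requires.
  set g : ℕ → Ω → ℝ≥0∞ := fun j ω => ENNReal.ofReal (h j ω - h 0 ω) with hg
  have hgi : ∀ j, Integrable (fun ω => h j ω - h 0 ω) μ := fun j =>
    (hint _ (hhS j)).sub (hint _ (hhS 0))
  have hgm : ∀ j, AEMeasurable (g j) μ := fun j => (hgi j).aemeasurable.ennreal_ofReal
  have hgint : ∀ j, ∫⁻ ω, g j ω ∂μ ≤ ENNReal.ofReal (sSup I - ∫ ω, h 0 ω ∂μ) := fun j => by
    have h0 : 0 ≤ᵐ[μ] fun ω => h j ω - h 0 ω := by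
      filter_upwards [hmono'] with ω hω
      exact sub_nonneg.2 (hω (Nat.zero_le j))
    rw [hg, ← ofReal_integral_eq_lintegral_ofReal (hgi j) h0,
      integral_sub (hint _ (hhS j)) (hint _ (hhS 0))]
    exact ENNReal.ofReal_le_ofReal (sub_le_sub_right (hle _ (hhS j)) _)
  have hG : ∫⁻ ω, ⨆ j, g j ω ∂μ ≤ ENNReal.ofReal (sSup I - ∫ ω, h 0 ω ∂μ) := by
    rw [lintegral_iSup' hgm]
    · exact iSup_le hgint
    · filter_upwards [hmono'] with ω hω i j hij
      exact ENNReal.ofReal_le_ofReal (sub_le_sub_right (hω hij) _)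
  have hGm : AEMeasurable (fun ω => ⨆ j, g j ω) μ := AEMeasurable.iSup hgm
  have hGfin : ∀ᵐ ω ∂μ, ⨆ j, g j ω < ∞ := ae_lt_top' hGm (hG.trans_lt ENNReal.ofReal_lt_top).ne
  have hGint : Integrable (fun ω => (⨆ j, g j ω).toReal) μ :=
    integrable_toReal_of_lintegral_ne_top hGm (hG.trans_lt ENNReal.ofReal_lt_top).ne
  set X0 : Ω → ℝ := fun ω => h 0 ω + (⨆ j, g j ω).toReal with hX0
  have hX0int : Integrable X0 μ := (hint _ (hhS 0)).add hGint
  have hX0I : ∫ ω, X0 ω ∂μ ≤ sSup I := by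
    rw [hX0, integral_add (hint _ (hhS 0)) hGint, integral_toReal hGm hGfin]
    have := ENNReal.toReal_le_of_le_ofReal (sub_nonneg.2 (hle _ (hhS 0))) hG
    linarith
  have hhX : ∀ᵐ ω ∂μ, ∀ j, h j ω ≤ X0 ω := by
    filter_upwards [hGfin] with ω hω j
    have := (ENNReal.ofReal_le_iff_le_toReal hω.ne).1 (le_iSup (fun j => g j ω) j)
    simp only [hX0]
    linarith
  have hupper : ∀ f ∈ S, f ≤ᵐ[μ] X0 := fun f hf => by
    have hpint : Integrable (fun ω => max (f ω - X0 ω) 0) μ :=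
      by
      simpa using ((hint f hf).sub hX0int).pos_part
    -- A common upper bound k of f and h j gives (f - X0)⁺ ≤ k - h j, since X0 ≥ h j. The right side
    -- integrates to at most 2⁻ʲ, because ∫ k cannot exceed the supremum that ∫ h j nearly attains.
    have hbound : ∀ j : ℕ, ∫ ω, max (f ω - X0 ω) 0 ∂μ ≤ (1 / 2 : ℝ) ^ j := fun j => by
      obtain ⟨k, hk, hk1, hk2⟩ := hdir f hf (h j) (hhS j)
      have h1 : ∫ ω, max (f ω - X0 ω) 0 ∂μ ≤ ∫ ω, (k ω - h j ω) ∂μ := by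
        refine integral_mono_ae hpint ((hint k hk).sub (hint _ (hhS j))) ?_
        filter_upwards [hk1, hk2, hhX] with ω h1 h2 h3
        have := h3 j
        exact max_le (by linarith) (by linarith)
      rw [integral_sub (hint k hk) (hint _ (hhS j))] at h1
      have h2 := hle k hk
      have h3 := hhI j
      linarith
    have hlim : ∫ ω, max (f ω - X0 ω) 0 ∂μ ≤ 0 :=
      ge_of_tendsto' (tendsto_pow_atTop_nhds_zero_of_lt_one (by norm_num) (by norm_num)) hbound
    have h0 : ∫ ω, max (f ω - X0 ω) 0 ∂μ = 0 :=
      hlim.antisymm (integral_nonneg fun ω => le_max_right _ _)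
    have h1 := (integral_eq_zero_iff_of_nonneg (fun ω => le_max_right _ _) hpint).1 h0
    filter_upwards [h1] with ω hω
    have : f ω - X0 ω ≤ 0 := by
      rw [← show max (f ω - X0 ω) 0 = 0 from hω]
      exact le_max_left _ _
    linarith
  have hX : X0 =ᵐ[μ] hX0int.aemeasurable.mk X0 := hX0int.aemeasurable.ae_eq_mk
  refine ⟨hX0int.aemeasurable.mk X0, ⟨hX0int.aemeasurable.measurable_mk,
    fun f hf => (hupper f hf).trans_eq hX, fun G hGm hGS => ?_⟩, hX0int.congr hX, fun ε hε => ?_⟩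
  · refine hX.symm.trans_le ?_
    filter_upwards [ae_all_iff.2 fun j => hGS (h j) (hhS j)] with ω hω
    have h0 := hω 0
    have : (⨆ j, g j ω).toReal ≤ G ω - h 0 ω :=
      ENNReal.toReal_le_of_le_ofReal (sub_nonneg.2 h0)
        (iSup_le fun j => ENNReal.ofReal_le_ofReal (sub_le_sub_right (hω j) _))
    simp only [hX0]
    linarith
  · rw [← integral_congr_ae hX]
    obtain ⟨_, ⟨f, hf, rfl⟩, h⟩ := exists_lt_of_lt_csSup hIne (sub_lt_self (sSup I) hε)
    exact ⟨f, hf, by simp only at h; linarith⟩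

end EssSup

/-! ### Traces of enlarged filtrations -/

section Trace

variable {Ω : Type*} {m : MeasurableSpace Ω}

/-- The σ-algebra of the sets whose trace on `B` is measurable. -/
@[reducible]
def interSpace {Ω : Type*} (M : MeasurableSpace Ω) (B : Set Ω) (hB : MeasurableSet[M] B) :
    MeasurableSpace Ω where
  MeasurableSet' E := MeasurableSet[M] (E ∩ B)
  measurableSet_empty := by simp
  measurableSet_compl E hE := by
    have : Eᶜ ∩ B = B \ (E ∩ B) := by
      ext ω
      simp only [Set.mem_inter_iff, Set.mem_compl_iff, Set.mem_sdiff]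
      tauto
    rw [this]
    exact hB.diff hE
  measurableSet_iUnion E hE := by
    rw [Set.iUnion_inter]
    exact MeasurableSet.iUnion hE

theorem le_adjoin (𝔄 : Filtration ℝ≥0 m) (ρ : Ω → WithTop ℝ≥0) : 𝔄 ≤ adjoin 𝔄 ρ :=
  le_sup_left.trans (Filtration.le_rightCont _)

theorem le_adjoinSeq (𝔄 : Filtration ℝ≥0 m) (ρ : ℕ → Ω → WithTop ℝ≥0) (i : ℕ) :
    𝔄 ≤ adjoinSeq 𝔄 ρ i := by
  induction i with
  | zero => exact le_rfl
  | succ i ih => exact ih.trans (le_adjoin _ _)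

theorem measurableSet_adjoin_iff {𝔄 : Filtration ℝ≥0 m} {ρ : Ω → WithTop ℝ≥0} {t : ℝ≥0}
    {E : Set Ω} : MeasurableSet[adjoin 𝔄 ρ t] E ↔
      ∀ s, t < s → MeasurableSet[𝔄 s ⊔ timeFiltration (m := m) ρ s] E := by
  rw [adjoin, Filtration.rightCont_eq]
  simp only [MeasurableSpace.measurableSet_iInf, gt_iff_lt]

theorem measurableSet_timeFiltration {ρ : Ω → WithTop ℝ≥0}
    (hρ : ∀ s : ℝ≥0, MeasurableSet {ω | ρ ω ≤ s}) {s t : ℝ≥0} (h : s ≤ t) :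
    MeasurableSet[timeFiltration (m := m) ρ t] {ω | ρ ω ≤ s} :=
  MeasurableSpace.measurableSet_generateFrom ⟨hρ s, s, h, rfl⟩

/-- Sets whose trace on B lies in the target σ-algebra form a σ-algebra, so generators suffice, and
on B the events {ρ ≤ u} and {ρ' ≤ u} coincide. The hypothesis `h` concerns all s ≥ t because 𝔄^ρ at
time t is an intersection over later times. -/
theorem measurableSet_adjoin_inter {𝔄 𝔄' : Filtration ℝ≥0 m} {ρ ρ' : Ω → WithTop ℝ≥0} {t : ℝ≥0}
    {B : Set Ω} (hB : MeasurableSet[𝔄' t] B) (hρ' : ∀ s : ℝ≥0, MeasurableSet {ω | ρ' ω ≤ s})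
    (hρ : ∀ ω ∈ B, ρ ω = ρ' ω)
    (h : ∀ s, t ≤ s → ∀ E, MeasurableSet[𝔄 s] E → MeasurableSet[𝔄' s] (E ∩ B))
    {E : Set Ω} (hE : MeasurableSet[adjoin 𝔄 ρ t] E) : MeasurableSet[adjoin 𝔄' ρ' t] (E ∩ B) := by
  rw [measurableSet_adjoin_iff] at hE ⊢
  intro s hs
  have hB' : MeasurableSet[𝔄' s ⊔ timeFiltration (m := m) ρ' s] B :=
    le_sup_left (a := 𝔄' s) _ (𝔄'.mono hs.le _ hB)
  suffices 𝔄 s ⊔ timeFiltration (m := m) ρ s ≤ interSpace (𝔄' s ⊔ timeFiltration (m := m) ρ' s) B hB' from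
    this _ (hE s hs)
  refine sup_le (fun F hF => le_sup_left (a := 𝔄' s) _ (h s hs.le F hF))
    (MeasurableSpace.generateFrom_le ?_)
  rintro F ⟨-, u, hu, rfl⟩
  change MeasurableSet[𝔄' s ⊔ timeFiltration (m := m) ρ' s] ({ω | ρ ω ≤ u} ∩ B)
  have : {ω | ρ ω ≤ u} ∩ B = {ω | ρ' ω ≤ u} ∩ B := by
    ext ω
    simp only [Set.mem_inter_iff, Set.mem_ofPred_eq]
    exact ⟨fun h => ⟨hρ ω h.2 ▸ h.1, h.2⟩, fun h => ⟨(hρ ω h.2).symm ▸ h.1, h.2⟩⟩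
  rw [this]
  exact MeasurableSet.inter (le_sup_right (a := 𝔄' s) _ (measurableSet_timeFiltration hρ' hu)) hB'

theorem measurableSet_adjoinSeq_inter {𝔄 : Filtration ℝ≥0 m} {ρ ρ' : ℕ → Ω → WithTop ℝ≥0} {B : Set Ω}
    (i : ℕ) (hρ' : ∀ j < i, ∀ s : ℝ≥0, MeasurableSet {ω | ρ' j ω ≤ s})
    (hρ : ∀ j < i, ∀ ω ∈ B, ρ j ω = ρ' j ω) {t : ℝ≥0} (hB : MeasurableSet[𝔄 t] B) {E : Set Ω}
    (hE : MeasurableSet[adjoinSeq 𝔄 ρ i t] E) : MeasurableSet[adjoinSeq 𝔄 ρ' i t] (E ∩ B) := by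
  induction i generalizing t E with
  | zero => exact MeasurableSet.inter hE hB
  | succ i ih =>
    refine measurableSet_adjoin_inter (le_adjoinSeq 𝔄 ρ' i t _ hB) (hρ' i i.lt_succ_self)
      (hρ i i.lt_succ_self) (fun s hs F hF => ?_) hE
    exact ih (fun j hj => hρ' j (hj.trans i.lt_succ_self))
      (fun j hj => hρ j (hj.trans i.lt_succ_self)) (𝔄.mono hs _ hB) hF

theorem measurable_glue {ι β : Type*} [Countable ι] [MeasurableSpace β] {p : Ω → ι}
    (hp : ∀ x, MeasurableSet (p ⁻¹' {x})) {T : ι → Ω → β} (hT : ∀ x, Measurable (T x)) :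
    Measurable fun ω => T (p ω) ω := by
  intro s hs
  have : (fun ω => T (p ω) ω) ⁻¹' s = ⋃ x, p ⁻¹' {x} ∩ T x ⁻¹' s := by
    ext ω
    simp
  rw [this]
  exact MeasurableSet.iUnion fun x => (hp x).inter (hT x hs)

/-- One may switch between stopping rules according to information available at σ. The event {p = x}
∩ {σ ≤ t} lies in 𝔄_t, and on it the times ρ x and ρ' agree, so measurability transfers between the
two enlargements. As σ is below the glued time, intersecting with {σ ≤ t} loses nothing. -/
theorem isStoppingTime_adjoinSeq_glue {ι : Type*} [Countable ι] {𝔄 : Filtration ℝ≥0 m}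
    {σ : Ω → WithTop ℝ≥0} (hσ : IsStoppingTime 𝔄 σ) {p : Ω → ι}
    (hp : ∀ x, MeasurableSet[hσ.measurableSpace] (p ⁻¹' {x})) {ρ : ι → ℕ → Ω → WithTop ℝ≥0}
    {ρ' : ℕ → Ω → WithTop ℝ≥0} {i : ℕ} (hρ' : ∀ j < i, Measurable (ρ' j))
    (hρ : ∀ j < i, ∀ ω, ρ (p ω) j ω = ρ' j ω) {T : ι → Ω → WithTop ℝ≥0}
    (hT : ∀ x, IsStoppingTime (adjoinSeq 𝔄 (ρ x) i) (T x)) (hσT : ∀ ω, σ ω ≤ T (p ω) ω) :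
    IsStoppingTime (adjoinSeq 𝔄 ρ' i) fun ω => T (p ω) ω := by
  intro t
  have : {ω | T (p ω) ω ≤ t} = ⋃ x, {ω | T x ω ≤ t} ∩ (p ⁻¹' {x} ∩ {ω | σ ω ≤ t}) := by
    ext ω
    simp only [Set.mem_ofPred_eq, Set.mem_iUnion, Set.mem_inter_iff, Set.mem_preimage,
      Set.mem_singleton_iff]
    constructor
    · exact fun h => ⟨p ω, h, rfl, (hσT ω).trans h⟩
    · rintro ⟨x, h, rfl, -⟩
      exact h
  rw [this]
  refine MeasurableSet.iUnion fun x => measurableSet_adjoinSeq_inter i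
    (fun j hj s => hρ' j hj measurableSet_Iic) ?_ ((hp x).2 t) (hT x t)
  rintro j hj ω ⟨rfl, -⟩
  exact hρ j hj ω

theorem adjoin_mono {𝔄 𝔅 : Filtration ℝ≥0 m} (h : 𝔄 ≤ 𝔅) (ρ : Ω → WithTop ℝ≥0) :
    adjoin 𝔄 ρ ≤ adjoin 𝔅 ρ := by
  intro t E hE
  rw [measurableSet_adjoin_iff] at hE ⊢
  exact fun s hs => sup_le_sup_right (h s) _ _ (hE s hs)

theorem adjoinSeq_mono {𝔄 𝔅 : Filtration ℝ≥0 m} (h : 𝔄 ≤ 𝔅) (ρ : ℕ → Ω → WithTop ℝ≥0) (i : ℕ) :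
    adjoinSeq 𝔄 ρ i ≤ adjoinSeq 𝔅 ρ i := by
  induction i with
  | zero => exact h
  | succ i ih => exact adjoin_mono ih _

/-- Splitting off the first adjoined time turns the filtrations of a problem with k + 1 exercises
into those of the remaining k exercises over 𝔄^{ρ_0}. -/
theorem adjoinSeq_succ' (𝔄 : Filtration ℝ≥0 m) (ρ : ℕ → Ω → WithTop ℝ≥0) (i : ℕ) :
    adjoinSeq 𝔄 ρ (i + 1) = adjoinSeq (adjoin 𝔄 (ρ 0)) (fun j => ρ (j + 1)) i := by
  induction i with
  | zero => rfl
  | succ i ih =>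
    change adjoin (adjoinSeq 𝔄 ρ (i + 1)) (ρ (i + 1)) = _
    rw [ih]
    rfl

/-- By minimality of the enlargement, adjoining times that are already stopping times adds no
information. -/
theorem adjoinSeq_le {𝔄 : Filtration ℝ≥0 m} (h𝔄 : 𝔄.IsRightContinuous) {ρ : ℕ → Ω → WithTop ℝ≥0}
    {i : ℕ} (hρ : ∀ j < i, IsStoppingTime 𝔄 (ρ j)) : adjoinSeq 𝔄 ρ i ≤ 𝔄 := by
  induction i with
  | zero => exact le_rfl
  | succ i ih =>
    exact adjoin_le h𝔄 (ih fun j hj => hρ j (hj.trans i.lt_succ_self)) (hρ i i.lt_succ_self)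

/-- The filtration enlarged by delayed times is, up to the delay, at least as large. -/
theorem measurableSet_adjoin_add {𝔄 𝔄' : Filtration ℝ≥0 m} {ρ ρ' : Ω → WithTop ℝ≥0} {h : ℝ≥0}
    (hρ : ∀ ω, ρ' ω = ρ ω + h) (h𝔄 : ∀ t, 𝔄 t ≤ 𝔄' (t + h)) (t : ℝ≥0) :
    adjoin 𝔄 ρ t ≤ adjoin 𝔄' ρ' (t + h) := by
  intro E hE
  rw [measurableSet_adjoin_iff] at hE ⊢
  intro s hs
  have hs' : s - h + h = s := tsub_add_cancel_of_le (le_add_self.trans hs.le)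
  suffices 𝔄 (s - h) ⊔ timeFiltration (m := m) ρ (s - h) ≤ 𝔄' s ⊔ timeFiltration (m := m) ρ' s from
    this _ (hE _ (lt_tsub_iff_right.2 hs))
  refine sup_le_sup (by simpa only [hs'] using h𝔄 (s - h)) (MeasurableSpace.generateFrom_le ?_)
  rintro F ⟨hF, u, hu, rfl⟩
  have : {ω | ρ ω ≤ u} = {ω | ρ' ω ≤ (u + h : ℝ≥0)} := by
    ext ω
    simp only [Set.mem_ofPred_eq, hρ, add_coe_le_coe_iff, add_tsub_cancel_right]
    exact ⟨fun h => ⟨le_add_self, h⟩, fun h => h.2⟩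
  rw [this] at hF ⊢
  exact MeasurableSpace.measurableSet_generateFrom ⟨hF, u + h, by rw [← hs']; gcongr, rfl⟩

theorem adjoinSeq_add {𝔄 𝔄' : Filtration ℝ≥0 m} {ρ ρ' : ℕ → Ω → WithTop ℝ≥0} {h : ℝ≥0}
    (hρ : ∀ j ω, ρ' j ω = ρ j ω + h) (h𝔄 : ∀ t, 𝔄 t ≤ 𝔄' (t + h)) (i : ℕ) (t : ℝ≥0) :
    adjoinSeq 𝔄 ρ i t ≤ adjoinSeq 𝔄' ρ' i (t + h) := by
  induction i generalizing t with
  | zero => exact h𝔄 t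
  | succ i ih => exact measurableSet_adjoin_add (hρ i) ih t

theorem isStoppingTime_of_add {𝔄 𝔄' : Filtration ℝ≥0 m} {τ : Ω → WithTop ℝ≥0} {h : ℝ≥0}
    (hτ : IsStoppingTime 𝔄 τ) (h𝔄 : ∀ t, 𝔄 t ≤ 𝔄' (t + h)) :
    IsStoppingTime 𝔄' fun ω => τ ω + h := by
  intro u
  simp only [add_coe_le_coe_iff]
  by_cases hu : h ≤ u
  · simp only [hu, true_and]
    have := h𝔄 (u - h) _ (hτ (u - h))
    rwa [tsub_add_cancel_of_le hu] at this
  · simp [hu]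

end Trace

/-! ### Strategies -/

section Strategies

variable {Ω : Type*} {m : MeasurableSpace Ω} {𝔄 : Filtration ℝ≥0 m} {δ : ℕ → Ω → WithTop ℝ≥0}
  {k : ℕ} {σ : Ω → WithTop ℝ≥0} {τ : ℕ → Ω → WithTop ℝ≥0}

/-- Exercising only at ∞ is always allowed. It makes the reward families non-empty and bounds the
continuation value below through k Y(∞). -/
theorem top_mem_strategies (𝔄 : Filtration ℝ≥0 m) (δ : ℕ → Ω → WithTop ℝ≥0) (k : ℕ)
    (σ : Ω → WithTop ℝ≥0) : (fun _ _ => ⊤) ∈ strategies 𝔄 δ k σ :=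
  ⟨fun _ _ => le_top, fun i _ t => by
    have : {_ω : Ω | (⊤ : WithTop ℝ≥0) ≤ t} = ∅ :=
      Set.eq_empty_of_forall_notMem fun _ h =>
        absurd (top_le_iff.1 (Set.mem_ofPred_eq ▸ h)) WithTop.coe_ne_top
    rw [this]
    exact MeasurableSpace.measurableSet_empty _, fun _ _ _ => le_top⟩

theorem top_mem_strategiesDisc (𝔄 : Filtration ℝ≥0 m) (δ : ℕ → Ω → WithTop ℝ≥0) (k : ℕ)
    (σ : Ω → WithTop ℝ≥0) : (fun _ _ => ⊤) ∈ strategiesDisc 𝔄 δ k σ :=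
  ⟨top_mem_strategies 𝔄 δ k σ, (Set.countable_singleton ⊤).mono (by rintro _ ⟨ω, rfl⟩; rfl)⟩

theorem measurable_of_mem_strategies (hτ : τ ∈ strategies 𝔄 δ k σ) {i : ℕ} (hi : i < k) :
    Measurable (τ i) :=
  (hτ.2.1 i hi).measurable'

theorem zero_le_of_mem_strategies (hτ : τ ∈ strategies 𝔄 δ k σ) {i : ℕ} (hi : i < k) (ω : Ω) :
    τ 0 ω ≤ τ i ω := by
  induction i with
  | zero => exact le_rfl
  | succ i ih =>
    exact (ih (i.lt_succ_self.trans hi)).trans (le_self_add.trans (hτ.2.2 i hi ω))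

theorem le_of_mem_strategies (hτ : τ ∈ strategies 𝔄 δ k σ) {i : ℕ} (hi : i < k) (ω : Ω) :
    σ ω ≤ τ i ω :=
  (hτ.1 (Nat.zero_lt_of_lt hi) ω).trans (zero_le_of_mem_strategies hτ hi ω)

theorem glue_mem_strategies {ι : Type*} [Countable ι] (hδ : ∀ i, Measurable (δ i))
    (hσ : IsStoppingTime 𝔄 σ) {p : Ω → ι}
    (hp : ∀ x, MeasurableSet[hσ.measurableSpace] (p ⁻¹' {x})) {τ : ι → ℕ → Ω → WithTop ℝ≥0}
    (hτ : ∀ x, τ x ∈ strategies 𝔄 δ k σ) : (fun i ω => τ (p ω) i ω) ∈ strategies 𝔄 δ k σ := by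
  refine ⟨fun hk ω => (hτ (p ω)).1 hk ω, fun i hi => ?_, fun i hi ω => (hτ (p ω)).2.2 i hi ω⟩
  exact isStoppingTime_adjoinSeq_glue hσ hp (ρ := fun x j ω => τ x j ω + δ j ω)
    (fun j hj => measurable_add (measurable_glue (fun x => hσ.measurableSpace_le _ (hp x))
      fun x => measurable_of_mem_strategies (hτ x) (hj.trans hi)) (hδ j))
    (fun _ _ _ => rfl) (fun x => (hτ x).2.1 i hi) (fun ω => le_of_mem_strategies (hτ _) hi ω)

/-- The time t + d = (s + d) + (t - s) is already a stopping time for 𝔉^{s+d}, so a later first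
exercise leaves both less information and less time. This inclusion is behind the supermartingale
property of the continuation value. -/
theorem strategies_delay_anti (𝔉 : Filtration ℝ≥0 m) {d : Ω → WithTop ℝ≥0} (hd : Measurable d)
    (δ : ℕ → Ω → WithTop ℝ≥0) (k : ℕ) {s t : ℝ≥0} (hst : s ≤ t) :
    strategies (adjoin 𝔉 (delay t d)) δ k (delay t d) ⊆
      strategies (adjoin 𝔉 (delay s d)) δ k (delay s d) := by
  have hst' : ∀ ω, delay t d ω = delay s d ω + ((t - s : ℝ≥0) : WithTop ℝ≥0) := fun ω => by
    unfold delay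
    rw [add_right_comm, ← WithTop.coe_add, add_tsub_cancel_of_le hst]
  have hle : adjoin 𝔉 (delay t d) ≤ adjoin 𝔉 (delay s d) := by
    refine adjoin_le (𝔅 := adjoin 𝔉 (delay s d)) ?_ (le_adjoin _ _) ?_
    · unfold adjoin
      infer_instance
    · rw [funext hst']
      exact isStoppingTime_add_const (isStoppingTime_delay 𝔉 hd s) _
  intro τ hτ
  refine ⟨fun hk ω => le_trans ?_ (hτ.1 hk ω), fun i hi => ?_, hτ.2.2⟩
  · rw [hst']
    exact le_self_add
  · exact fun t => adjoinSeq_mono hle _ i t _ (hτ.2.1 i hi t)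

/-- A common delay h respects the waiting times and moves all the enlarged filtrations by h. Letting
h tend to 0 yields right-continuity of the mean of the continuation value. -/
theorem add_mem_strategies_delay (𝔉 : Filtration ℝ≥0 m) (d : Ω → WithTop ℝ≥0)
    (δ : ℕ → Ω → WithTop ℝ≥0) (k : ℕ) (t h : ℝ≥0) {τ : ℕ → Ω → WithTop ℝ≥0}
    (hτ : τ ∈ strategies (adjoin 𝔉 (delay t d)) δ k (delay t d)) :
    (fun i ω => τ i ω + h) ∈
      strategies (adjoin 𝔉 (delay (t + h) d)) δ k (delay (t + h) d) := by
  have hd : ∀ ω, delay (t + h) d ω = delay t d ω + h := fun ω => by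
    unfold delay
    rw [WithTop.coe_add, add_right_comm]
  refine ⟨fun hk ω => ?_, fun i hi => isStoppingTime_of_add (hτ.2.1 i hi) (adjoinSeq_add
    (fun j ω => add_right_comm _ _ _) (fun u => measurableSet_adjoin_add hd
      (fun u => 𝔉.mono le_self_add) u) i), fun i hi ω => ?_⟩
  · rw [hd]
    exact add_le_add_left (hτ.1 hk ω) _
  · simp only
    rw [add_right_comm]
    exact add_le_add_left (hτ.2.2 i hi ω) _

end Strategies

/-! ### Rewards -/

/-- The total reward of the first `k` exercise times of `τ`. -/
noncomputable def reward {Ω : Type*} (Y : ℝ≥0 → Ω → ℝ) (k : ℕ) (τ : ℕ → Ω → WithTop ℝ≥0) (ω : Ω) : ℝ :=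
  ∑ i ∈ Finset.range k, atTime Y (τ i) ω

/-- A non-negative right-continuous process of measurable random variables with integrable
supremum. -/
structure IsReward {Ω : Type*} {m : MeasurableSpace Ω} (μ : Measure Ω) (Y : ℝ≥0 → Ω → ℝ) : Prop where
  measurable : ∀ t, Measurable (Y t)
  nonneg : ∀ t ω, 0 ≤ Y t ω
  rightCont : RightContinuousPaths Y
  lintegral_sup : ∫⁻ ω, ⨆ t, ENNReal.ofReal (Y t ω) ∂μ < ∞

section Reward

variable {Ω : Type*} {m : MeasurableSpace Ω} {μ : Measure Ω} {Y : ℝ≥0 → Ω → ℝ} {k : ℕ}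
  {τ : ℕ → Ω → WithTop ℝ≥0}

theorem IsReward.lintegral_supFrom (hY : IsReward μ Y) : ∫⁻ ω, supFrom Y 0 ω ∂μ ≠ ∞ := by
  have h : ∀ ω, supFrom Y 0 ω = ⨆ t, ENNReal.ofReal (Y t ω) := fun ω => by simp [supFrom]
  simp_rw [h]
  exact hY.lintegral_sup.ne

theorem IsReward.ae_ne_top (hY : IsReward μ Y) : ∀ᵐ ω ∂μ, supFrom Y 0 ω ≠ ∞ :=
  (ae_lt_top (measurable_supFrom hY.rightCont hY.measurable 0) hY.lintegral_supFrom).mono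
    fun _ h => h.ne

theorem IsReward.integrable_supFrom (hY : IsReward μ Y) (T : ℝ≥0) :
    Integrable (fun ω => (supFrom Y T ω).toReal) μ :=
  integrable_toReal_of_lintegral_ne_top
    (measurable_supFrom hY.rightCont hY.measurable T).aemeasurable
    (ne_top_of_le_ne_top hY.lintegral_supFrom (lintegral_mono fun _ => supFrom_anti zero_le))

theorem IsReward.aemeasurable_atTime_top (hY : IsReward μ Y) :
    AEMeasurable (atTime Y fun _ => ⊤) μ :=
  aemeasurable_of_tendsto_metrizable_ae'
    (fun N : ℕ => (hY.integrable_supFrom N).aemeasurable)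
    (hY.ae_ne_top.mono fun _ h => tendsto_supFrom hY.nonneg h)

theorem IsReward.integrable_atTime (hY : IsReward μ Y) {ρ : Ω → WithTop ℝ≥0} (hρ : Measurable ρ) :
    Integrable (atTime Y ρ) μ := by
  refine (hY.integrable_supFrom 0).mono' (aemeasurable_atTime hY.rightCont
    (fun t => (hY.measurable t).aemeasurable) hY.aemeasurable_atTime_top hρ).aestronglyMeasurable ?_
  filter_upwards [hY.ae_ne_top] with ω hω
  rw [Real.norm_of_nonneg (atTime_nonneg hY.nonneg hω ρ)]
  exact atTime_le hY.nonneg hω zero_le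

theorem IsReward.integrable_reward (hY : IsReward μ Y) (hτ : ∀ i < k, Measurable (τ i)) :
    Integrable (reward Y k τ) μ :=
  integrable_finsetSum _ fun i hi => hY.integrable_atTime (hτ i (Finset.mem_range.1 hi))

theorem reward_nonneg (h0 : ∀ t ω, 0 ≤ Y t ω) {ω : Ω} (h : supFrom Y 0 ω ≠ ∞) :
    0 ≤ reward Y k τ ω :=
  Finset.sum_nonneg fun _ _ => atTime_nonneg h0 h _

theorem reward_le (h0 : ∀ t ω, 0 ≤ Y t ω) {ω : Ω} (h : supFrom Y 0 ω ≠ ∞) {T : ℝ≥0}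
    (hT : ∀ i < k, T ≤ τ i ω) : reward Y k τ ω ≤ k * (supFrom Y T ω).toReal := by
  refine (Finset.sum_le_sum fun i hi => atTime_le h0 h (hT i (Finset.mem_range.1 hi))).trans ?_
  simp

theorem reward_congr {τ' : ℕ → Ω → WithTop ℝ≥0} {ω : Ω} (h : ∀ i < k, τ i ω = τ' i ω) :
    reward Y k τ ω = reward Y k τ' ω :=
  Finset.sum_congr rfl fun i hi => atTime_congr (h i (Finset.mem_range.1 hi))

theorem reward_top : reward Y k (fun _ _ => ⊤) = fun ω => k * atTime Y (fun _ => ⊤) ω := by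
  funext ω
  simp [reward]

variable {𝔄 : Filtration ℝ≥0 m} {δ : ℕ → Ω → WithTop ℝ≥0} {σ : Ω → WithTop ℝ≥0}

open Classical in
-- Following τ where its conditional reward is the larger one, and τ' elsewhere, beats both; the
-- choice is known at σ, so `hpaste` applies and the rewards are directed. Their integrals are
-- bounded by that of k times the supremum of Y.
theorem exists_isEssSup_rewards [IsFiniteMeasure μ] (hY : IsReward μ Y) (hσ : IsStoppingTime 𝔄 σ)
    {S : Set (ℕ → Ω → WithTop ℝ≥0)} (hS : S.Nonempty) (hSm : ∀ τ ∈ S, ∀ i < k, Measurable (τ i))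
    (hpaste : ∀ τ ∈ S, ∀ τ' ∈ S, ∀ A, MeasurableSet[hσ.measurableSpace] A →
      (fun i ω => (if ω ∈ A then τ else τ') i ω) ∈ S) :
    ∃ X, IsEssSup μ (rewards μ Y hσ k S) X ∧ Integrable X μ ∧
      ∀ ε > 0, ∃ τ ∈ S, ∫ ω, X ω ∂μ ≤ ∫ ω, reward Y k τ ω ∂μ + ε := by
  have hle := hσ.measurableSpace_le
  have hmem : ∀ τ ∈ S, μ[reward Y k τ | hσ.measurableSpace] ∈ rewards μ Y hσ k S :=
    fun τ hτ => ⟨τ, hτ, rfl⟩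
  have hint : ∀ τ ∈ S, Integrable (reward Y k τ) μ := fun τ hτ => hY.integrable_reward (hSm τ hτ)
  suffices hX : ∃ X, IsEssSup μ (rewards μ Y hσ k S) X ∧ Integrable X μ ∧
      ∀ ε > 0, ∃ f ∈ rewards μ Y hσ k S, ∫ ω, X ω ∂μ ≤ ∫ ω, f ω ∂μ + ε by
    obtain ⟨X, h1, h2, h3⟩ := hX
    refine ⟨X, h1, h2, fun ε hε => ?_⟩
    obtain ⟨_, ⟨τ, hτ, rfl⟩, h⟩ := h3 ε hε
    rw [integral_condExp hle] at h
    exact ⟨τ, hτ, h⟩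
  refine exists_isEssSup_of_directed (C := ∫ ω, k * (supFrom Y 0 ω).toReal ∂μ)
    ⟨_, hmem _ hS.choose_spec⟩ ?_ ?_ ?_
  · rintro _ ⟨τ, hτ, rfl⟩
    exact integrable_condExp
  · rintro _ ⟨τ, hτ, rfl⟩ _ ⟨τ', hτ', rfl⟩
    set f := μ[reward Y k τ | hσ.measurableSpace] with hf
    set g := μ[reward Y k τ' | hσ.measurableSpace] with hg
    set A : Set Ω := {ω | g ω ≤ f ω} with hA
    have hAm : MeasurableSet[hσ.measurableSpace] A :=
      stronglyMeasurable_condExp.measurableSet_le stronglyMeasurable_condExp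
    set τ'' : ℕ → Ω → WithTop ℝ≥0 := fun i ω => (if ω ∈ A then τ else τ') i ω with hτ''
    have hr : reward Y k τ'' = A.indicator (reward Y k τ) + Aᶜ.indicator (reward Y k τ') := by
      funext ω
      by_cases hω : ω ∈ A
      · simp only [Pi.add_apply, Set.indicator_of_mem hω,
          Set.indicator_of_notMem (Set.notMem_compl_iff.2 hω), add_zero]
        exact reward_congr fun i _ => by simp [hτ'', hω]
      · simp only [Pi.add_apply, Set.indicator_of_notMem hω,
          Set.indicator_of_mem (Set.mem_compl hω), zero_add]
        exact reward_congr fun i _ => by simp [hτ'', hω]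
    have hc : μ[reward Y k τ'' | hσ.measurableSpace] =ᵐ[μ] A.indicator f + Aᶜ.indicator g := by
      rw [hr]
      exact (condExp_add ((hint τ hτ).indicator (hle _ hAm))
        ((hint τ' hτ').indicator (hle _ hAm.compl)) _).trans
        ((condExp_indicator (hint τ hτ) hAm).add (condExp_indicator (hint τ' hτ') hAm.compl))
    refine ⟨_, hmem τ'' (hpaste τ hτ τ' hτ' A hAm), ?_, ?_⟩
    all_goals
      filter_upwards [hc] with ω hω
      rw [hω]
      by_cases h : ω ∈ A
      · simp only [Pi.add_apply, Set.indicator_of_mem h,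
          Set.indicator_of_notMem (Set.notMem_compl_iff.2 h), add_zero]
        first | exact le_rfl | exact h
      · simp only [Pi.add_apply, Set.indicator_of_notMem h,
          Set.indicator_of_mem (Set.mem_compl h), zero_add]
        first | exact le_rfl | exact (not_le.1 h).le
  · rintro _ ⟨τ, hτ, rfl⟩
    have : ∫ ω, (μ[reward Y k τ | hσ.measurableSpace]) ω ∂μ = ∫ ω, reward Y k τ ω ∂μ :=
      integral_condExp hle
    refine this.trans_le (integral_mono_ae (hint τ hτ) ((hY.integrable_supFrom 0).const_mul _) ?_)
    filter_upwards [hY.ae_ne_top] with ω hω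
    exact reward_le hY.nonneg hω fun _ _ => zero_le

open Classical in
theorem paste_mem_strategies (hδ : ∀ i, Measurable (δ i)) (hσ : IsStoppingTime 𝔄 σ)
    {τ τ' : ℕ → Ω → WithTop ℝ≥0} (hτ : τ ∈ strategies 𝔄 δ k σ) (hτ' : τ' ∈ strategies 𝔄 δ k σ)
    {A : Set Ω} (hA : MeasurableSet[hσ.measurableSpace] A) :
    (fun i ω => (if ω ∈ A then τ else τ') i ω) ∈ strategies 𝔄 δ k σ := by
  refine glue_mem_strategies (p := fun ω => ω ∈ A) (τ := fun q => if q then τ else τ') hδ hσ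
    (fun x => ?_) (fun x => by split_ifs <;> assumption)
  by_cases hx : x
  · convert hA using 1
    ext ω
    simp [hx]
  · convert hA.compl using 1
    ext ω
    simp [hx]

theorem exists_isEssSup_strategies [IsFiniteMeasure μ] (hY : IsReward μ Y)
    (hδ : ∀ i, Measurable (δ i)) (hσ : IsStoppingTime 𝔄 σ) :
    ∃ X, IsEssSup μ (rewards μ Y hσ k (strategies 𝔄 δ k σ)) X ∧ Integrable X μ ∧
      ∀ ε > 0, ∃ τ ∈ strategies 𝔄 δ k σ, ∫ ω, X ω ∂μ ≤ ∫ ω, reward Y k τ ω ∂μ + ε :=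
  exists_isEssSup_rewards hY hσ ⟨_, top_mem_strategies 𝔄 δ k σ⟩
    (fun _ hτ _ hi => measurable_of_mem_strategies hτ hi)
    (fun _ hτ _ hτ' _ hA => paste_mem_strategies hδ hσ hτ hτ' hA)

theorem exists_isEssSup_strategiesDisc [IsFiniteMeasure μ] (hY : IsReward μ Y)
    (hδ : ∀ i, Measurable (δ i)) (hσ : IsStoppingTime 𝔄 σ) :
    ∃ X, IsEssSup μ (rewards μ Y hσ k (strategiesDisc 𝔄 δ k σ)) X ∧ Integrable X μ ∧
      ∀ ε > 0, ∃ τ ∈ strategiesDisc 𝔄 δ k σ, ∫ ω, X ω ∂μ ≤ ∫ ω, reward Y k τ ω ∂μ + ε := by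
  refine exists_isEssSup_rewards hY hσ ⟨_, top_mem_strategiesDisc 𝔄 δ k σ⟩
    (fun _ hτ _ hi => measurable_of_mem_strategies hτ.1 hi)
    (fun τ hτ τ' hτ' A hA => ⟨paste_mem_strategies hδ hσ hτ.1 hτ'.1 hA, ?_⟩)
  refine (hτ.2.union hτ'.2).mono ?_
  rintro _ ⟨ω, rfl⟩
  by_cases h : ω ∈ A
  · exact Or.inl ⟨ω, by simp [h]⟩
  · exact Or.inr ⟨ω, by simp [h]⟩

theorem isEssSup_value [IsFiniteMeasure μ] (hY : IsReward μ Y) (hδ : ∀ i, Measurable (δ i))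
    (hσ : IsStoppingTime 𝔄 σ) :
    IsEssSup μ (rewards μ Y hσ k (strategies 𝔄 δ k σ)) (value μ Y δ k hσ) :=
  (exists_isEssSup_strategies hY hδ hσ).choose_spec.1.essSupFamily

theorem isEssSup_valueDisc [IsFiniteMeasure μ] (hY : IsReward μ Y) (hδ : ∀ i, Measurable (δ i))
    (hσ : IsStoppingTime 𝔄 σ) :
    IsEssSup μ (rewards μ Y hσ k (strategiesDisc 𝔄 δ k σ)) (valueDisc μ Y δ k hσ) :=
  (exists_isEssSup_strategiesDisc hY hδ hσ).choose_spec.1.essSupFamily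

theorem integrable_value [IsFiniteMeasure μ] (hY : IsReward μ Y) (hδ : ∀ i, Measurable (δ i))
    (hσ : IsStoppingTime 𝔄 σ) : Integrable (value μ Y δ k hσ) μ := by
  obtain ⟨X, h1, h2, -⟩ := exists_isEssSup_strategies (k := k) hY hδ hσ
  exact h2.congr (h1.ae_eq h1.essSupFamily)

theorem integrable_valueDisc [IsFiniteMeasure μ] (hY : IsReward μ Y) (hδ : ∀ i, Measurable (δ i))
    (hσ : IsStoppingTime 𝔄 σ) : Integrable (valueDisc μ Y δ k hσ) μ := by
  obtain ⟨X, h1, h2, -⟩ := exists_isEssSup_strategiesDisc (k := k) hY hδ hσ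
  exact h2.congr (h1.ae_eq h1.essSupFamily)

theorem exists_integral_value_le [IsFiniteMeasure μ] (hY : IsReward μ Y)
    (hδ : ∀ i, Measurable (δ i)) (hσ : IsStoppingTime 𝔄 σ) {ε : ℝ} (hε : 0 < ε) :
    ∃ τ ∈ strategies 𝔄 δ k σ,
      ∫ ω, value μ Y δ k hσ ω ∂μ ≤ ∫ ω, reward Y k τ ω ∂μ + ε := by
  obtain ⟨X, h1, -, h3⟩ := exists_isEssSup_strategies (k := k) hY hδ hσ
  rw [show ∫ ω, value μ Y δ k hσ ω ∂μ = ∫ ω, X ω ∂μ from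
    integral_congr_ae (h1.essSupFamily.ae_eq h1)]
  exact h3 ε hε

theorem IsEssSup.setIntegral_reward_le [IsFiniteMeasure μ] (hY : IsReward μ Y)
    {hσ : IsStoppingTime 𝔄 σ} {S : Set (ℕ → Ω → WithTop ℝ≥0)} {X : Ω → ℝ}
    (hX : IsEssSup μ (rewards μ Y hσ k S) X) (hXi : Integrable X μ) (hτ : τ ∈ S)
    (hτm : ∀ i < k, Measurable (τ i)) {A : Set Ω} (hA : MeasurableSet[hσ.measurableSpace] A) :
    ∫ ω in A, reward Y k τ ω ∂μ ≤ ∫ ω in A, X ω ∂μ := by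
  rw [← setIntegral_condExp hσ.measurableSpace_le (hY.integrable_reward hτm) hA]
  exact setIntegral_mono_ae integrable_condExp.integrableOn hXi.integrableOn
    (hX.upper _ ⟨τ, hτ, rfl⟩)

end Reward

/-! ### The continuation value -/

section Continuation

variable {Ω : Type*} {m : MeasurableSpace Ω} {μ : Measure Ω} [IsFiniteMeasure μ] {Y : ℝ≥0 → Ω → ℝ}
  {𝔉 : Filtration ℝ≥0 m} {δ : ℕ → Ω → WithTop ℝ≥0} {k : ℕ}

/-- The strategies for the exercises that remain after a first exercise at time `t`. -/
def laterStrategies {Ω : Type*} {m : MeasurableSpace Ω} (𝔉 : Filtration ℝ≥0 m)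
    (δ : ℕ → Ω → WithTop ℝ≥0) (k : ℕ) (t : ℝ≥0) : Set (ℕ → Ω → WithTop ℝ≥0) :=
  strategies (adjoin 𝔉 (delay t (δ 0))) (shift δ) k (delay t (δ 0))

theorem le_of_mem_laterStrategies {t : ℝ≥0} {τ : ℕ → Ω → WithTop ℝ≥0}
    (hτ : τ ∈ laterStrategies 𝔉 δ k t) {i : ℕ} (hi : i < k) (ω : Ω) : t ≤ τ i ω :=
  (le_self_add (a := (t : WithTop ℝ≥0)) (b := δ 0 ω)).trans (le_of_mem_strategies hτ hi ω)

/-- The remaining value is optimal given the information at t + δ_1. Since this contains ℱ_t,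
inequalities for it may be integrated over events of ℱ_t. -/
theorem le_measurableSpace_delay {hδ : Measurable (δ 0)} (t : ℝ≥0) :
    𝔉 t ≤ (isStoppingTime_delay 𝔉 hδ t).measurableSpace :=
  (le_adjoin 𝔉 _ t).trans ((isStoppingTime_delay 𝔉 hδ t).le_measurableSpace_of_const_le
    fun _ => le_self_add)

theorem setIntegral_continuation (hY : IsReward μ Y) (hδ : ∀ i, Measurable (δ i)) {t : ℝ≥0}
    {A : Set Ω} (hA : MeasurableSet[𝔉 t] A) :
    ∫ ω in A, continuation μ Y 𝔉 δ (hδ 0) k t ω ∂μ =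
      ∫ ω in A, remainingValue μ Y 𝔉 δ (hδ 0) k t ω ∂μ :=
  setIntegral_condExp (𝔉.le t) (integrable_value hY (fun i => hδ (i + 1)) _) hA

theorem setIntegral_reward_le_continuation (hY : IsReward μ Y) (hδ : ∀ i, Measurable (δ i))
    {t : ℝ≥0} {τ : ℕ → Ω → WithTop ℝ≥0} (hτ : τ ∈ laterStrategies 𝔉 δ k t) {A : Set Ω}
    (hA : MeasurableSet[𝔉 t] A) :
    ∫ ω in A, reward Y k τ ω ∂μ ≤ ∫ ω in A, continuation μ Y 𝔉 δ (hδ 0) k t ω ∂μ := by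
  rw [setIntegral_continuation hY hδ hA]
  exact (isEssSup_value hY (fun i => hδ (i + 1)) _).setIntegral_reward_le hY
    (integrable_value hY (fun i => hδ (i + 1)) _) hτ
    (fun _ hi => measurable_of_mem_strategies hτ hi) (le_measurableSpace_delay (hδ := hδ 0) t _ hA)

/-- One τ serves all events A at once: its total deficit is at most ε, and its deficit on the
complement of A is non-negative. -/
theorem exists_setIntegral_continuation_le (hY : IsReward μ Y) (hδ : ∀ i, Measurable (δ i))
    (t : ℝ≥0) {ε : ℝ} (hε : 0 < ε) :
    ∃ τ ∈ laterStrategies 𝔉 δ k t, ∀ A, MeasurableSet[𝔉 t] A →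
      ∫ ω in A, continuation μ Y 𝔉 δ (hδ 0) k t ω ∂μ ≤ ∫ ω in A, reward Y k τ ω ∂μ + ε := by
  have hδ' : ∀ i, Measurable (shift δ i) := fun i => hδ (i + 1)
  obtain ⟨τ, hτ, h⟩ := exists_integral_value_le (k := k) hY hδ' (isStoppingTime_delay 𝔉 (hδ 0) t) hε
  refine ⟨τ, hτ, fun A hA => ?_⟩
  have h1 := setIntegral_reward_le_continuation hY hδ hτ hA.compl
  rw [setIntegral_continuation hY hδ hA.compl] at h1
  rw [setIntegral_continuation hY hδ hA]
  have hi : Integrable (remainingValue μ Y 𝔉 δ (hδ 0) k t) μ := integrable_value hY hδ' _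
  have hr : Integrable (reward Y k τ) μ :=
    hY.integrable_reward fun i hi => measurable_of_mem_strategies hτ hi
  have h2 := integral_add_compl (𝔉.le t _ hA) hi
  have h3 := integral_add_compl (𝔉.le t _ hA) hr
  have h4 : ∫ ω, remainingValue μ Y 𝔉 δ (hδ 0) k t ω ∂μ ≤ ∫ ω, reward Y k τ ω ∂μ + ε := h
  linarith

omit [IsFiniteMeasure μ] in
theorem integrable_continuation (hδ : Measurable (δ 0)) (t : ℝ≥0) :
    Integrable (continuation μ Y 𝔉 δ hδ k t) μ :=
  integrable_condExp

theorem setIntegral_continuation_anti (hY : IsReward μ Y) (hδ : ∀ i, Measurable (δ i)) {s t : ℝ≥0}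
    (hst : s ≤ t) {A : Set Ω} (hA : MeasurableSet[𝔉 s] A) :
    ∫ ω in A, continuation μ Y 𝔉 δ (hδ 0) k t ω ∂μ ≤
      ∫ ω in A, continuation μ Y 𝔉 δ (hδ 0) k s ω ∂μ := by
  refine le_of_forall_pos_le_add fun ε hε => ?_
  obtain ⟨τ, hτ, h⟩ := exists_setIntegral_continuation_le (𝔉 := 𝔉) (k := k) hY hδ t hε
  refine (h A (𝔉.mono hst _ hA)).trans (add_le_add_left ?_ ε)
  exact setIntegral_reward_le_continuation hY hδ
    (strategies_delay_anti 𝔉 (hδ 0) (shift δ) k hst hτ) hA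

theorem setIntegral_continuation_le (hY : IsReward μ Y) (hδ : ∀ i, Measurable (δ i)) {T t : ℝ≥0}
    (hT : T ≤ t) {A : Set Ω} (hA : MeasurableSet[𝔉 t] A) :
    ∫ ω in A, continuation μ Y 𝔉 δ (hδ 0) k t ω ∂μ ≤ ∫ ω in A, k * (supFrom Y T ω).toReal ∂μ := by
  refine le_of_forall_pos_le_add fun ε hε => ?_
  obtain ⟨τ, hτ, h⟩ := exists_setIntegral_continuation_le (𝔉 := 𝔉) (k := k) hY hδ t hε
  refine (h A hA).trans (add_le_add_left ?_ ε)
  refine setIntegral_mono_ae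
    (hY.integrable_reward fun i hi => measurable_of_mem_strategies hτ hi).integrableOn
    ((hY.integrable_supFrom T).const_mul _).integrableOn ?_
  filter_upwards [hY.ae_ne_top] with ω hω
  exact reward_le hY.nonneg hω fun i hi =>
    le_trans (by exact_mod_cast hT) (le_of_mem_laterStrategies hτ hi ω)

theorem le_setIntegral_continuation (hY : IsReward μ Y) (hδ : ∀ i, Measurable (δ i)) {t : ℝ≥0}
    {A : Set Ω} (hA : MeasurableSet[𝔉 t] A) :
    ∫ ω in A, k * atTime Y (fun _ => ⊤) ω ∂μ ≤
      ∫ ω in A, continuation μ Y 𝔉 δ (hδ 0) k t ω ∂μ := by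
  rw [← reward_top]
  exact setIntegral_reward_le_continuation hY hδ (top_mem_strategies _ _ _ _) hA

omit [IsFiniteMeasure μ] in
-- Restricting μ to m' reduces this to the usual comparison, in which every measurable event is
-- available for testing.
theorem ae_le_of_forall_setIntegral_le_of_stronglyMeasurable {m' : MeasurableSpace Ω} (hm : m' ≤ m)
    {f g : Ω → ℝ} (hf : StronglyMeasurable[m'] f) (hg : StronglyMeasurable[m'] g)
    (hfi : Integrable f μ) (hgi : Integrable g μ)
    (h : ∀ A, MeasurableSet[m'] A → ∫ ω in A, f ω ∂μ ≤ ∫ ω in A, g ω ∂μ) : f ≤ᵐ[μ] g := by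
  refine ae_le_of_ae_le_trim (hm := hm)
    (ae_le_of_forall_setIntegral_le (hfi.trim hm hf) (hgi.trim hm hg) fun A hA _ => ?_)
  rw [← setIntegral_trim hm hf hA, ← setIntegral_trim hm hg hA]
  exact h A hA

theorem continuation_le_condExp (hY : IsReward μ Y) (hδ : ∀ i, Measurable (δ i)) {T t : ℝ≥0}
    (hT : T ≤ t) :
    continuation μ Y 𝔉 δ (hδ 0) k t ≤ᵐ[μ] μ[fun ω => k * (supFrom Y T ω).toReal | 𝔉 t] := by
  refine ae_le_of_forall_setIntegral_le_of_stronglyMeasurable (𝔉.le t) stronglyMeasurable_condExp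
    stronglyMeasurable_condExp integrable_condExp integrable_condExp fun A hA => ?_
  rw [setIntegral_condExp (𝔉.le t) ((hY.integrable_supFrom T).const_mul _) hA]
  exact setIntegral_continuation_le hY hδ hT hA

theorem condExp_le_continuation (hY : IsReward μ Y) (hδ : ∀ i, Measurable (δ i)) (t : ℝ≥0) :
    μ[fun ω => k * atTime Y (fun _ => ⊤) ω | 𝔉 t] ≤ᵐ[μ] continuation μ Y 𝔉 δ (hδ 0) k t := by
  refine ae_le_of_forall_setIntegral_le_of_stronglyMeasurable (𝔉.le t) stronglyMeasurable_condExp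
    stronglyMeasurable_condExp integrable_condExp integrable_condExp fun A hA => ?_
  rw [setIntegral_condExp (𝔉.le t) ((hY.integrable_atTime measurable_const).const_mul _) hA]
  exact le_setIntegral_continuation hY hδ hA

theorem continuation_nonneg (hY : IsReward μ Y) (hδ : ∀ i, Measurable (δ i)) (t : ℝ≥0) :
    0 ≤ᵐ[μ] continuation μ Y 𝔉 δ (hδ 0) k t := by
  refine EventuallyLE.trans (condExp_nonneg ?_) (condExp_le_continuation hY hδ t)
  filter_upwards [hY.ae_ne_top] with ω hω
  exact mul_nonneg (Nat.cast_nonneg _) (atTime_nonneg hY.nonneg hω _)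

/-- The mean cannot rise, by the supermartingale property. It cannot drop abruptly either: delaying
a nearly optimal strategy by h j changes its expected reward little, by right-continuity of Y and
dominated convergence. -/
theorem tendsto_integral_continuation (hY : IsReward μ Y) (hδ : ∀ i, Measurable (δ i)) (t : ℝ≥0)
    {h : ℕ → ℝ≥0} (hh : Tendsto h atTop (𝓝 0)) :
    Tendsto (fun j => ∫ ω, continuation μ Y 𝔉 δ (hδ 0) k (t + h j) ω ∂μ) atTop
      (𝓝 (∫ ω, continuation μ Y 𝔉 δ (hδ 0) k t ω ∂μ)) := by
  refine tendsto_order.2 ⟨fun a ha => ?_, fun a ha => Eventually.of_forall fun j => ?_⟩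
  · obtain ⟨b, hab, hb⟩ := exists_between ha
    obtain ⟨τ, hτ, h1⟩ := exists_setIntegral_continuation_le (𝔉 := 𝔉) (k := k) hY hδ t
      (sub_pos.2 hb)
    have h2 := h1 Set.univ MeasurableSet.univ
    rw [setIntegral_univ, setIntegral_univ] at h2
    have hτm : ∀ j, ∀ i < k, Measurable fun ω => τ i ω + h j := fun j i hi =>
      measurable_add (measurable_of_mem_strategies hτ hi) measurable_const
    have h3 : Tendsto (fun j => ∫ ω, reward Y k (fun i ω => τ i ω + h j) ω ∂μ) atTop
        (𝓝 (∫ ω, reward Y k τ ω ∂μ)) := by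
      refine tendsto_integral_of_dominated_convergence (fun ω => k * (supFrom Y 0 ω).toReal)
        (fun j => (hY.integrable_reward (hτm j)).aestronglyMeasurable)
        ((hY.integrable_supFrom 0).const_mul _) (fun j => ?_) ?_
      · filter_upwards [hY.ae_ne_top] with ω hω
        rw [Real.norm_of_nonneg (reward_nonneg hY.nonneg hω)]
        exact reward_le hY.nonneg hω fun _ _ => zero_le
      · exact Eventually.of_forall fun ω => tendsto_finsetSum _ fun i _ =>
          tendsto_atTime hY.rightCont hh (fun _ => le_self_add) (fun _ => le_rfl)
    have h4 : a < ∫ ω, reward Y k τ ω ∂μ := by linarith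
    filter_upwards [h3.eventually (lt_mem_nhds h4)] with j hj
    refine hj.trans_le ?_
    have h5 := setIntegral_reward_le_continuation hY hδ
      (add_mem_strategies_delay 𝔉 (δ 0) (shift δ) k t (h j) hτ) MeasurableSet.univ
    rwa [setIntegral_univ, setIntegral_univ] at h5
  · have := setIntegral_continuation_anti (𝔉 := 𝔉) (k := k) hY hδ
      (le_self_add (a := t) (b := h j)) MeasurableSet.univ
    rw [setIntegral_univ, setIntegral_univ] at this
    exact this.trans_lt ha

end Continuation

/-! ### Oscillation along the dyadic times -/

/-- The path `x` crosses the interval `[a, b]` upwards at least `K` times along the dyadic times. -/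
def HasCrossings (x : ℝ≥0 → ℝ) (a b : ℝ) (K : ℕ) : Prop :=
  ∃ p r : ℕ → ℝ≥0, ∀ i < K, p i ∈ dyadics ∧ r i ∈ dyadics ∧ p i < r i ∧ x (p i) < a ∧ b < x (r i) ∧
    (i + 1 < K → r i < p (i + 1))

/-- The path `x` crosses every interval with rational endpoints finitely often. -/
def FiniteCrossings (x : ℝ≥0 → ℝ) : Prop :=
  ∀ a b : ℚ, a < b → ∃ K, ¬ HasCrossings x a b K

section Paths

variable {x : ℝ≥0 → ℝ} {a b : ℝ}

theorem hasCrossings_of_frequently_atTop (h1 : ∃ᶠ q in atTop ⊓ 𝓟 dyadics, x q < a)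
    (h2 : ∃ᶠ q in atTop ⊓ 𝓟 dyadics, b < x q) (K : ℕ) : HasCrossings x a b K := by
  rw [frequently_inf_principal] at h1 h2
  have h1' : ∀ T, ∃ q, T < q ∧ q ∈ dyadics ∧ x q < a := fun T => frequently_atTop'.1 h1 T
  have h2' : ∀ T, ∃ q, T < q ∧ q ∈ dyadics ∧ b < x q := fun T => frequently_atTop'.1 h2 T
  choose P hP hPD hPx using h1'
  choose R hR hRD hRx using h2'
  let p : ℕ → ℝ≥0 := fun i => Nat.rec (P 0) (fun _ s => P (R s)) i
  have hp : ∀ i, p i ∈ dyadics ∧ x (p i) < a := fun i => by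
    cases i with
    | zero => exact ⟨hPD _, hPx _⟩
    | succ i => exact ⟨hPD _, hPx _⟩
  exact ⟨p, fun i => R (p i), fun i _ => ⟨(hp i).1, hRD _, hR _, (hp i).2, hRx _, fun _ => hP _⟩⟩

theorem hasCrossings_of_frequently_nhdsGT {t : ℝ≥0} (h1 : ∃ᶠ q in 𝓝[>] t ⊓ 𝓟 dyadics, x q < a)
    (h2 : ∃ᶠ q in 𝓝[>] t ⊓ 𝓟 dyadics, b < x q) (K : ℕ) : HasCrossings x a b K := by
  rw [frequently_inf_principal] at h1 h2
  -- The condition t < u is placed inside the existential so that `choose` yields total functions,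
  -- as the recursion below needs.
  have key : ∀ {p : ℝ≥0 → Prop}, (∃ᶠ q in 𝓝[>] t, p q) → ∀ u, ∃ q, t < u → t < q ∧ q < u ∧ p q := by
    intro p hp u
    by_cases hu : t < u
    · obtain ⟨q, hq, h⟩ := (hp.and_eventually (Ioo_mem_nhdsGT hu)).exists
      exact ⟨q, fun _ => ⟨h.1, h.2, hq⟩⟩
    · exact ⟨0, fun h => absurd h hu⟩
  choose P hP using key h1
  choose R hR using key h2
  let r : ℕ → ℝ≥0 := fun i => Nat.rec (R (t + 1)) (fun _ s => R (P s)) i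
  have hr : ∀ i, t < r i ∧ r i ∈ dyadics ∧ b < x (r i) := fun i => by
    induction i with
    | zero =>
      have := hR (t + 1) (lt_add_of_pos_right t one_pos)
      exact ⟨this.1, this.2.2⟩
    | succ i ih =>
      have := hR _ (hP _ ih.1).1
      exact ⟨this.1, this.2.2⟩
  have hr' : ∀ i, r (i + 1) < P (r i) := fun i => (hR _ (hP _ (hr i).1).1).2.1
  -- The chosen times run down towards t, so the first K crossings are listed in reverse order.
  refine ⟨fun i => P (r (K - 1 - i)), fun i => r (K - 1 - i), fun i hi => ?_⟩
  have h3 := hP _ (hr (K - 1 - i)).1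
  refine ⟨h3.2.2.1, (hr _).2.1, h3.2.1, h3.2.2.2, (hr _).2.2, fun hi' => ?_⟩
  have := hr' (K - 1 - (i + 1))
  rwa [show K - 1 - (i + 1) + 1 = K - 1 - i by omega] at this

theorem FiniteCrossings.exists_tendsto_nhdsGT (h : FiniteCrossings x) {C D : ℝ}
    (hC : ∀ q ∈ dyadics, x q ≤ C) (hD : ∀ q ∈ dyadics, D ≤ x q) (t : ℝ≥0) :
    ∃ c, Tendsto x (𝓝[>] t ⊓ 𝓟 dyadics) (𝓝 c) := by
  have hmem : ∀ᶠ q in 𝓝[>] t ⊓ 𝓟 dyadics, q ∈ dyadics :=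
    mem_inf_of_right (mem_principal_self _)
  refine tendsto_of_no_upcrossings (s := Set.range ((↑) : ℚ → ℝ)) Rat.denseRange_cast ?_
    ⟨C, hmem.mono fun q hq => hC q hq⟩ ⟨D, hmem.mono fun q hq => hD q hq⟩
  rintro _ ⟨a, rfl⟩ _ ⟨b, rfl⟩ hab ⟨h1, h2⟩
  obtain ⟨K, hK⟩ := h a b (by exact_mod_cast hab)
  exact hK (hasCrossings_of_frequently_nhdsGT h1 h2 K)

theorem le_of_forall_dyadic_le {t : ℝ≥0} (hx : ContinuousWithinAt x (Set.Ici t) t) {c : ℝ}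
    (h : ∀ q ∈ dyadics, t ≤ q → x q ≤ c) : x t ≤ c := by
  have h1 : Tendsto (fun m => x (ceilDyadic m t)) atTop (𝓝 (x t)) :=
    hx.tendsto.comp ((tendsto_ceilDyadic t).mono_right (nhdsWithin_mono t Set.Ioi_subset_Ici_self))
  exact le_of_tendsto' h1 fun m => h _ (dyadic_mem_dyadics _ _) (lt_ceilDyadic m t).le

theorem ge_of_forall_dyadic_ge {t : ℝ≥0} (hx : ContinuousWithinAt x (Set.Ici t) t) {c : ℝ}
    (h : ∀ q ∈ dyadics, t ≤ q → c ≤ x q) : c ≤ x t :=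
  neg_le_neg_iff.1 (le_of_forall_dyadic_le hx.neg fun q hq hq' => neg_le_neg (h q hq hq'))

/-- If dyadic values were frequently below a < b < L, then, the integer values being eventually
above b, the path would cross [a, b] arbitrarily often; levels above L are symmetric.
Right-continuity extends the bounds from dyadic to all times. -/
theorem FiniteCrossings.tendsto_atTop (h : FiniteCrossings x)
    (hx : ∀ t, ContinuousWithinAt x (Set.Ici t) t) {L : ℝ}
    (hL : Tendsto (fun N : ℕ => x N) atTop (𝓝 L)) : Tendsto x atTop (𝓝 L) := by
  have hl : Tendsto (fun N : ℕ => (N : ℝ≥0)) atTop (atTop ⊓ 𝓟 dyadics) :=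
    tendsto_inf.2 ⟨tendsto_natCast_atTop_atTop, tendsto_principal.2 (Eventually.of_forall fun N =>
      by rw [← dyadic_zero_left]; exact dyadic_mem_dyadics _ _)⟩
  have hfreq : ∀ {p : ℝ≥0 → Prop}, (∀ᶠ N : ℕ in atTop, p N) → ∃ᶠ q in atTop ⊓ 𝓟 dyadics, p q :=
    fun hp => hl.frequently hp.frequently
  refine tendsto_order.2 ⟨fun c hc => ?_, fun c hc => ?_⟩
  · obtain ⟨b, hcb, hbL⟩ := exists_rat_btwn hc
    obtain ⟨a, hca, hab⟩ := exists_rat_btwn hcb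
    obtain ⟨K, hK⟩ := h a b (by exact_mod_cast hab)
    have h2 := hfreq (p := fun q => (b : ℝ) < x q) (hL.eventually (lt_mem_nhds hbL))
    have h1 : ∀ᶠ q in atTop ⊓ 𝓟 dyadics, ¬ x q < a := not_frequently.1 fun h1 =>
      hK (hasCrossings_of_frequently_atTop h1 h2 K)
    rw [eventually_inf_principal] at h1
    obtain ⟨T, hT⟩ := eventually_atTop.1 h1
    filter_upwards [eventually_ge_atTop T] with t ht
    exact hca.trans_le (ge_of_forall_dyadic_ge (hx t) fun q hq htq =>
      not_lt.1 (hT q (ht.trans htq) hq))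
  · obtain ⟨a, hLa, hac⟩ := exists_rat_btwn hc
    obtain ⟨b, hab, hbc⟩ := exists_rat_btwn hac
    obtain ⟨K, hK⟩ := h a b (by exact_mod_cast hab)
    have h1 := hfreq (p := fun q => x q < a) (hL.eventually (gt_mem_nhds hLa))
    have h2 : ∀ᶠ q in atTop ⊓ 𝓟 dyadics, ¬ (b : ℝ) < x q := not_frequently.1 fun h2 =>
      hK (hasCrossings_of_frequently_atTop h1 h2 K)
    rw [eventually_inf_principal] at h2
    obtain ⟨T, hT⟩ := eventually_atTop.1 h2
    filter_upwards [eventually_ge_atTop T] with t ht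
    exact (le_of_forall_dyadic_le (hx t) fun q hq htq =>
      not_lt.1 (hT q (ht.trans htq) hq)).trans_lt hbc

/-- The right limits along the dyadic times form a right-continuous path. -/
theorem continuousWithinAt_rightLimit {v : ℝ≥0 → ℝ}
    (h : ∀ t, Tendsto x (𝓝[>] t ⊓ 𝓟 dyadics) (𝓝 (v t))) (t : ℝ≥0) :
    ContinuousWithinAt v (Set.Ici t) t := by
  rw [← continuousWithinAt_Ioi_iff_Ici, ContinuousWithinAt, Metric.tendsto_nhds]
  intro ε hε
  have h1 := Metric.tendsto_nhds.1 (h t) (ε / 2) (half_pos hε)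
  rw [eventually_inf_principal] at h1
  obtain ⟨u, hu, h2⟩ := mem_nhdsGT_iff_exists_Ioo_subset.1 h1
  filter_upwards [Ioo_mem_nhdsGT hu] with s hs
  have h3 : ∀ᶠ q in 𝓝[>] s ⊓ 𝓟 dyadics, dist (x q) (v t) ≤ ε / 2 := by
    rw [eventually_inf_principal]
    filter_upwards [Ioo_mem_nhdsGT hs.2] with q hq hqD
    exact (h2 ⟨hs.1.trans hq.1, hq.2⟩ hqD).le
  exact (le_of_tendsto ((h s).dist tendsto_const_nhds) h3).trans_lt (half_lt_self hε)

end Paths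

/-! ### Right-continuous modifications of supermartingales -/

section Supermartingale

variable {Ω : Type*} {m : MeasurableSpace Ω} {μ : Measure Ω} [IsFiniteMeasure μ]
  {𝔉 : Filtration ℝ≥0 m} {V : ℝ≥0 → Ω → ℝ}

/-- The filtration along the `j`-th dyadic grid. -/
noncomputable def gridFiltration {Ω : Type*} {m : MeasurableSpace Ω} (𝔉 : Filtration ℝ≥0 m) (j : ℕ) :
    Filtration ℕ m where
  seq i := 𝔉 (dyadic j i)
  mono' _ _ h := 𝔉.mono (dyadic_mono j h)
  le' _ := 𝔉.le _

omit [IsFiniteMeasure μ] in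
theorem Submartingale.grid (hV : Submartingale V 𝔉 μ) (j : ℕ) :
    Submartingale (fun i => V (dyadic j i)) (gridFiltration 𝔉 j) μ :=
  ⟨fun i => hV.1 (dyadic j i), fun _ _ h => hV.2.1 _ _ (dyadic_mono j h), fun _ => hV.2.2 _⟩

/-- Finitely many dyadic times lie together on every sufficiently fine grid, and there each crossing
completes at least one further upcrossing. -/
theorem le_upcrossings_of_hasCrossings {a b : ℝ} (hab : a < b) {ω : Ω} {K : ℕ}
    (h : HasCrossings (fun t => V t ω) a b K) :
    ∀ᶠ j in atTop, (K : ℝ≥0∞) ≤ upcrossings a b (fun i => V (dyadic j i)) ω := by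
  obtain ⟨p, r, h⟩ := h
  have hgrid : ∀ q ∈ dyadics, ∀ᶠ j in atTop, ∃ i, q = dyadic j i := by
    rintro _ ⟨⟨j0, i0⟩, rfl⟩
    filter_upwards [eventually_ge_atTop j0] with j hj
    refine ⟨2 ^ (j - j0) * i0, ?_⟩
    have := dyadic_add j0 (j - j0) i0
    rw [Nat.add_sub_cancel' hj] at this
    exact this.symm
  have hev : ∀ᶠ j in atTop, ∀ i ∈ Finset.range K,
      (∃ n, p i = dyadic j n) ∧ ∃ n, r i = dyadic j n := by
    rw [Filter.eventually_all_finset]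
    intro i hi
    have := h i (Finset.mem_range.1 hi)
    exact (hgrid _ this.1).and (hgrid _ this.2.1)
  filter_upwards [hev] with j hj
  have hj' : ∀ i, ∃ P R : ℕ, i < K → p i = dyadic j P ∧ r i = dyadic j R := fun i => by
    by_cases hi : i < K
    · obtain ⟨⟨P, hP⟩, ⟨R, hR⟩⟩ := hj i (Finset.mem_range.2 hi)
      exact ⟨P, R, fun _ => ⟨hP, hR⟩⟩
    · exact ⟨0, 0, fun h => absurd h hi⟩
  choose P R hPR using hj'
  -- Invariant: i upcrossings are completed before step N, and the next crossing starts no earlier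
  -- than N.
  suffices hind : ∀ i ≤ K, ∃ N, i ≤ upcrossingsBefore a b (fun i => V (dyadic j i)) N ω ∧
      (i < K → N ≤ P i) by
    obtain ⟨N, hN, -⟩ := hind K le_rfl
    exact le_iSup_of_le N (by exact_mod_cast hN)
  intro i
  induction i with
  | zero => exact fun _ => ⟨0, Nat.zero_le _, fun _ => Nat.zero_le _⟩
  | succ i ih =>
    intro hi
    obtain ⟨N, hN, hNP⟩ := ih (Nat.le_of_succ_le hi)
    have hiK : i < K := hi
    obtain ⟨-, -, h1, h2, h3, h4⟩ := h i hiK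
    obtain ⟨hPi, hRi⟩ := hPR i hiK
    rw [hPi, hRi] at h1
    simp only [hPi, hRi] at h2 h3
    refine ⟨R i + 1, Nat.lt_of_le_of_lt hN (upcrossingsBefore_lt_of_exists_upcrossing hab
      (hNP hiK) h2 (lt_of_dyadic_lt h1).le h3), fun hi' => ?_⟩
    have := h4 hi'
    rw [hRi, (hPR _ hi').1] at this
    exact lt_of_dyadic_lt this

/-- As V ≤ 0, (V - a)⁺ ≤ |a|, so the upcrossing inequality is uniform over the grids. By Fatou the
liminf of the upcrossings is almost surely finite, whereas unboundedly many crossings would make it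
infinite. -/
theorem ae_exists_not_hasCrossings (hV : Submartingale V 𝔉 μ) (hV0 : ∀ t, V t ≤ᵐ[μ] 0) {a b : ℝ}
    (hab : a < b) : ∀ᵐ ω ∂μ, ∃ K, ¬ HasCrossings (fun t => V t ω) a b K := by
  have hU : ∀ j, ENNReal.ofReal (b - a) * ∫⁻ ω, upcrossings a b (fun i => V (dyadic j i)) ω ∂μ ≤
      ENNReal.ofReal |a| * μ Set.univ := fun j => by
    refine ((Submartingale.grid hV j).mul_lintegral_upcrossings_le_lintegral_pos_part a b).trans
      (iSup_le fun N => ?_)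
    rw [← lintegral_const]
    refine lintegral_mono_ae ?_
    filter_upwards [hV0 (dyadic j N)] with ω hω
    refine ENNReal.ofReal_le_ofReal (sup_le ?_ (abs_nonneg a))
    have : V (dyadic j N) ω ≤ 0 := hω
    linarith [neg_abs_le a]
  set C : ℝ≥0∞ := ENNReal.ofReal |a| * μ Set.univ / ENNReal.ofReal (b - a) with hC
  have hb : ENNReal.ofReal (b - a) ≠ 0 := by simpa using hab
  have hC' : C < ∞ := ENNReal.div_lt_top (by finiteness) hb
  have hU' : ∀ j, ∫⁻ ω, upcrossings a b (fun i => V (dyadic j i)) ω ∂μ ≤ C := fun j => by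
    rw [hC, ENNReal.le_div_iff_mul_le (Or.inl hb) (Or.inl ENNReal.ofReal_ne_top), mul_comm]
    exact hU j
  have hUm : ∀ j, Measurable (upcrossings a b (fun i => V (dyadic j i))) := fun j =>
    (Submartingale.grid hV j).stronglyAdapted.measurable_upcrossings hab
  have hlim : ∫⁻ ω, liminf (fun j => upcrossings a b (fun i => V (dyadic j i)) ω) atTop ∂μ ≤ C :=
    (lintegral_liminf_le hUm).trans (liminf_le_of_le (by isBoundedDefault)
      fun c hc => by obtain ⟨j, hj⟩ := hc.exists; exact hj.trans (hU' j))
  filter_upwards [ae_lt_top (.liminf hUm) (hlim.trans_lt hC').ne] with ω hω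
  by_contra! hcon
  refine hω.ne (ENNReal.eq_top_of_forall_nnreal_le fun c => ?_)
  obtain ⟨K, hK⟩ := exists_nat_ge c
  refine le_liminf_of_le (by isBoundedDefault) ?_
  filter_upwards [le_upcrossings_of_hasCrossings hab (hcon K)] with j hj
  exact le_trans (by exact_mod_cast hK) hj

theorem ae_finiteCrossings (hV : Submartingale V 𝔉 μ) (hV0 : ∀ t, V t ≤ᵐ[μ] 0) :
    ∀ᵐ ω ∂μ, FiniteCrossings fun t => V t ω := by
  simp only [FiniteCrossings, ae_all_iff]
  intro a b hab
  exact ae_exists_not_hasCrossings hV hV0 (by exact_mod_cast hab)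

theorem measure_exists_dyadic_ge_le (hV : Submartingale V 𝔉 μ) (hV0 : 0 ≤ V) {C : ℝ≥0∞}
    (hC : ∀ t, ENNReal.ofReal (∫ ω, V t ω ∂μ) ≤ C) (c : ℝ≥0) :
    c * μ {ω | ∃ q ∈ dyadics, (c : ℝ) ≤ V q ω} ≤ C := by
  -- Indices up to j * 2 ^ j are the grid times up to j: passing from j to j + 1 refines the grid
  -- and extends the horizon, so the sets increase.
  set E : ℕ → Set Ω := fun j => {ω | ∃ i ≤ j * 2 ^ j, (c : ℝ) ≤ V (dyadic j i) ω} with hE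
  have hmono : Monotone E := by
    refine monotone_nat_of_le_succ fun j ω => ?_
    rintro ⟨i, hi, h⟩
    refine ⟨2 * i, ?_, by rwa [dyadic_succ]⟩
    calc 2 * i ≤ 2 * (j * 2 ^ j) := by gcongr
      _ = j * 2 ^ (j + 1) := by ring
      _ ≤ (j + 1) * 2 ^ (j + 1) := by gcongr; exact Nat.le_succ j
  have hunion : {ω | ∃ q ∈ dyadics, (c : ℝ) ≤ V q ω} ⊆ ⋃ j, E j := by
    rintro ω ⟨_, ⟨⟨j, i⟩, rfl⟩, h⟩
    refine Set.mem_iUnion.2 ⟨j + i, 2 ^ i * i, ?_, by rwa [dyadic_add]⟩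
    calc 2 ^ i * i ≤ 2 ^ (j + i) * (j + i) :=
          Nat.mul_le_mul (Nat.pow_le_pow_right two_pos (Nat.le_add_left i j)) (Nat.le_add_left i j)
      _ = (j + i) * 2 ^ (j + i) := mul_comm _ _
  have hEC : ∀ j, c * μ (E j) ≤ C := fun j => by
    have h := maximal_ineq (Submartingale.grid hV j) (fun i => hV0 (dyadic j i)) (ε := c)
      (j * 2 ^ j)
    have hEeq : E j = {ω | (c : ℝ) ≤ (Finset.range (j * 2 ^ j + 1)).sup'
        Finset.nonempty_range_add_one fun k => V (dyadic j k) ω} := by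
      ext ω
      simp only [hE, Set.mem_ofPred_eq, Finset.le_sup'_iff, Finset.mem_range, Nat.lt_succ_iff]
    rw [hEeq]
    refine h.trans (le_trans (ENNReal.ofReal_le_ofReal ?_) (hC (dyadic j (j * 2 ^ j))))
    exact setIntegral_le_integral (hV.integrable _) (Eventually.of_forall fun ω => hV0 _ ω)
  calc c * μ {ω | ∃ q ∈ dyadics, (c : ℝ) ≤ V q ω} ≤ c * μ (⋃ j, E j) := by gcongr
    _ = ⨆ j, c * μ (E j) := by rw [hmono.measure_iUnion, ENNReal.mul_iSup]
    _ ≤ C := iSup_le hEC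

theorem ae_bddAbove_dyadic (hV : Submartingale V 𝔉 μ) (hV0 : 0 ≤ V) {C : ℝ≥0∞} (hC' : C ≠ ∞)
    (hC : ∀ t, ENNReal.ofReal (∫ ω, V t ω ∂μ) ≤ C) : ∀ᵐ ω ∂μ, ∃ c, ∀ q ∈ dyadics, V q ω ≤ c := by
  rw [ae_iff]
  have hle : ∀ N : ℕ, μ {ω | ¬ ∃ c, ∀ q ∈ dyadics, V q ω ≤ c} ≤ C / ((N + 1 : ℝ≥0) : ℝ≥0∞) :=
    fun N => by
    rw [ENNReal.le_div_iff_mul_le (Or.inl (by simp)) (Or.inl ENNReal.coe_ne_top), mul_comm]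
    refine le_trans ?_ (measure_exists_dyadic_ge_le hV hV0 hC (N + 1))
    refine mul_le_mul_right (measure_mono fun ω hω => ?_) _
    simp only [Set.mem_ofPred_eq] at hω
    push Not at hω
    obtain ⟨q, hq, h⟩ := hω ((N + 1 : ℝ≥0) : ℝ)
    exact ⟨q, hq, h.le⟩
  have hlim : Tendsto (fun N : ℕ => C / ((N + 1 : ℝ≥0) : ℝ≥0∞)) atTop (𝓝 0) := by
    have h1 : Tendsto (fun N : ℕ => ((N + 1 : ℝ≥0) : ℝ≥0∞)) atTop (𝓝 ∞) := by
      have := (tendsto_add_atTop_iff_nat 1).2 ENNReal.tendsto_nat_nhds_top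
      refine this.congr fun N => by push_cast; rfl
    have := ENNReal.Tendsto.const_div h1 (Or.inr hC')
    simpa using this
  exact le_antisymm (ge_of_tendsto' hlim hle) zero_le

/-- The positive part is an L¹-bounded submartingale, to which the maximal inequality applies. The
bound keeps the dyadic right limits of a dominated process finite. -/
theorem ae_bddAbove_condExp_dyadic {g : Ω → ℝ} :
    ∀ᵐ ω ∂μ, ∃ c, ∀ q ∈ dyadics, (μ[g | 𝔉 q]) ω ≤ c := by
  have hM : Submartingale (fun t => (μ[g | 𝔉 t])⁺) 𝔉 μ :=
    (martingale_condExp g 𝔉 μ).submartingale.pos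
  have hbound : ∀ t, ENNReal.ofReal (∫ ω, (μ[g | 𝔉 t])⁺ ω ∂μ) ≤
      ENNReal.ofReal (∫ ω, |g ω| ∂μ) := fun t => by
    refine ENNReal.ofReal_le_ofReal (le_trans (integral_mono (hM.integrable t)
      (integrable_condExp (m := 𝔉 t)).abs fun ω => ?_) (integral_abs_condExp_le g))
    exact sup_le (le_abs_self _) (abs_nonneg _)
  filter_upwards [ae_bddAbove_dyadic hM (fun t ω => posPart_nonneg _) ENNReal.ofReal_ne_top hbound]
    with ω ⟨c, hc⟩
  exact ⟨c, fun q hq => (le_posPart _).trans (hc q hq)⟩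

end Supermartingale

/-! ### Regularisation of supermartingales dominated by a closed martingale -/

section Supermartingale

variable {Ω : Type*} {m : MeasurableSpace Ω} {μ : Measure Ω} [IsFiniteMeasure μ]
  {𝔉 : Filtration ℝ≥0 m} {V : ℝ≥0 → Ω → ℝ} {g : Ω → ℝ}

theorem unifIntegrable_of_le_condExp (hg : Integrable g μ) (hV0 : ∀ t, 0 ≤ᵐ[μ] V t)
    (hVg : ∀ t, V t ≤ᵐ[μ] μ[g | 𝔉 t]) (s : ℕ → ℝ≥0) : UnifIntegrable (fun j => V (s j)) 1 μ := by
  intro ε hε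
  obtain ⟨η, hη, h⟩ := (hg.uniformIntegrable_condExp (ℱ := fun j => 𝔉 (s j))
    fun j => 𝔉.le (s j)).unifIntegrable hε
  refine ⟨η, hη, fun j A hA hμA => (eLpNorm_mono_ae ?_).trans (h j A hA hμA)⟩
  filter_upwards [hV0 (s j), hVg (s j)] with ω h1 h2
  by_cases hω : ω ∈ A
  · simp only [Set.indicator_of_mem hω]
    rw [Real.norm_of_nonneg h1]
    exact h2.trans (le_abs_self _)
  · simp only [Set.indicator_of_notMem hω, le_refl]

/-- Domination by a closed martingale gives uniform integrability, so by Vitali's theorem almost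
sure limits are L¹ limits. -/
theorem tendsto_setIntegral_of_le_condExp (hVi : ∀ t, Integrable (V t) μ) (hg : Integrable g μ)
    (hV0 : ∀ t, 0 ≤ᵐ[μ] V t) (hVg : ∀ t, V t ≤ᵐ[μ] μ[g | 𝔉 t]) {s : ℕ → ℝ≥0} {X : Ω → ℝ}
    (hX : Integrable X μ) (hlim : ∀ᵐ ω ∂μ, Tendsto (fun j => V (s j) ω) atTop (𝓝 (X ω)))
    (A : Set Ω) :
    Tendsto (fun j => ∫ ω in A, V (s j) ω ∂μ) atTop (𝓝 (∫ ω in A, X ω ∂μ)) := by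
  refine tendsto_setIntegral_of_L1' X hX.aestronglyMeasurable
    (Eventually.of_forall fun j => hVi (s j)) ?_ A
  exact tendsto_Lp_finite_of_tendsto_ae le_rfl ENNReal.one_ne_top
    (fun j => (hVi (s j)).aestronglyMeasurable) (memLp_one_iff_integrable.2 hX)
    (unifIntegrable_of_le_condExp hg hV0 hVg s) hlim

theorem integrable_of_tendsto_of_le_condExp (hVi : ∀ t, Integrable (V t) μ)
    (hV0 : ∀ t, 0 ≤ᵐ[μ] V t) (hVg : ∀ t, V t ≤ᵐ[μ] μ[g | 𝔉 t]) {s : ℕ → ℝ≥0} {X : Ω → ℝ}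
    (hlim : ∀ᵐ ω ∂μ, Tendsto (fun j => V (s j) ω) atTop (𝓝 (X ω))) : Integrable X μ := by
  have hXm : AEStronglyMeasurable X μ :=
    aestronglyMeasurable_of_tendsto_ae atTop (fun j => (hVi (s j)).aestronglyMeasurable) hlim
  refine ⟨hXm, ?_⟩
  have hb : ∀ j, ∫⁻ ω, ‖V (s j) ω‖ₑ ∂μ ≤ ENNReal.ofReal (∫ ω, g ω ∂μ) := fun j => by
    have h1 : ∫⁻ ω, ‖V (s j) ω‖ₑ ∂μ = ENNReal.ofReal (∫ ω, V (s j) ω ∂μ) := by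
      rw [ofReal_integral_eq_lintegral_ofReal (hVi _) (hV0 _)]
      refine lintegral_congr_ae ?_
      filter_upwards [hV0 (s j)] with ω h
      exact Real.enorm_of_nonneg h
    rw [h1]
    refine ENNReal.ofReal_le_ofReal ?_
    exact (integral_mono_ae (hVi _) integrable_condExp (hVg _)).trans_eq
      (integral_condExp (𝔉.le (s j)))
  calc ∫⁻ ω, ‖X ω‖ₑ ∂μ ≤ ∫⁻ ω, liminf (fun j => ‖V (s j) ω‖ₑ) atTop ∂μ := by
        refine lintegral_mono_ae ?_
        filter_upwards [hlim] with ω hω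
        exact hω.enorm.liminf_eq.ge
    _ ≤ liminf (fun j => ∫⁻ ω, ‖V (s j) ω‖ₑ ∂μ) atTop :=
        lintegral_liminf_le' fun j => (hVi (s j)).aestronglyMeasurable.enorm
    _ ≤ ENNReal.ofReal (∫ ω, g ω ∂μ) := liminf_le_of_le (by isBoundedDefault)
        fun c hc => by obtain ⟨j, hj⟩ := hc.exists; exact hj.trans (hb j)
    _ < ∞ := ENNReal.ofReal_lt_top

theorem ae_exists_rightLimit (hV : Submartingale (fun t ω => -V t ω) 𝔉 μ)
    (hV0 : ∀ t, 0 ≤ᵐ[μ] V t) (hVg : ∀ t, V t ≤ᵐ[μ] μ[g | 𝔉 t]) :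
    ∀ᵐ ω ∂μ, ∀ t, ∃ c, Tendsto (fun q => V q ω) (𝓝[>] t ⊓ 𝓟 dyadics) (𝓝 c) := by
  have hfc := ae_finiteCrossings hV fun t => by
    filter_upwards [hV0 t] with ω hω
    exact neg_nonpos.2 hω
  have h0 : ∀ᵐ ω ∂μ, ∀ q ∈ dyadics, 0 ≤ V q ω :=
    (ae_ball_iff countable_dyadics).2 fun q _ => hV0 q
  have h1 : ∀ᵐ ω ∂μ, ∀ q ∈ dyadics, V q ω ≤ (μ[g | 𝔉 q]) ω :=
    (ae_ball_iff countable_dyadics).2 fun q _ => hVg q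
  filter_upwards [hfc, h0, h1, ae_bddAbove_condExp_dyadic (𝔉 := 𝔉) (μ := μ) (g := g)]
    with ω hω h0 h1 ⟨C, hC⟩ t
  obtain ⟨c, hc⟩ := hω.exists_tendsto_nhdsGT (C := 0) (D := -C)
    (fun q hq => neg_nonpos.2 (h0 q hq)) (fun q hq => neg_le_neg ((h1 q hq).trans (hC q hq))) t
  exact ⟨-c, by simpa using hc.neg⟩

/-- Under the usual conditions, a non-negative supermartingale that is dominated by a closed
martingale and has a right-continuous mean has a right-continuous modification. -/
theorem exists_isRightContinuousModification (h𝔉 : 𝔉.IsRightContinuous)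
    (hcomplete : ∀ N : Set Ω, μ N = 0 → MeasurableSet[𝔉 0] N)
    (hV : Submartingale (fun t ω => -V t ω) 𝔉 μ) (hV0 : ∀ t, 0 ≤ᵐ[μ] V t)
    (hg : Integrable g μ) (hVg : ∀ t, V t ≤ᵐ[μ] μ[g | 𝔉 t])
    (hmean : ∀ (t : ℝ≥0) (h : ℕ → ℝ≥0), Tendsto h atTop (𝓝 0) →
      Tendsto (fun j => ∫ ω, V (t + h j) ω ∂μ) atTop (𝓝 (∫ ω, V t ω ∂μ))) :
    ∃ X, IsRightContinuousModification μ V X := by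
  classical
  -- On G all dyadic right limits exist. Its complement is null, so completeness puts G in ℱ_0, and
  -- setting X to 0 off G spoils neither adaptedness nor right-continuity.
  set G : Set Ω := {ω | ∀ t, ∃ c, Tendsto (fun q => V q ω) (𝓝[>] t ⊓ 𝓟 dyadics) (𝓝 c)} with hGdef
  have hG : ∀ᵐ ω ∂μ, ω ∈ G := ae_exists_rightLimit hV hV0 hVg
  have hGm : MeasurableSet[𝔉 0] G := by
    rw [← compl_compl G]
    exact (hcomplete Gᶜ hG).compl
  have hVm : ∀ t, StronglyMeasurable[𝔉 t] (V t) := fun t => by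
    have h := (hV.stronglyMeasurable t).neg
    rwa [show (-fun ω => -V t ω) = V t from funext fun ω => neg_neg _] at h
  have hVi : ∀ t, Integrable (V t) μ := fun t => by simpa using (hV.integrable t).neg
  set X : ℝ≥0 → Ω → ℝ := fun t ω =>
    if ω ∈ G then limUnder (𝓝[>] t ⊓ 𝓟 dyadics) (fun q => V q ω) else 0 with hX
  have hlim : ∀ ω ∈ G, ∀ t, Tendsto (fun q => V q ω) (𝓝[>] t ⊓ 𝓟 dyadics) (𝓝 (X t ω)) := by
    intro ω hω t
    simp only [hX, if_pos hω]
    exact tendsto_nhds_limUnder (hω t)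
  have hlim' : ∀ t, ∀ᵐ ω ∂μ, Tendsto (fun j => V (ceilDyadic j t) ω) atTop (𝓝 (X t ω)) := fun t =>
    hG.mono fun ω hω => (hlim ω hω t).comp (tendsto_ceilDyadic_inf t)
  have hXm : ∀ t, StronglyMeasurable[𝔉 t] (X t) := fun t => by
    -- The right limit at t involves only times in (t, s), so X t is ℱ_s-measurable for each s > t;
    -- right-continuity of the filtration then gives ℱ_t.
    have hs : ∀ s, t < s → StronglyMeasurable[𝔉 s] (X t) := fun s hs => by
      obtain ⟨J, hJ⟩ := eventually_atTop.1 (((tendsto_ceilDyadic t).mono_right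
        nhdsWithin_le_nhds).eventually (gt_mem_nhds hs))
      refine stronglyMeasurable_of_tendsto atTop
        (f := fun j => G.indicator (V (ceilDyadic (j + J) t))) (fun j => ?_) ?_
      · exact ((hVm _).mono (𝔉.mono (hJ _ (Nat.le_add_left J j)).le)).indicator
          (𝔉.mono zero_le _ hGm)
      · refine tendsto_pi_nhds.2 fun ω => ?_
        by_cases hω : ω ∈ G
        · simp only [Set.indicator_of_mem hω]
          exact ((hlim ω hω t).comp (tendsto_ceilDyadic_inf t)).comp (tendsto_add_atTop_nat J)
        · simp only [Set.indicator_of_notMem hω, hX, if_neg hω]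
          exact tendsto_const_nhds
    refine Measurable.stronglyMeasurable fun B hB => ?_
    refine h𝔉.RC t _ ?_
    rw [Filtration.rightCont_eq]
    simp only [MeasurableSpace.measurableSet_iInf]
    exact fun s hts => (hs s hts).measurable hB
  have hXi : ∀ t, Integrable (X t) μ := fun t =>
    integrable_of_tendsto_of_le_condExp hVi hV0 hVg (hlim' t)
  have htend := fun t => tendsto_setIntegral_of_le_condExp hVi hg hV0 hVg (hXi t) (hlim' t)
  refine ⟨X, fun ω t => ?_, fun t => ?_⟩
  · by_cases hω : ω ∈ G
    · exact continuousWithinAt_rightLimit (hlim ω hω) t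
    · simp only [hX, if_neg hω]
      exact continuousWithinAt_const
  -- The supermartingale inequality passes to the limit as X t ≤ V t. The right-continuous mean
  -- makes the integrals equal, which forces equality almost surely.
  · have hle : X t ≤ᵐ[μ] V t := by
      refine ae_le_of_forall_setIntegral_le_of_stronglyMeasurable (𝔉.le t) (hXm t) (hVm t) (hXi t)
        (hVi t) fun A hA => ?_
      refine le_of_tendsto' (htend t A) fun j => ?_
      have := hV.setIntegral_le (lt_ceilDyadic j t).le hA
      rw [integral_neg, integral_neg] at this
      exact neg_le_neg_iff.1 this
    have hint : ∫ ω, X t ω ∂μ = ∫ ω, V t ω ∂μ := by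
      have h1 := htend t Set.univ
      simp only [setIntegral_univ] at h1
      have h2 : Tendsto (fun j => ceilDyadic j t - t) atTop (𝓝 0) := by
        have := ((tendsto_ceilDyadic t).mono_right nhdsWithin_le_nhds).sub
          (tendsto_const_nhds (x := t))
        rwa [tsub_self] at this
      have h3 := hmean t _ h2
      simp only [fun j => add_tsub_cancel_of_le (lt_ceilDyadic j t).le] at h3
      exact tendsto_nhds_unique h1 h3
    have h0 : 0 ≤ᵐ[μ] fun ω => V t ω - X t ω := by
      filter_upwards [hle] with ω hω
      exact sub_nonneg.2 hω
    have h1 : ∫ ω, (V t ω - X t ω) ∂μ = 0 := by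
      rw [integral_sub (hVi t) (hXi t), hint, sub_self]
    filter_upwards [(integral_eq_zero_iff_of_nonneg_ae h0 ((hVi t).sub (hXi t))).1 h1] with ω hω
    exact (sub_eq_zero.1 hω).symm

/-- A right-continuous modification of a supermartingale converges as soon as the supermartingale
converges along the integers. -/
theorem IsRightContinuousModification.ae_tendsto_atTop {X : ℝ≥0 → Ω → ℝ}
    (hX : IsRightContinuousModification μ V X)
    (hV : Submartingale (fun t ω => -V t ω) 𝔉 μ) (hV0 : ∀ t, 0 ≤ᵐ[μ] V t) {L : Ω → ℝ}
    (hL : ∀ᵐ ω ∂μ, Tendsto (fun N : ℕ => V N ω) atTop (𝓝 (L ω))) :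
    ∀ᵐ ω ∂μ, Tendsto (fun t => X t ω) atTop (𝓝 (L ω)) := by
  have hfc := ae_finiteCrossings hV fun t => by
    filter_upwards [hV0 t] with ω hω
    exact neg_nonpos.2 hω
  have hXV : ∀ᵐ ω ∂μ, ∀ q ∈ dyadics, X q ω = V q ω :=
    (ae_ball_iff countable_dyadics).2 fun q _ => hX.2 q
  filter_upwards [hfc, hXV, hL] with ω h1 h2 h3
  -- Crossings are tested at dyadic times only, where X and V agree.
  have h1' : FiniteCrossings fun t => -X t ω := by
    intro a b hab
    obtain ⟨K, hK⟩ := h1 a b hab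
    refine ⟨K, fun ⟨p, r, h⟩ => hK ⟨p, r, fun i hi => ?_⟩⟩
    have := h i hi
    simpa only [h2 _ this.1, h2 _ this.2.1] using this
  have h4 : Tendsto (fun N : ℕ => -X N ω) atTop (𝓝 (-L ω)) := by
    refine (h3.neg).congr fun N => ?_
    rw [h2]
    rw [← dyadic_zero_left]
    exact dyadic_mem_dyadics _ _
  simpa using (h1'.tendsto_atTop (fun t => (hX.1 ω t).neg) h4).neg

end Supermartingale

/-! ### The continuation value as a process -/

section ContinuationInTime

variable {Ω : Type*} {m : MeasurableSpace Ω} {μ : Measure Ω} [IsFiniteMeasure μ] {Y : ℝ≥0 → Ω → ℝ}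
  {𝔉 : Filtration ℝ≥0 m} {δ : ℕ → Ω → WithTop ℝ≥0} {k : ℕ}

theorem submartingale_neg_continuation (hY : IsReward μ Y) (hδ : ∀ i, Measurable (δ i)) :
    Submartingale (fun t ω => -continuation μ Y 𝔉 δ (hδ 0) k t ω) 𝔉 μ := by
  refine submartingale_of_setIntegral_le (fun t => stronglyMeasurable_condExp.neg)
    (fun t => (integrable_continuation (hδ 0) t).neg) fun s t hst A hA => ?_
  rw [integral_neg, integral_neg]
  exact neg_le_neg (setIntegral_continuation_anti hY hδ hst hA)

theorem exists_isRightContinuousModification_continuation (h𝔉 : 𝔉.IsRightContinuous)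
    (hcomplete : ∀ N : Set Ω, μ N = 0 → MeasurableSet[𝔉 0] N) (hY : IsReward μ Y)
    (hδ : ∀ i, Measurable (δ i)) :
    ∃ Z, IsRightContinuousModification μ (continuation μ Y 𝔉 δ (hδ 0) k) Z :=
  exists_isRightContinuousModification h𝔉 hcomplete (submartingale_neg_continuation hY hδ)
    (continuation_nonneg hY hδ) ((hY.integrable_supFrom 0).const_mul k)
    (fun _ => continuation_le_condExp hY hδ zero_le)
    (fun t _ hh => tendsto_integral_continuation hY hδ t hh)

/-- For T ≤ N, k E(Y(∞) | ℱ_N) ≤ Z̄(N) ≤ k E(sup_{s ≥ T} Y(s) | ℱ_N) almost surely. Lévy's upward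
theorem in N, followed by T → ∞, squeezes Z̄(N) to k Y(∞). -/
theorem ae_tendsto_continuation_nat (hY : IsReward μ Y) (hYa : StronglyAdapted 𝔉 Y)
    (hδ : ∀ i, Measurable (δ i)) :
    ∀ᵐ ω ∂μ, Tendsto (fun N : ℕ => continuation μ Y 𝔉 δ (hδ 0) k N ω) atTop
      (𝓝 (k * atTime Y (fun _ => ⊤) ω)) := by
  set ℱ := gridFiltration 𝔉 0
  have hℱ : ∀ N : ℕ, ℱ N = 𝔉 N := fun N => congrArg 𝔉 (dyadic_zero_left N)
  have hYm : ∀ t, Measurable[⨆ N, ℱ N] (Y t) := fun t => by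
    obtain ⟨N, hN⟩ := exists_nat_ge t
    refine (hYa t).measurable.mono ?_ le_rfl
    refine (𝔉.mono hN).trans ((hℱ N).ge.trans (le_iSup (fun N => (ℱ N : MeasurableSpace Ω)) N))
  have hSm : ∀ T, Measurable[⨆ N, ℱ N] fun ω => (supFrom Y T ω).toReal := fun T =>
    (measurable_supFrom (m := ⨆ N, ℱ N) hY.rightCont hYm T).ennreal_toReal
  have hupper : ∀ T : ℕ, ∀ᵐ ω ∂μ, Tendsto
      (fun N : ℕ => (μ[fun ω => k * (supFrom Y T ω).toReal | 𝔉 N]) ω) atTop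
      (𝓝 (k * (supFrom Y T ω).toReal)) := fun T => by
    have := ((hY.integrable_supFrom T).const_mul k).tendsto_ae_condExp (ℱ := ℱ)
      ((hSm T).const_mul (k : ℝ)).stronglyMeasurable
    simpa only [hℱ] using this
  -- A version of Y(∞) that is measurable for the σ-algebra generated by all ℱ_N, as Lévy's theorem
  -- requires.
  set L : Ω → ℝ := fun ω => limsup (fun N : ℕ => (supFrom Y N ω).toReal) atTop with hL
  have hLm : Measurable[⨆ N, ℱ N] L := Measurable.limsup fun N : ℕ => hSm N
  have hLY : (fun ω => k * atTime Y (fun _ => ⊤) ω) =ᵐ[μ] fun ω => k * L ω := by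
    filter_upwards [hY.ae_ne_top] with ω hω
    rw [show L ω = limsup (fun t => Y t ω) atTop from (tendsto_supFrom hY.nonneg hω).limsup_eq,
      atTime_top (τ := fun _ => ⊤) rfl]
  have hLi : Integrable (fun ω => k * L ω) μ :=
    ((hY.integrable_atTime measurable_const).const_mul (k : ℝ)).congr hLY
  have hlower : ∀ᵐ ω ∂μ, Tendsto
      (fun N : ℕ => (μ[fun ω => k * L ω | 𝔉 N]) ω) atTop (𝓝 (k * L ω)) := by
    have := hLi.tendsto_ae_condExp (ℱ := ℱ) (hLm.const_mul (k : ℝ)).stronglyMeasurable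
    simpa only [hℱ] using this
  have hVle : ∀ᵐ ω ∂μ, ∀ T N : ℕ, T ≤ N → continuation μ Y 𝔉 δ (hδ 0) k N ω ≤
      (μ[fun ω => k * (supFrom Y T ω).toReal | 𝔉 N]) ω := by
    simp only [ae_all_iff]
    exact fun T N hTN => continuation_le_condExp hY hδ (by exact_mod_cast hTN)
  have hVge : ∀ᵐ ω ∂μ, ∀ N : ℕ,
      (μ[fun ω => k * L ω | 𝔉 N]) ω ≤ continuation μ Y 𝔉 δ (hδ 0) k N ω := by
    rw [ae_all_iff]
    exact fun N => (condExp_congr_ae hLY).symm.trans_le (condExp_le_continuation hY hδ N)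
  filter_upwards [ae_all_iff.2 hupper, hlower, hVle, hVge, hLY, hY.ae_ne_top]
    with ω h1 h2 h3 h4 h5 h6
  have h7 : Tendsto (fun T : ℕ => k * (supFrom Y T ω).toReal) atTop
      (𝓝 (k * atTime Y (fun _ => ⊤) ω)) := (tendsto_supFrom hY.nonneg h6).const_mul _
  refine tendsto_order.2 ⟨fun c hc => ?_, fun c hc => ?_⟩
  · rw [h5] at hc
    filter_upwards [h2.eventually (lt_mem_nhds hc)] with N hN
    exact hN.trans_le (h4 N)
  · obtain ⟨T, hT⟩ := (h7.eventually (gt_mem_nhds hc)).exists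
    filter_upwards [(h1 T).eventually (gt_mem_nhds hT), eventually_ge_atTop T] with N hN hTN
    exact (h3 T N hTN).trans_lt hN

theorem limsup_add_of_tendsto {y z : ℝ≥0 → ℝ} {L : ℝ} (hy : IsBoundedUnder (· ≤ ·) atTop y)
    (hy' : IsBoundedUnder (· ≥ ·) atTop y) (hz : Tendsto z atTop (𝓝 L)) :
    limsup (fun t => y t + z t) atTop = limsup y atTop + L := by
  refine le_antisymm ?_ ?_
  · have := limsup_add_le (f := atTop) (u := y) (v := z) hy' hy
      hz.isBoundedUnder_ge.isCoboundedUnder_le hz.isBoundedUnder_le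
    rwa [hz.limsup_eq] at this
  · have := le_limsup_add (f := atTop) (u := y) (v := z) hy hy'.isCoboundedUnder_le
      hz.isBoundedUnder_le hz.isBoundedUnder_ge
    rwa [hz.liminf_eq] at this

/-- The limsup of the sum splits because Z actually converges, to k Y(∞). Stopping the ordinary
problem at ∞ is thus worth k + 1 exercises at ∞. -/
theorem ae_atTime_top_add (hY : IsReward μ Y) (hYa : StronglyAdapted 𝔉 Y)
    (hδ : ∀ i, Measurable (δ i)) {Z : ℝ≥0 → Ω → ℝ}
    (hZ : IsRightContinuousModification μ (continuation μ Y 𝔉 δ (hδ 0) k) Z) :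
    ∀ᵐ ω ∂μ, atTime (fun t ω => Y t ω + Z t ω) (fun _ => ⊤) ω =
      (k + 1) * atTime Y (fun _ => ⊤) ω := by
  filter_upwards [hZ.ae_tendsto_atTop (submartingale_neg_continuation hY hδ)
    (continuation_nonneg hY hδ) (ae_tendsto_continuation_nat hY hYa hδ), hY.ae_ne_top] with ω h h'
  rw [atTime_top (X := fun t ω => Y t ω + Z t ω) (τ := fun _ => ⊤) rfl,
    limsup_add_of_tendsto (isBoundedUnder_le_atTop h') (isBoundedUnder_ge_atTop hY.nonneg _) h,
    ← atTime_top (X := Y) (τ := fun _ => ⊤) rfl]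
  ring

omit [IsFiniteMeasure μ] in
theorem measurable_of_ae_eq {𝒢 : MeasurableSpace Ω} (h𝒢 : ∀ N : Set Ω, μ N = 0 → MeasurableSet[𝒢] N)
    {f g : Ω → ℝ} (hf : Measurable[𝒢] f) (h : g =ᵐ[μ] f) : Measurable[𝒢] g := by
  intro B hB
  set N : Set Ω := {ω | ¬ g ω = f ω} with hN
  have hN0 : μ N = 0 := h
  have : g ⁻¹' B = (f ⁻¹' B \ N) ∪ (g ⁻¹' B ∩ N) := by
    ext ω
    by_cases hω : ω ∈ N
    · simp [hω]
    · have : g ω = f ω := not_not.1 hω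
      simp [hω, this]
  rw [this]
  exact ((hf hB).diff (h𝒢 N hN0)).union (h𝒢 _ (measure_mono_null Set.inter_subset_right hN0))

end ContinuationInTime

/-! ### Integration over the fibres of a map with countable range -/

section Fibres

variable {Ω β : Type*} {m : MeasurableSpace Ω} {μ : Measure Ω} {p : Ω → β}

theorem iUnion_inter_fibre (p : Ω → β) (A : Set Ω) :
    ⋃ x : Set.range p, A ∩ p ⁻¹' {(x : β)} = A := by
  ext ω
  simp

theorem pairwise_disjoint_inter_fibre (p : Ω → β) (A : Set Ω) :
    Pairwise (Function.onFun Disjoint fun x : Set.range p => A ∩ p ⁻¹' {(x : β)}) := by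
  intro x y hxy
  refine Set.disjoint_left.2 fun ω hx hy => hxy (Subtype.ext ?_)
  exact (Set.mem_singleton_iff.1 hx.2).symm.trans (Set.mem_singleton_iff.1 hy.2)

/-- The error may vary with the fibre as long as it is summable, so each continuation can be chosen
with its own tolerance. -/
theorem setIntegral_le_of_countable_range (hp : (Set.range p).Countable)
    (hpm : ∀ x, MeasurableSet (p ⁻¹' {x})) {f g : Ω → ℝ} (hf : Integrable f μ) (hg : Integrable g μ)
    {A : Set Ω} (hA : MeasurableSet A) {ε : Set.range p → ℝ} {c : ℝ} (hε : HasSum ε c)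
    (h : ∀ x : Set.range p,
      ∫ ω in A ∩ p ⁻¹' {(x : β)}, f ω ∂μ ≤ ∫ ω in A ∩ p ⁻¹' {(x : β)}, g ω ∂μ + ε x) :
    ∫ ω in A, f ω ∂μ ≤ ∫ ω in A, g ω ∂μ + c := by
  have := hp.to_subtype
  have key : ∀ {f : Ω → ℝ}, Integrable f μ →
      HasSum (fun x : Set.range p => ∫ ω in A ∩ p ⁻¹' {(x : β)}, f ω ∂μ) (∫ ω in A, f ω ∂μ) := by
    intro f hf
    have h1 := hasSum_integral_iUnion (μ := μ) (f := f)
      (fun x : Set.range p => hA.inter (hpm x)) (pairwise_disjoint_inter_fibre p A)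
      hf.integrableOn
    rwa [iUnion_inter_fibre] at h1
  exact hasSum_le h (key hf) ((key hg).add hε)

theorem lintegral_le_of_countable_range (hp : (Set.range p).Countable)
    (hpm : ∀ x, MeasurableSet (p ⁻¹' {x})) {f g : Ω → ℝ≥0∞}
    (h : ∀ x ∈ Set.range p, ∫⁻ ω in p ⁻¹' {x}, f ω ∂μ ≤ ∫⁻ ω in p ⁻¹' {x}, g ω ∂μ) :
    ∫⁻ ω, f ω ∂μ ≤ ∫⁻ ω, g ω ∂μ := by
  have := hp.to_subtype
  have key : ∀ f : Ω → ℝ≥0∞, ∫⁻ ω, f ω ∂μ =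
      ∑' x : Set.range p, ∫⁻ ω in Set.univ ∩ p ⁻¹' {(x : β)}, f ω ∂μ := by
    intro f
    rw [← lintegral_iUnion (fun x : Set.range p => MeasurableSet.univ.inter (hpm x))
      (pairwise_disjoint_inter_fibre p Set.univ), iUnion_inter_fibre, Measure.restrict_univ]
  rw [key f, key g]
  refine ENNReal.tsum_le_tsum fun x => ?_
  rw [Set.univ_inter]
  exact h x x.2

/-- Fatou's lemma: upper bounds on integrals survive almost sure limits with no dominating function,
and integrability comes with them. -/
theorem setIntegral_le_of_tendsto_of_nonneg {f : ℕ → Ω → ℝ} {g : Ω → ℝ}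
    (hf : ∀ j, Integrable (f j) μ) (hf0 : ∀ j, 0 ≤ᵐ[μ] f j)
    (hlim : ∀ᵐ ω ∂μ, Tendsto (fun j => f j ω) atTop (𝓝 (g ω))) {A : Set Ω} {c : ℝ}
    (hc : ∀ j, ∫ ω in A, f j ω ∂μ ≤ c) : IntegrableOn g A μ ∧ ∫ ω in A, g ω ∂μ ≤ c := by
  have hc0 : 0 ≤ c := (integral_nonneg_of_ae (ae_restrict_of_ae (hf0 0))).trans (hc 0)
  have hg0 : 0 ≤ᵐ[μ] g := by
    filter_upwards [hlim, ae_all_iff.2 hf0] with ω h1 h2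
    exact ge_of_tendsto' h1 h2
  have hgm : AEStronglyMeasurable g (μ.restrict A) :=
    (aestronglyMeasurable_of_tendsto_ae atTop (fun j => (hf j).aestronglyMeasurable) hlim).restrict
  have hle : ∫⁻ ω in A, ENNReal.ofReal (g ω) ∂μ ≤ ENNReal.ofReal c := by
    calc ∫⁻ ω in A, ENNReal.ofReal (g ω) ∂μ
        ≤ ∫⁻ ω in A, liminf (fun j => ENNReal.ofReal (f j ω)) atTop ∂μ := by
          refine lintegral_mono_ae (ae_restrict_of_ae ?_)
          filter_upwards [hlim] with ω hω
          exact ((ENNReal.continuous_ofReal.tendsto _).comp hω).liminf_eq.ge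
      _ ≤ liminf (fun j => ∫⁻ ω in A, ENNReal.ofReal (f j ω) ∂μ) atTop :=
          lintegral_liminf_le' fun j => (hf j).aemeasurable.restrict.ennreal_ofReal
      _ ≤ ENNReal.ofReal c := liminf_le_of_le (by isBoundedDefault) fun b hb => by
          obtain ⟨j, hj⟩ := hb.exists
          rw [← ofReal_integral_eq_lintegral_ofReal (hf j).integrableOn
            (ae_restrict_of_ae (hf0 j))] at hj
          exact hj.trans (ENNReal.ofReal_le_ofReal (hc j))
  have hgi : IntegrableOn g A μ := by
    refine ⟨hgm, ?_⟩
    rw [hasFiniteIntegral_iff_ofReal (ae_restrict_of_ae hg0)]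
    exact hle.trans_lt ENNReal.ofReal_lt_top
  refine ⟨hgi, ?_⟩
  rw [← ofReal_integral_eq_lintegral_ofReal hgi (ae_restrict_of_ae hg0)] at hle
  exact (ENNReal.ofReal_le_ofReal_iff hc0).1 hle

end Fibres

/-! ### Composition and decomposition of strategies -/

section Decomposition

variable {Ω : Type*} {m : MeasurableSpace Ω} {𝔉 : Filtration ℝ≥0 m}
  {δ : ℕ → Ω → WithTop ℝ≥0} {k : ℕ} {σ : Ω → WithTop ℝ≥0}

theorem isStoppingTime_top (𝔄 : Filtration ℝ≥0 m) : IsStoppingTime 𝔄 fun _ => ⊤ :=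
  (top_mem_strategies 𝔄 (fun _ _ => ⊤) 1 fun _ => ⊤).2.1 0 one_pos

theorem strategies.isStoppingTime_zero {τ : ℕ → Ω → WithTop ℝ≥0}
    (hτ : τ ∈ strategies 𝔉 δ (k + 1) σ) : IsStoppingTime 𝔉 (τ 0) :=
  hτ.2.1 0 k.succ_pos

open Classical in
/-- The remaining exercises of a strategy, on the event that the first exercise is at time `t`. -/
theorem tail_mem_laterStrategies (hδ : ∀ i, Measurable (δ i)) {τ : ℕ → Ω → WithTop ℝ≥0}
    (hτ : τ ∈ strategies 𝔉 δ (k + 1) σ) (t : ℝ≥0) :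
    (fun i ω => if τ 0 ω = t then τ (i + 1) ω else ⊤) ∈ laterStrategies 𝔉 δ k t := by
  have hτm : ∀ i < k + 1, Measurable (τ i) := fun i hi => measurable_of_mem_strategies hτ hi
  have h0 : MeasurableSet {ω | τ 0 ω = t} := hτm 0 k.succ_pos (measurableSet_singleton _)
  refine ⟨fun hk ω => ?_, fun i hi => ?_, fun i hi ω => ?_⟩
  · simp only
    split_ifs with h
    · have := hτ.2.2 0 (Nat.succ_lt_succ hk) ω
      rwa [h] at this
    · exact le_top
  -- The time t + δ_1 and the times adjoined by the truncated tail, as one sequence over 𝔉, so that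
  -- `adjoinSeq_succ'` applies.
  · set ρ' : ℕ → Ω → WithTop ℝ≥0 := fun j => Nat.casesOn j (delay t (δ 0))
      (fun j ω => (if τ 0 ω = t then τ (j + 1) ω else ⊤) + δ (j + 1) ω) with hρ'
    have hρ'm : ∀ j < i + 1, Measurable (ρ' j) := fun j hj => by
      cases j with
      | zero => exact measurable_add measurable_const (hδ 0)
      | succ j =>
        exact measurable_add
          (Measurable.ite h0 (hτm (j + 1) (hj.trans (Nat.succ_lt_succ hi))) measurable_const)
          (hδ (j + 1))
    suffices IsStoppingTime (adjoinSeq 𝔉 ρ' (i + 1))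
        (fun ω => if τ 0 ω = t then τ (i + 1) ω else ⊤) by
      rwa [adjoinSeq_succ'] at this
    -- Gluing at the constant time t with two labels: where τ 0 = t, the tail of τ; elsewhere ∞, a
    -- stopping time for every filtration.
    have hglue := isStoppingTime_adjoinSeq_glue (𝔄 := 𝔉) (isStoppingTime_const 𝔉 t)
      (p := fun ω => τ 0 ω = t)
      (ρ := fun q => if q then fun j ω => τ j ω + δ j ω else fun j => Nat.casesOn j (delay t (δ 0))
        (fun _ _ => ⊤)) (ρ' := ρ') (i := i + 1)
      (T := fun q => if q then τ (i + 1) else fun _ => ⊤) ?_ hρ'm ?_ ?_ ?_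
    · convert hglue using 2 with ω
      split_ifs <;> rfl
    · intro x
      rw [IsStoppingTime.measurableSpace_const]
      have h1 : MeasurableSet[𝔉 t] {ω | τ 0 ω = t} :=
        (strategies.isStoppingTime_zero hτ).measurableSet_eq t
      by_cases hx : x
      · convert h1 using 1
        ext ω
        simp [hx]
      · convert h1.compl using 1
        ext ω
        simp [hx]
    · intro j hj ω
      by_cases hω : τ 0 ω = t
      · cases j with
        | zero =>
          simp only [if_pos hω]
          exact congrArg (· + δ 0 ω) hω
        | succ j => simp only [hρ', if_pos hω]
      · cases j with
        | zero =>
          simp only [if_neg hω]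
          rfl
        | succ j => simp only [hρ', if_neg hω, WithTop.top_add]
    · intro x
      by_cases hx : x
      · simpa [hx] using hτ.2.1 (i + 1) (Nat.succ_lt_succ hi)
      · simpa [hx] using isStoppingTime_top _
    · intro ω
      by_cases hω : τ 0 ω = t
      · simp only [if_pos hω]
        exact hω ▸ zero_le_of_mem_strategies hτ (Nat.succ_lt_succ hi) ω
      · simp only [if_neg hω, le_top]
  · simp only
    split_ifs with h
    · exact hτ.2.2 (i + 1) (Nat.succ_lt_succ hi) ω
    · exact le_top

/-- A first exercise time with countable range, followed by strategies for the remaining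
exercises, is a strategy. -/
theorem cons_mem_strategiesDisc (hδ : ∀ i, Measurable (δ i)) {ρ : Ω → WithTop ℝ≥0}
    (hρ : IsStoppingTime 𝔉 ρ) (hρc : (Set.range ρ).Countable) (hσρ : σ ≤ ρ)
    {τ : WithTop ℝ≥0 → ℕ → Ω → WithTop ℝ≥0} (hτ : ∀ t : ℝ≥0, τ t ∈ laterStrategies 𝔉 δ k t)
    (hτ' : τ ⊤ = fun _ _ => ⊤) :
    (fun i ω => Nat.casesOn i (ρ ω) fun i => τ (ρ ω) i ω) ∈ strategiesDisc 𝔉 δ (k + 1) σ := by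
  have := hρc.to_subtype
  have hτm : ∀ x : WithTop ℝ≥0, ∀ i < k, Measurable (τ x i) := fun x i hi => by
    cases x with
    | top => rw [hτ']; exact measurable_const
    | coe t => exact measurable_of_mem_strategies (hτ t) hi
  set p : Ω → Set.range ρ := fun ω => ⟨ρ ω, ω, rfl⟩ with hp
  have hpm : ∀ x, MeasurableSet[hρ.measurableSpace] (p ⁻¹' {x}) := fun x => by
    have : p ⁻¹' {x} = ρ ⁻¹' {(x : WithTop ℝ≥0)} := by
      ext ω
      simp [hp, Subtype.ext_iff]
    rw [this]
    exact hρ.measurable (measurableSet_singleton _)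
  have hglm : ∀ i < k, Measurable fun ω => τ (ρ ω) i ω := fun i hi =>
    measurable_glue (p := p) (T := fun x => τ x i) (fun x => hρ.measurableSpace_le _ (hpm x))
      fun x => hτm x i hi
  refine ⟨⟨fun _ => hσρ, fun i hi => ?_, fun i hi ω => ?_⟩, hρc⟩
  · cases i with
    | zero => exact hρ
    | succ i =>
      have hi' : i < k := Nat.lt_of_succ_lt_succ hi
      -- The value of ρ is known at time ρ, so the gluing takes place at ρ with that value as label.
      refine isStoppingTime_adjoinSeq_glue hρ (p := p) hpm
        (ρ := fun x j ω => Nat.casesOn j ((x : WithTop ℝ≥0) + δ 0 ω)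
          fun j => τ x j ω + δ (j + 1) ω) (T := fun x => τ x i) (fun j hj => ?_)
        (fun j _ ω => ?_) (fun x => ?_) (fun ω => ?_)
      · cases j with
        | zero => exact measurable_add hρ.measurable' (hδ 0)
        | succ j =>
          exact measurable_add (hglm j ((Nat.lt_of_succ_lt_succ hj).trans hi')) (hδ (j + 1))
      · cases j <;> rfl
      · rw [adjoinSeq_succ']
        obtain ⟨x, hx⟩ := x
        cases x with
        | top => simp only [hτ']; exact isStoppingTime_top _
        | coe t => exact (hτ t).2.1 i hi'
      · change ρ ω ≤ τ (ρ ω) i ω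
        cases h : ρ ω with
        | top => rw [hτ']
        | coe t => exact le_of_mem_laterStrategies (hτ t) hi' ω
  · cases i with
    | zero =>
      change ρ ω + δ 0 ω ≤ τ (ρ ω) 0 ω
      cases h : ρ ω with
      | top => rw [hτ']; exact le_top
      | coe t => exact (hτ t).1 (Nat.lt_of_succ_lt_succ hi) ω
    | succ i =>
      change τ (ρ ω) i ω + δ (i + 1) ω ≤ τ (ρ ω) (i + 1) ω
      cases h : ρ ω with
      | top => rw [hτ']; exact le_top
      | coe t => exact (hτ t).2.2 i (Nat.lt_of_succ_lt_succ hi) ω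

theorem reward_succ {Y : ℝ≥0 → Ω → ℝ} (τ : ℕ → Ω → WithTop ℝ≥0) (ω : Ω) :
    reward Y (k + 1) τ ω = atTime Y (τ 0) ω + reward Y k (fun i => τ (i + 1)) ω := by
  rw [reward, Finset.sum_range_succ', add_comm]
  rfl

/-- Inductively all earlier τ_j + δ_j are stopping times of 𝔉, so adjoining them does not enlarge 𝔉.
-/
theorem isStoppingTime_of_mem_strategies (h𝔉 : 𝔉.IsRightContinuous)
    (hδ : ∀ i < k, IsStoppingTime 𝔉 (δ i)) {τ : ℕ → Ω → WithTop ℝ≥0}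
    (hτ : τ ∈ strategies 𝔉 δ (k + 1) σ) {i : ℕ} (hi : i < k + 1) : IsStoppingTime 𝔉 (τ i) := by
  induction i using Nat.strong_induction_on with
  | _ i ih =>
    have hle : adjoinSeq 𝔉 (fun j ω => τ j ω + δ j ω) i ≤ 𝔉 := adjoinSeq_le h𝔉 fun j hj =>
      isStoppingTime_add h𝔉 (ih j hj (hj.trans hi)) (hδ j (hj.trans_le (Nat.le_of_lt_succ hi)))
    exact fun t => hle t _ (hτ.2.1 i hi t)

/-- If the waiting times are stopping times, a strategy may be delayed to one whose first exercise
is at a dyadic time. -/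
theorem delay_mem_strategiesDisc (h𝔉 : 𝔉.IsRightContinuous)
    (hδ : ∀ i < k, IsStoppingTime 𝔉 (δ i)) {τ : ℕ → Ω → WithTop ℝ≥0}
    (hτ : τ ∈ strategies 𝔉 δ (k + 1) σ) (j : ℕ) :
    (fun i ω => Nat.casesOn i (approx j (τ 0) ω)
      fun i => τ (i + 1) ω + ((1 / 2 : ℝ≥0) ^ j : ℝ≥0)) ∈ strategiesDisc 𝔉 δ (k + 1) σ := by
  refine ⟨⟨fun h ω => (hτ.1 h ω).trans (le_approx j (τ 0) ω), fun i hi => ?_, fun i hi ω => ?_⟩,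
    countable_range_approx j (τ 0)⟩
  · have hst := isStoppingTime_of_mem_strategies h𝔉 hδ hτ hi
    refine fun t => le_adjoinSeq 𝔉 _ i t _ ?_
    cases i with
    | zero => exact isStoppingTime_approx hst j t
    | succ i => exact isStoppingTime_add_const hst _ t
  · cases i with
    | zero =>
      change approx j (τ 0) ω + δ 0 ω ≤ τ 1 ω + ((1 / 2 : ℝ≥0) ^ j : ℝ≥0)
      -- The first exercise moves by at most 2⁻ʲ, the delay given to all later ones, so the waiting
      -- time is respected.
      refine (add_le_add_left (approx_le j (τ 0) ω) _).trans ?_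
      rw [add_right_comm]
      exact add_le_add_left (hτ.2.2 0 hi ω) _
    | succ i =>
      change τ (i + 1) ω + _ + δ (i + 1) ω ≤ τ (i + 2) ω + _
      rw [add_right_comm]
      exact add_le_add_left (hτ.2.2 (i + 1) hi ω) _

end Decomposition

/-! ### The reduction to an ordinary stopping problem -/

section Reduction

variable {Ω : Type*} {m : MeasurableSpace Ω} {μ : Measure Ω} [IsFiniteMeasure μ] {Y Z : ℝ≥0 → Ω → ℝ}
  {𝔉 : Filtration ℝ≥0 m} {δ : ℕ → Ω → WithTop ℝ≥0} {k : ℕ} {σ : Ω → WithTop ℝ≥0}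

/-- The sum `Y + Z` of the immediate reward `Y` and the continuation value `Z`. -/
abbrev totalReward {Ω : Type*} (Y Z : ℝ≥0 → Ω → ℝ) : ℝ≥0 → Ω → ℝ := fun t ω => Y t ω + Z t ω

theorem IsRightContinuousModification.ae_nonneg (hY : IsReward μ Y) (hδ : ∀ i, Measurable (δ i))
    (hZ : IsRightContinuousModification μ (continuation μ Y 𝔉 δ (hδ 0) k) Z) :
    ∀ᵐ ω ∂μ, ∀ t, 0 ≤ Z t ω := by
  have h : ∀ᵐ ω ∂μ, ∀ q ∈ dyadics, 0 ≤ Z q ω := by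
    refine (ae_ball_iff countable_dyadics).2 fun q _ => ?_
    filter_upwards [hZ.2 q, continuation_nonneg hY hδ q] with ω h1 h2
    rw [h1]
    exact h2
  filter_upwards [h] with ω hω t
  exact ge_of_forall_dyadic_ge (hZ.1 ω t) fun q hq _ => hω q hq

theorem rightContinuousPaths_totalReward (hY : RightContinuousPaths Y)
    (hZ : RightContinuousPaths Z) : RightContinuousPaths (totalReward Y Z) :=
  fun ω t => (hY ω t).add (hZ ω t)

omit [IsFiniteMeasure μ] in
theorem stronglyAdapted_totalReward (hcomplete : ∀ N : Set Ω, μ N = 0 → MeasurableSet[𝔉 0] N)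
    (hYa : StronglyAdapted 𝔉 Y) {hδ : Measurable (δ 0)}
    (hZ : IsRightContinuousModification μ (continuation μ Y 𝔉 δ hδ k) Z) :
    StronglyAdapted 𝔉 (totalReward Y Z) := fun t =>
  (hYa t).add (measurable_of_ae_eq (fun N hN => 𝔉.mono zero_le _ (hcomplete N hN))
    stronglyMeasurable_condExp.measurable (hZ.2 t)).stronglyMeasurable

theorem ae_atTime_totalReward_nonneg (hY : IsReward μ Y) (hYa : StronglyAdapted 𝔉 Y)
    (hδ : ∀ i, Measurable (δ i))
    (hZ : IsRightContinuousModification μ (continuation μ Y 𝔉 δ (hδ 0) k) Z)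
    (τ : Ω → WithTop ℝ≥0) : 0 ≤ᵐ[μ] atTime (totalReward Y Z) τ := by
  filter_upwards [hZ.ae_nonneg hY hδ, ae_atTime_top_add hY hYa hδ hZ, hY.ae_ne_top]
    with ω h1 h2 h3
  cases h : τ ω with
  | coe t =>
    rw [atTime_coe h]
    exact add_nonneg (hY.nonneg t ω) (h1 t)
  | top =>
    rw [atTime_congr (τ' := fun _ => ⊤) h, h2]
    exact mul_nonneg (by positivity) (atTime_nonneg hY.nonneg h3 _)

omit [IsFiniteMeasure μ] in
theorem IsReward.integrable (hY : IsReward μ Y) (t : ℝ≥0) : Integrable (Y t) μ :=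
  hY.integrable_atTime (measurable_const (a := (t : WithTop ℝ≥0)))

omit [IsFiniteMeasure μ] in
theorem integrable_totalReward (hY : IsReward μ Y) {hδ : Measurable (δ 0)}
    (hZ : IsRightContinuousModification μ (continuation μ Y 𝔉 δ hδ k) Z) (t : ℝ≥0) :
    Integrable (totalReward Y Z t) μ := by
  exact (hY.integrable t).add ((integrable_continuation hδ t).congr (hZ.2 t).symm)

omit [IsFiniteMeasure μ] in
theorem setIntegral_totalReward (hY : IsReward μ Y) {hδ : Measurable (δ 0)}
    (hZ : IsRightContinuousModification μ (continuation μ Y 𝔉 δ hδ k) Z) (t : ℝ≥0) (A : Set Ω) :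
    ∫ ω in A, totalReward Y Z t ω ∂μ =
      ∫ ω in A, Y t ω ∂μ + ∫ ω in A, continuation μ Y 𝔉 δ hδ k t ω ∂μ := by
  rw [← integral_add (hY.integrable t).integrableOn (integrable_continuation hδ t).integrableOn]
  refine integral_congr_ae (ae_restrict_of_ae ?_)
  filter_upwards [hZ.2 t] with ω hω
  simp [totalReward, hω]

/-- On {τ = t}, an event of ℱ_t, the continuation value integrates to at most k times the supremum
of Y. The bound is independent of τ, so it survives dyadic approximation of general stopping times.
-/
theorem lintegral_atTime_totalReward_le (hY : IsReward μ Y) (hYa : StronglyAdapted 𝔉 Y)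
    (hδ : ∀ i, Measurable (δ i))
    (hZ : IsRightContinuousModification μ (continuation μ Y 𝔉 δ (hδ 0) k) Z)
    {τ : Ω → WithTop ℝ≥0} (hτ : IsStoppingTime 𝔉 τ) (hτc : (Set.range τ).Countable) :
    ∫⁻ ω, ENNReal.ofReal (atTime (totalReward Y Z) τ ω) ∂μ ≤
      ∫⁻ ω, ENNReal.ofReal ((k + 1) * (supFrom Y 0 ω).toReal) ∂μ := by
  have hm : ∀ x, MeasurableSet (τ ⁻¹' {x}) := fun x => hτ.measurable' (measurableSet_singleton x)
  refine lintegral_le_of_countable_range hτc hm fun x _ => ?_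
  cases x with
  | top =>
    refine lintegral_mono_ae ((ae_restrict_iff' (hm ⊤)).2 ?_)
    filter_upwards [ae_atTime_top_add hY hYa hδ hZ, hY.ae_ne_top] with ω h1 h2 h3
    rw [atTime_congr (τ' := fun _ => ⊤) h3, h1]
    exact ENNReal.ofReal_le_ofReal (mul_le_mul_of_nonneg_left
      (atTime_le hY.nonneg h2 zero_le) (by positivity))
  | coe t =>
    have hS := (hY.integrable_supFrom 0).const_mul (k + 1 : ℝ)
    have hX := integrable_totalReward hY hZ t
    have h0 : 0 ≤ᵐ[μ] totalReward Y Z t := by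
      filter_upwards [hZ.ae_nonneg hY hδ] with ω h
      exact add_nonneg (hY.nonneg t ω) (h t)
    rw [setLIntegral_congr_fun (hm t) (g := fun ω => ENNReal.ofReal (totalReward Y Z t ω))
      fun ω hω => by rw [atTime_coe hω],
      ← ofReal_integral_eq_lintegral_ofReal hX.integrableOn (ae_restrict_of_ae h0),
      ← ofReal_integral_eq_lintegral_ofReal hS.integrableOn
        (Eventually.of_forall fun ω => mul_nonneg (by positivity) ENNReal.toReal_nonneg)]
    refine ENNReal.ofReal_le_ofReal ?_
    rw [setIntegral_totalReward hY hZ]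
    have h1 := setIntegral_continuation_le (𝔉 := 𝔉) (k := k) hY hδ (zero_le (a := t))
      (hτ.measurableSet_eq t)
    have h2 : ∫ ω in τ ⁻¹' {(t : WithTop ℝ≥0)}, Y t ω ∂μ ≤
        ∫ ω in τ ⁻¹' {(t : WithTop ℝ≥0)}, (supFrom Y 0 ω).toReal ∂μ := by
      refine integral_mono_of_nonneg (Eventually.of_forall fun ω => hY.nonneg t ω)
        (hY.integrable_supFrom 0).integrableOn (ae_restrict_of_ae ?_)
      filter_upwards [hY.ae_ne_top] with ω hω
      exact le_toReal_supFrom hω zero_le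
    rw [integral_const_mul] at h1 ⊢
    rw [add_mul, one_mul, add_comm]
    exact add_le_add h1 h2

theorem integrable_atTime_totalReward (hY : IsReward μ Y) (hYa : StronglyAdapted 𝔉 Y)
    (hδ : ∀ i, Measurable (δ i))
    (hZ : IsRightContinuousModification μ (continuation μ Y 𝔉 δ (hδ 0) k) Z)
    {τ : Ω → WithTop ℝ≥0} (hτ : IsStoppingTime 𝔉 τ) :
    Integrable (atTime (totalReward Y Z) τ) μ := by
  have hXr := rightContinuousPaths_totalReward hY.rightCont hZ.1
  have hS := (hY.integrable_supFrom 0).const_mul (k + 1 : ℝ)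
  have hS0 : 0 ≤ᵐ[μ] fun ω => (k + 1 : ℝ) * (supFrom Y 0 ω).toReal :=
    Eventually.of_forall fun ω => mul_nonneg (by positivity) ENNReal.toReal_nonneg
  have hnn := ae_atTime_totalReward_nonneg hY hYa hδ hZ
  have hle := fun j => lintegral_atTime_totalReward_le hY hYa hδ hZ (isStoppingTime_approx hτ j)
    (countable_range_approx j τ)
  have htop : AEMeasurable (atTime (totalReward Y Z) fun _ => ⊤) μ :=
    (hY.aemeasurable_atTime_top.const_mul (k + 1 : ℝ)).congr
      ((ae_atTime_top_add hY hYa hδ hZ).mono fun _ h => h.symm)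
  have hi : ∀ j, Integrable (atTime (totalReward Y Z) (approx j τ)) μ := fun j => by
    refine ⟨(aemeasurable_atTime hXr (fun t => (integrable_totalReward hY hZ t).aemeasurable) htop
      (isStoppingTime_approx hτ j).measurable').aestronglyMeasurable, ?_⟩
    rw [hasFiniteIntegral_iff_ofReal (hnn _)]
    refine (hle j).trans_lt ?_
    rw [← hasFiniteIntegral_iff_ofReal hS0]
    exact hS.2
  refine integrableOn_univ.1 (setIntegral_le_of_tendsto_of_nonneg hi (fun j => hnn _)
    (Eventually.of_forall fun ω => tendsto_atTime_approx hXr)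
    (c := ∫ ω, (k + 1) * (supFrom Y 0 ω).toReal ∂μ) fun j => ?_).1
  rw [setIntegral_univ, integral_eq_lintegral_of_nonneg_ae (hnn _) (hi j).aestronglyMeasurable,
    integral_eq_lintegral_of_nonneg_ae hS0 hS.aestronglyMeasurable]
  refine ENNReal.toReal_mono ?_ (hle j)
  exact ((hasFiniteIntegral_iff_ofReal hS0).1 hS.2).ne

end Reduction

/-! ### Comparison of essential suprema -/

section EssSup

variable {Ω : Type*} {m : MeasurableSpace Ω} {μ : Measure Ω} {S S' : Set (Ω → ℝ)} {X X' : Ω → ℝ}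

theorem IsEssSup.congr (h : IsEssSup μ S X) (hX' : Measurable X') (hXX' : X =ᵐ[μ] X') :
    IsEssSup μ S X' :=
  ⟨hX', fun f hf => (h.upper f hf).trans_eq hXX', fun g hg hg' =>
    hXX'.symm.trans_le (h.least g hg hg')⟩

theorem IsEssSup.of_le (h : IsEssSup μ S X) (h1 : ∀ f ∈ S', f ≤ᵐ[μ] X)
    (h2 : ∀ f ∈ S, ∃ f' ∈ S', f ≤ᵐ[μ] f') : IsEssSup μ S' X :=
  ⟨h.measurable, h1, fun g hg hg' => h.least g hg fun f hf =>
    let ⟨f', hf', hff'⟩ := h2 f hf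
    hff'.trans (hg' f' hf')⟩

/-- The essential supremum of a family of `m'`-measurable functions is `m'`-measurable, up to null
sets. -/
theorem IsEssSup.condExp_ae_eq [IsFiniteMeasure μ] (h : IsEssSup μ S X) (hX : Integrable X μ)
    {m' : MeasurableSpace Ω} (hm : m' ≤ m)
    (hS : ∀ f ∈ S, StronglyMeasurable[m'] f ∧ Integrable f μ) : μ[X | m'] =ᵐ[μ] X := by
  have hle : X ≤ᵐ[μ] μ[X | m'] := by
    refine h.least _ (stronglyMeasurable_condExp.mono hm).measurable fun f hf => ?_
    have := condExp_mono (m := m') (hS f hf).2 hX (h.upper f hf)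
    rwa [condExp_of_stronglyMeasurable hm (hS f hf).1 (hS f hf).2] at this
  exact ((integral_eq_iff_of_ae_le hX integrable_condExp hle).1 (integral_condExp hm).symm).symm

theorem condExp_le_of_forall_setIntegral_le [IsFiniteMeasure μ] {m' : MeasurableSpace Ω}
    (hm : m' ≤ m) {f g : Ω → ℝ} (hf : Integrable f μ) (hg : Integrable g μ)
    (h : ∀ A, MeasurableSet[m'] A → ∫ ω in A, f ω ∂μ ≤ ∫ ω in A, g ω ∂μ) :
    μ[f | m'] ≤ᵐ[μ] μ[g | m'] := by
  refine ae_le_of_forall_setIntegral_le_of_stronglyMeasurable hm stronglyMeasurable_condExp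
    stronglyMeasurable_condExp integrable_condExp integrable_condExp fun A hA => ?_
  rw [setIntegral_condExp hm hf hA, setIntegral_condExp hm hg hA]
  exact h A hA

end EssSup

/-! ### Equality of the multiple and the ordinary stopping values -/

section Reduction

variable {Ω : Type*} {m : MeasurableSpace Ω} {μ : Measure Ω} [IsFiniteMeasure μ] {Y Z : ℝ≥0 → Ω → ℝ}
  {𝔉 : Filtration ℝ≥0 m} {δ : ℕ → Ω → WithTop ℝ≥0} {k : ℕ} {σ : Ω → WithTop ℝ≥0}

omit [IsFiniteMeasure μ] in
theorem setIntegral_fibre_totalReward (hY : IsReward μ Y) {hδ : Measurable (δ 0)}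
    (hZ : IsRightContinuousModification μ (continuation μ Y 𝔉 δ hδ k) Z) {ρ : Ω → WithTop ℝ≥0}
    {t : ℝ≥0} {B : Set Ω} (hB : MeasurableSet B) (hρ : ∀ ω ∈ B, ρ ω = t) :
    ∫ ω in B, atTime (totalReward Y Z) ρ ω ∂μ =
      ∫ ω in B, Y t ω ∂μ + ∫ ω in B, continuation μ Y 𝔉 δ hδ k t ω ∂μ := by
  rw [← setIntegral_totalReward hY hZ]
  exact setIntegral_congr_fun hB fun ω hω => atTime_coe (hρ ω hω)

omit [IsFiniteMeasure μ] in
theorem setIntegral_reward_succ (hY : IsReward μ Y) {τ τ' : ℕ → Ω → WithTop ℝ≥0} {t : ℝ≥0}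
    {B : Set Ω} (hB : MeasurableSet B) (hτ'm : ∀ i < k, Measurable (τ' i))
    (hτ : ∀ ω ∈ B, τ 0 ω = t) (hτ' : ∀ ω ∈ B, ∀ i < k, τ (i + 1) ω = τ' i ω) :
    ∫ ω in B, reward Y (k + 1) τ ω ∂μ = ∫ ω in B, Y t ω ∂μ + ∫ ω in B, reward Y k τ' ω ∂μ := by
  rw [← integral_add (hY.integrable t).integrableOn (hY.integrable_reward hτ'm).integrableOn]
  refine setIntegral_congr_fun hB fun ω hω => ?_
  rw [reward_succ, atTime_coe (hτ ω hω)]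
  exact congrArg _ (reward_congr (hτ' ω hω))

theorem setIntegral_reward_top (hY : IsReward μ Y) (hYa : StronglyAdapted 𝔉 Y)
    (hδ : ∀ i, Measurable (δ i))
    (hZ : IsRightContinuousModification μ (continuation μ Y 𝔉 δ (hδ 0) k) Z)
    {τ : ℕ → Ω → WithTop ℝ≥0} {B : Set Ω} (hB : MeasurableSet B)
    (hτ : ∀ ω ∈ B, ∀ i < k + 1, τ i ω = ⊤) :
    ∫ ω in B, reward Y (k + 1) τ ω ∂μ = ∫ ω in B, atTime (totalReward Y Z) (τ 0) ω ∂μ := by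
  refine setIntegral_congr_ae hB ?_
  filter_upwards [ae_atTime_top_add hY hYa hδ hZ] with ω h hω
  rw [reward_congr (τ' := fun _ _ => ⊤) (hτ ω hω), reward_top,
    atTime_congr (τ' := fun _ => ⊤) (hτ ω hω 0 k.succ_pos), h]
  push_cast
  rfl

theorem measurableSet_inter_fibre {ρ : Ω → WithTop ℝ≥0} (hσ : IsStoppingTime 𝔉 σ)
    (hρ : IsStoppingTime 𝔉 ρ) (hσρ : σ ≤ ρ) {A : Set Ω} (hA : MeasurableSet[hσ.measurableSpace] A)
    (t : ℝ≥0) : MeasurableSet[𝔉 t] (A ∩ ρ ⁻¹' {(t : WithTop ℝ≥0)}) :=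
  (hρ.measurableSet_inter_eq_iff A t).1
    ((hσ.measurableSpace_mono hρ hσρ _ hA).inter (hρ.measurableSet_eq' t))

/-- On {τ 0 = t} the tail competes in the supremum defining the continuation value at t. On {τ 0 =
∞} every exercise is at ∞, and both sides agree by the value of Y_n(∞). -/
theorem setIntegral_reward_le_totalReward (hY : IsReward μ Y) (hYa : StronglyAdapted 𝔉 Y)
    (hδ : ∀ i, Measurable (δ i))
    (hZ : IsRightContinuousModification μ (continuation μ Y 𝔉 δ (hδ 0) k) Z)
    (hσ : IsStoppingTime 𝔉 σ) {τ : ℕ → Ω → WithTop ℝ≥0} (hτ : τ ∈ strategiesDisc 𝔉 δ (k + 1) σ)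
    {A : Set Ω} (hA : MeasurableSet[hσ.measurableSpace] A) :
    ∫ ω in A, reward Y (k + 1) τ ω ∂μ ≤ ∫ ω in A, atTime (totalReward Y Z) (τ 0) ω ∂μ := by
  have h0 := strategies.isStoppingTime_zero hτ.1
  have hm : ∀ x, MeasurableSet (τ 0 ⁻¹' {x}) := fun x => h0.measurable' (measurableSet_singleton x)
  have hAm := hσ.measurableSpace_le _ hA
  rw [← add_zero (∫ ω in A, atTime (totalReward Y Z) (τ 0) ω ∂μ)]
  refine setIntegral_le_of_countable_range hτ.2 hm
    (hY.integrable_reward fun _ hi => measurable_of_mem_strategies hτ.1 hi)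
    (integrable_atTime_totalReward hY hYa hδ hZ h0) hAm (ε := 0) hasSum_zero ?_
  rintro ⟨x, -⟩
  have hB := hAm.inter (hm x)
  simp only [Pi.zero_apply, add_zero]
  cases x with
  | top =>
    refine (setIntegral_reward_top hY hYa hδ hZ hB fun ω hω i hi => top_le_iff.1 ?_).le
    exact (Eq.ge hω.2).trans (zero_le_of_mem_strategies hτ.1 hi ω)
  | coe t =>
    have hl := tail_mem_laterStrategies hδ hτ.1 t
    rw [setIntegral_fibre_totalReward hY hZ hB fun ω hω => hω.2,
      setIntegral_reward_succ hY hB (fun _ hi => measurable_of_mem_strategies hl hi)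
        (fun ω hω => hω.2) fun ω hω i _ => (if_pos hω.2).symm]
    exact add_le_add_right (setIntegral_reward_le_continuation hY hδ hl
      (measurableSet_inter_fibre hσ h0 (hτ.1.1 k.succ_pos) hA t)) _

/-- For each value t of ρ, a continuation whose deficit is at most a share of ε is used on {ρ = t}.
The shares sum to less than ε, and the glued strategy does not depend on A. -/
theorem exists_setIntegral_totalReward_le (hY : IsReward μ Y) (hYa : StronglyAdapted 𝔉 Y)
    (hδ : ∀ i, Measurable (δ i))
    (hZ : IsRightContinuousModification μ (continuation μ Y 𝔉 δ (hδ 0) k) Z)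
    (hσ : IsStoppingTime 𝔉 σ) {ρ : Ω → WithTop ℝ≥0} (hρ : IsStoppingTime 𝔉 ρ)
    (hρc : (Set.range ρ).Countable) (hσρ : σ ≤ ρ) {ε : ℝ≥0} (hε : ε ≠ 0) :
    ∃ τ ∈ strategiesDisc 𝔉 δ (k + 1) σ, ∀ A, MeasurableSet[hσ.measurableSpace] A →
      ∫ ω in A, atTime (totalReward Y Z) ρ ω ∂μ ≤ ∫ ω in A, reward Y (k + 1) τ ω ∂μ + ε := by
  classical
  have := hρc.to_subtype
  obtain ⟨e, he, c, hc, hcε⟩ := NNReal.exists_pos_sum_of_countable hε (Set.range ρ)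
  -- The value 1 off the range of ρ is a dummy that keeps the tolerance positive for every t.
  set e' : WithTop ℝ≥0 → ℝ := fun x => if h : x ∈ Set.range ρ then e ⟨x, h⟩ else 1 with he'
  have hpos : ∀ x, 0 < e' x := fun x => by
    simp only [he']
    split_ifs with h
    · exact he _
    · exact one_pos
  choose T hT hT' using fun t : ℝ≥0 =>
    exists_setIntegral_continuation_le (𝔉 := 𝔉) (k := k) hY hδ t (hpos t)
  set U : WithTop ℝ≥0 → ℕ → Ω → WithTop ℝ≥0 := WithTop.recTopCoe (fun _ _ => ⊤) T with hU
  obtain ⟨V, hV0, hV, hmem⟩ : ∃ V : ℕ → Ω → WithTop ℝ≥0, V 0 = ρ ∧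
      (∀ i ω, V (i + 1) ω = U (ρ ω) i ω) ∧ V ∈ strategiesDisc 𝔉 δ (k + 1) σ :=
    ⟨_, rfl, fun _ _ => rfl, cons_mem_strategiesDisc hδ hρ hρc hσρ (τ := U) hT rfl⟩
  refine ⟨V, hmem, fun A hA => ?_⟩
  have hm : ∀ x, MeasurableSet (ρ ⁻¹' {x}) := fun x => hρ.measurable' (measurableSet_singleton x)
  have hAm := hσ.measurableSpace_le _ hA
  refine (setIntegral_le_of_countable_range hρc hm
    (integrable_atTime_totalReward hY hYa hδ hZ hρ)
    (hY.integrable_reward fun _ hi => measurable_of_mem_strategies hmem.1 hi) hAm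
    (NNReal.hasSum_coe.2 hc) ?_).trans (add_le_add_right (NNReal.coe_le_coe.2 hcε.le) _)
  rintro ⟨x, hx⟩
  have hB := hAm.inter (hm x)
  have hex : e' x = e ⟨x, hx⟩ := dif_pos hx
  rw [← hex]
  cases x with
  | top =>
    refine le_add_of_le_of_nonneg (Eq.le ?_) (hpos _).le
    have key := setIntegral_reward_top (τ := V) hY hYa hδ hZ hB fun ω hω i hi => by
      have h : ρ ω = ⊤ := hω.2
      cases i with
      | zero => rw [hV0, h]
      | succ i =>
        rw [hV, h]
        rfl
    rw [hV0] at key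
    exact key.symm
  | coe t =>
    rw [setIntegral_fibre_totalReward hY hZ hB fun ω hω => hω.2,
      setIntegral_reward_succ (τ := V) (τ' := T t) (t := t) hY hB
        (fun _ hi => measurable_of_mem_strategies (hT t) hi)
        (fun ω hω => hV0 ▸ hω.2) (fun ω hω i _ => ?_), add_assoc]
    · exact add_le_add_right (hT' t _ (measurableSet_inter_fibre hσ hρ hσρ hA t)) _
    · have h : ρ ω = t := hω.2
      rw [hV, h]
      rfl

/-- Dyadic times approaching ρ from the right have countable range, so the gluing applies to them;
right-continuity of Y_n and Fatou carry the bound to ρ. -/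
theorem setIntegral_totalReward_le_valueDisc (hY : IsReward μ Y) (hYa : StronglyAdapted 𝔉 Y)
    (hδ : ∀ i, Measurable (δ i))
    (hZ : IsRightContinuousModification μ (continuation μ Y 𝔉 δ (hδ 0) k) Z)
    (hσ : IsStoppingTime 𝔉 σ) {ρ : Ω → WithTop ℝ≥0} (hρ : IsStoppingTime 𝔉 ρ) (hσρ : σ ≤ ρ)
    {A : Set Ω} (hA : MeasurableSet[hσ.measurableSpace] A) :
    ∫ ω in A, atTime (totalReward Y Z) ρ ω ∂μ ≤ ∫ ω in A, valueDisc μ Y δ (k + 1) hσ ω ∂μ := by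
  have hXr := rightContinuousPaths_totalReward hY.rightCont hZ.1
  refine (setIntegral_le_of_tendsto_of_nonneg
    (fun j => integrable_atTime_totalReward hY hYa hδ hZ (isStoppingTime_approx hρ j))
    (fun j => ae_atTime_totalReward_nonneg hY hYa hδ hZ _)
    (Eventually.of_forall fun ω => tendsto_atTime_approx hXr) fun j => ?_).2
  refine le_of_forall_pos_le_add fun ε hε => ?_
  lift ε to ℝ≥0 using hε.le
  obtain ⟨τ, hτ, h⟩ := exists_setIntegral_totalReward_le hY hYa hδ hZ hσ
    (isStoppingTime_approx hρ j) (countable_range_approx j ρ)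
    (hσρ.trans fun ω => le_approx j ρ ω) (NNReal.coe_pos.1 hε).ne'
  refine (h A hA).trans (add_le_add_left ?_ _)
  exact (isEssSup_valueDisc hY hδ hσ).setIntegral_reward_le hY (integrable_valueDisc hY hδ hσ) hτ
    (fun _ hi => measurable_of_mem_strategies hτ.1 hi) hA

theorem condExp_valueDisc (hY : IsReward μ Y) (hδ : ∀ i, Measurable (δ i))
    (hσ : IsStoppingTime 𝔉 σ) :
    μ[valueDisc μ Y δ k hσ | hσ.measurableSpace] =ᵐ[μ] valueDisc μ Y δ k hσ := by
  refine (isEssSup_valueDisc hY hδ hσ).condExp_ae_eq (integrable_valueDisc hY hδ hσ)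
    hσ.measurableSpace_le ?_
  rintro _ ⟨τ, -, rfl⟩
  exact ⟨stronglyMeasurable_condExp, integrable_condExp⟩

/-- The discrete value bounds every ordinary reward, and each strategy's reward lies below the
ordinary reward of stopping at its first exercise time. -/
theorem isEssSup_stoppingRewards (hY : IsReward μ Y) (hYa : StronglyAdapted 𝔉 Y)
    (hδ : ∀ i, Measurable (δ i))
    (hZ : IsRightContinuousModification μ (continuation μ Y 𝔉 δ (hδ 0) k) Z)
    (hσ : IsStoppingTime 𝔉 σ) :
    IsEssSup μ (stoppingRewards μ (totalReward Y Z) hσ) (valueDisc μ Y δ (k + 1) hσ) := by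
  refine (isEssSup_valueDisc hY hδ hσ).of_le ?_ ?_
  · rintro _ ⟨ρ, hρ, hσρ, rfl⟩
    exact (condExp_le_of_forall_setIntegral_le hσ.measurableSpace_le
      (integrable_atTime_totalReward hY hYa hδ hZ hρ) (integrable_valueDisc hY hδ hσ)
      fun A hA => setIntegral_totalReward_le_valueDisc hY hYa hδ hZ hσ hρ hσρ hA).trans_eq
      (condExp_valueDisc hY hδ hσ)
  · rintro _ ⟨τ, hτ, rfl⟩
    have h0 := strategies.isStoppingTime_zero hτ.1
    exact ⟨_, ⟨τ 0, h0, hτ.1.1 k.succ_pos, rfl⟩,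
      condExp_le_of_forall_setIntegral_le hσ.measurableSpace_le
      (hY.integrable_reward fun _ hi => measurable_of_mem_strategies hτ.1 hi)
      (integrable_atTime_totalReward hY hYa hδ hZ h0)
      fun A hA => setIntegral_reward_le_totalReward hY hYa hδ hZ hσ hτ hA⟩

/-- Delaying turns any strategy into ones with a dyadic first time, whose rewards converge by
right-continuity of Y. The waiting times must be stopping times, since otherwise moving the first
exercise could change the information available to the later ones. -/
theorem valueDisc_ae_eq_value (h𝔉 : 𝔉.IsRightContinuous) (hY : IsReward μ Y)
    (hδ : ∀ i, Measurable (δ i)) (hδ' : ∀ i < k, IsStoppingTime 𝔉 (δ i))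
    (hσ : IsStoppingTime 𝔉 σ) :
    valueDisc μ Y δ (k + 1) hσ =ᵐ[μ] value μ Y δ (k + 1) hσ := by
  refine IsEssSup.ae_eq ((isEssSup_valueDisc hY hδ hσ).of_le ?_ ?_) (isEssSup_value hY hδ hσ)
  · rintro _ ⟨τ, hτ, rfl⟩
    refine (condExp_le_of_forall_setIntegral_le hσ.measurableSpace_le
      (hY.integrable_reward fun _ hi => measurable_of_mem_strategies hτ hi)
      (integrable_valueDisc hY hδ hσ) fun A hA => ?_).trans_eq (condExp_valueDisc hY hδ hσ)
    have hmem := delay_mem_strategiesDisc h𝔉 hδ' hτ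
    refine (setIntegral_le_of_tendsto_of_nonneg
      (fun j => hY.integrable_reward fun _ hi => measurable_of_mem_strategies (hmem j).1 hi)
      (fun j => hY.ae_ne_top.mono fun _ h => reward_nonneg hY.nonneg h)
      (Eventually.of_forall fun ω => tendsto_finsetSum _ fun i _ => ?_) fun j =>
        (isEssSup_valueDisc hY hδ hσ).setIntegral_reward_le hY (integrable_valueDisc hY hδ hσ)
          (hmem j) (fun _ hi => measurable_of_mem_strategies (hmem j).1 hi) hA).2
    cases i with
    | zero => exact tendsto_atTime_approx hY.rightCont
    | succ i =>
      exact tendsto_atTime hY.rightCont tendsto_half_pow (fun _ => le_self_add) fun _ => le_rfl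
  · rintro f ⟨τ, hτ, rfl⟩
    exact ⟨_, ⟨τ, hτ.1, rfl⟩, EventuallyLE.rfl⟩

end Reduction

end MultipleStopping

theorem mainTheorem1 {Ω : Type*} {m : MeasurableSpace Ω} (μ : Measure Ω) [IsProbabilityMeasure μ]
    (𝔉 : Filtration ℝ≥0 m) (hF_rightCont : 𝔉.IsRightContinuous)
    (hF_complete : ∀ N : Set Ω, μ N = 0 → MeasurableSet[𝔉 0] N)
    (Y : ℝ≥0 → Ω → ℝ) (hY_adapted : StronglyAdapted 𝔉 Y) (hY_nonneg : ∀ t ω, 0 ≤ Y t ω)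
    (hY_rightCont : RightContinuousPaths Y)
    (hY_sup : ∫⁻ ω, ⨆ t, ENNReal.ofReal (Y t ω) ∂μ < ∞)
    (n : ℕ) (hn : 1 ≤ n)
    (δ : ℕ → Ω → WithTop ℝ≥0) (hδ : ∀ i, Measurable (δ i))
    (hδ_finite : ∀ i, i + 1 < n → ∀ᵐ ω ∂μ, δ i ω ≠ ⊤) :
    -- the process whose modification is taken is well defined
    (∀ t, IsEssSup μ
        (rewards μ Y (isStoppingTime_delay 𝔉 (hδ 0) t) (n - 1)
          (strategies (adjoin 𝔉 (delay t (δ 0))) (shift δ) (n - 1) (delay t (δ 0))))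
        (remainingValue μ Y 𝔉 δ (hδ 0) (n - 1) t) ∧
      Integrable (remainingValue μ Y 𝔉 δ (hδ 0) (n - 1) t) μ) ∧
    -- it has a right-continuous modification
    (∃ Zr, IsRightContinuousModification μ (continuation μ Y 𝔉 δ (hδ 0) (n - 1)) Zr) ∧
    -- and every such modification reduces the multiple stopping problem to an ordinary one
    ∀ Zr, IsRightContinuousModification μ (continuation μ Y 𝔉 δ (hδ 0) (n - 1)) Zr →
      StronglyAdapted 𝔉 (fun t ω => Y t ω + Zr t ω) ∧
      RightContinuousPaths (fun t ω => Y t ω + Zr t ω) ∧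
      (∀ τ, IsStoppingTime 𝔉 τ → Integrable (atTime (fun t ω => Y t ω + Zr t ω) τ) μ) ∧
      (∀ (σ : Ω → WithTop ℝ≥0) (hσ : IsStoppingTime 𝔉 σ),
        IsEssSup μ (rewards μ Y hσ n (strategiesDisc 𝔉 δ n σ)) (valueDisc μ Y δ n hσ) ∧
        IsEssSup μ (stoppingRewards μ (fun t ω => Y t ω + Zr t ω) hσ) (valueDisc μ Y δ n hσ)) ∧
      ((∀ i, i + 1 < n → IsStoppingTime 𝔉 (δ i)) →
        ∀ (σ : Ω → WithTop ℝ≥0) (hσ : IsStoppingTime 𝔉 σ),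
          IsEssSup μ (rewards μ Y hσ n (strategies 𝔉 δ n σ)) (value μ Y δ n hσ) ∧
          IsEssSup μ (stoppingRewards μ (fun t ω => Y t ω + Zr t ω) hσ) (value μ Y δ n hσ)) := by
  obtain ⟨k, rfl⟩ : ∃ k, n = k + 1 := ⟨n - 1, (Nat.sub_add_cancel hn).symm⟩
  have hY : IsReward μ Y := ⟨fun t => ((hY_adapted t).mono (𝔉.le t)).measurable, hY_nonneg,
    hY_rightCont, hY_sup⟩
  have hδ' : ∀ i, Measurable (shift δ i) := fun i => hδ (i + 1)
  refine ⟨fun t => ⟨isEssSup_value hY hδ' _, integrable_value hY hδ' _⟩,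
    exists_isRightContinuousModification_continuation hF_rightCont hF_complete hY hδ,
    fun Zr hZ => ⟨stronglyAdapted_totalReward hF_complete hY_adapted hZ,
      rightContinuousPaths_totalReward hY_rightCont hZ.1,
      fun τ hτ => integrable_atTime_totalReward hY hY_adapted hδ hZ hτ,
      fun σ hσ => ⟨isEssSup_valueDisc hY hδ hσ, isEssSup_stoppingRewards hY hY_adapted hδ hZ hσ⟩,
      fun hδ_stop σ hσ => ?_⟩⟩
  have hvalue := isEssSup_value (k := k + 1) hY hδ hσ
  exact ⟨hvalue, (isEssSup_stoppingRewards hY hY_adapted hδ hZ hσ).congr hvalue.measurable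
    (valueDisc_ae_eq_value hF_rightCont hY hδ (fun i hi => hδ_stop i (Nat.succ_lt_succ hi)) hσ)⟩
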